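/- **Setting.** Let $N,M\ge 1$, $u\in(0,1)^N$, $v\in(0,1)^M$, and let $W=uv^\top$. Assume that the best row and the best column are unique, i.e. $u$ and $v$ each have a unique maximal entry; write $u_1=\max_i u_i$, $v_1=\max_j v_j$, $\Delta_i^U=u_1-u_i$, $\Delta_j^V=v_1-v_j$. Playing the pair $(i,j)$ as the $t$-th pair shows $x_{i,j,t}=u_iv_j+\varepsilon_{i,j,t}$, where the $\varepsilon_{i,j,t}$ are independent, zero-mean and sub-Gaussian with variance proxy $1/4$, i.e. $\mathbb E[e^{\lambda\varepsilon_{i,j,t}}]\le e^{\lambda^2/8}$ for all $\lambda\in\mathbb R$ (for instance, rewards in $[0,1]$). If $(i_t,j_t)$ is the $t$-th pair played, the regret is $R(T)=T\,u_1v_1-\sum_{t=1}^T u_{i_t}v_{j_t}$. **Algorithm (Pair-Elim with precision $\delta$).** It keeps domination maps $h^U$ on rows and $h^V$ on columns (initially the identity), whose images $I=h^U([N])$, $J=h^V([M])$ are the active rows and columns, and a window index $w=0,1,2,\dots$ For a precision $\beta$ let $k_l=\lceil 4^{l+1}\log\beta\rceil$, $l\ge1$. Each row has one statistic per column and one aggregated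 over all columns; each column has one statistic per row and one aggregated over all rows. Whenever the sample size of a statistic equals some $k_l$, its confidence interval becomes (empirical mean) $\pm\sqrt{\log\beta/k_l}$; otherwise the interval is left unchanged (initially $(-\infty,\infty)$). Rows use all samples collected for rows since the start and $\beta=1/\delta$; columns use the samples collected for columns in the current window and $\beta=2^{2^w}$. An item is dominated by another one if for some common statistic its upper bound is below the other's lower bound. Each step does the following. 1. Update all confidence intervals. Eliminate dominated active items: let $g$ send each active item that is dominated by active items to the largest index among those, and fix every other active item; replace $h^U$ by the composition of $h^U$ with the $N$-fold iterate of $g$, and likewise $h^V$ with the $M$-fold iterate, so that eliminated items are mapped along the dominations to items that remain active. 2. Draw a uniform column $b$ and play all active rows against $h^V(b)$; these are the samples collected for rows. Draw a uniform row $a$ and play $h^U(a)$ against all active columns; these are the samples collected for columns. All draws are independent of each other and of the noise. 3. If more than $2^{2^w}$ pairs have been played in the current window, increase $w$ by one, discard all samples and confidence intervals on columns, and make all columns active again ($h^V=\mathrm{id}$). **Theorem.** There is a universal constant $c>0$ such that for all $N,M,u,v$ as above there is a constant $c_{\mathfrak p}$, depending only on $(N,M,u,v)$, such that for every noise as above and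 every integer $T\ge 3$, Pair-Elim run with $\delta=1/T$ satisfies $$\mathbb E[R(T)]\le c\,A(u,v)\log T+c_{\mathfrak p}\log\log T,\qquad A(u,v)=\sum_{i:\Delta_i^U>0}\frac1{v_1\Delta_i^U}+\sum_{j:\Delta_j^V>0}\frac1{u_1\Delta_j^V}.$$ -/

import Mathlib

open MeasureTheory ProbabilityTheory

noncomputable section

namespace PairElim

/-! ## Confidence bounds and domination map

These are written once, for "items" `ι` that are compared against "opponents" `κ`.  For rows the
items are the rows and the opponents the columns; for columns it is the other way round.
The index `none` stands for the statistic that aggregates all opponents. -/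

/-- The statistic of item `i` against opponent `k`, or aggregated over all opponents. -/
def stat {ι κ α : Type} [Fintype κ] [AddCommMonoid α] (S : ι → κ → α) : Option κ → ι → α
  | none, i => ∑ k, S i k
  | some k, i => S i k

/-- The sample sizes `k_l = ⌈4 ^ (l + 1) * log β⌉` at which confidence bounds are recomputed. -/
def level (β : ℝ) (l : ℕ) : ℕ := ⌈(4 : ℝ) ^ (l + 1) * Real.log β⌉₊

/-- `n` is one of the update sample sizes `k_l`, `l > 0`. -/
def IsLevel (β : ℝ) (n : ℕ) : Prop := ∃ l : ℕ, 0 < l ∧ n = level β l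

/-- Lower and upper confidence bounds; `⊥` and `⊤` as long as no bound has been computed. -/
structure Bounds (ι κ : Type) where
  lo : Option κ → ι → EReal
  hi : Option κ → ι → EReal

/-- No information. -/
def Bounds.init (ι κ : Type) : Bounds ι κ where
  lo := fun _ _ => ⊥
  hi := fun _ _ => ⊤

open Classical in
/-- Recompute the bounds whose sample size is one of the `k_l`; all others stay unchanged.
`S` holds the sums of the observations, `C` their numbers. -/
def confidenceBound {ι κ : Type} [Fintype κ] (β : ℝ) (S : ι → κ → ℝ) (C : ι → κ → ℕ)
    (Q : Bounds ι κ) : Bounds ι κ where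
  lo := fun k i =>
    if IsLevel β (stat C k i) then
      ((stat S k i / ((stat C k i : ℕ) : ℝ) - √(Real.log β / ((stat C k i : ℕ) : ℝ)) : ℝ) : EReal)
    else Q.lo k i
  hi := fun k i =>
    if IsLevel β (stat C k i) then
      ((stat S k i / ((stat C k i : ℕ) : ℝ) + √(Real.log β / ((stat C k i : ℕ) : ℝ)) : ℝ) : EReal)
    else Q.hi k i

/-- Item `i` is provably dominated by item `j`. -/
def Bounds.Dominated {ι κ : Type} (Q : Bounds ι κ) (i j : ι) : Prop :=
  ∃ k : Option κ, Q.hi k i < Q.lo k j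

/-- The active items: the image of the domination map. -/
def active {n : ℕ} (h : Fin n → Fin n) : Finset (Fin n) := Finset.univ.image h

open Classical in
/-- The items of `I` that dominate `i`. -/
def dominators {n : ℕ} {κ : Type} (Q : Bounds (Fin n) κ) (I : Finset (Fin n)) (i : Fin n) :
    Finset (Fin n) :=
  I.filter fun j => Q.Dominated i j

open Classical in
/-- A dominated item is sent to the largest index among the items of `I` that dominate it;
an undominated item is fixed. -/
def redirect {n : ℕ} {κ : Type} (Q : Bounds (Fin n) κ) (I : Finset (Fin n)) (i : Fin n) : Fin n :=
  if h : (dominators Q I i).Nonempty then (dominators Q I i).max' h else i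

/-- Update of the domination map: dominated active items are eliminated and every item that was
mapped to an eliminated one is sent along the dominations to an active item that remains.
(`n` iterations reach the end of every chain of dominations.) -/
def dominationMap {n : ℕ} {κ : Type} (Q : Bounds (Fin n) κ) (h : Fin n → Fin n) :
    Fin n → Fin n :=
  fun i => (redirect Q (active h))^[n] (h i)

/-! ## The algorithm -/

/-- The memory of the algorithm with `N` rows and `M` columns. -/
structure State (N M : ℕ) where
  /-- number of pairs played so far -/
  t : ℕ
  /-- index of the current time window -/
  w : ℕ
  /-- number of pairs played in the current time window -/
  s : ℕ
  /-- sums of the observations used for rows (whole run) -/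
  X : Fin N → Fin M → ℝ
  /-- numbers of the observations used for rows (whole run) -/
  C : Fin N → Fin M → ℕ
  /-- sums of the observations used for columns (current window) -/
  Xw : Fin N → Fin M → ℝ
  /-- numbers of the observations used for columns (current window) -/
  Cw : Fin N → Fin M → ℕ
  /-- confidence bounds on rows -/
  QU : Bounds (Fin N) (Fin M)
  /-- confidence bounds on columns -/
  QV : Bounds (Fin M) (Fin N)
  /-- domination map on rows -/
  hU : Fin N → Fin N
  /-- domination map on columns -/
  hV : Fin M → Fin M

variable {N M : ℕ}

/-- The initial memory. -/
def State.init (N M : ℕ) : State N M where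
  t := 0
  w := 0
  s := 0
  X := fun _ _ => 0
  C := fun _ _ => 0
  Xw := fun _ _ => 0
  Cw := fun _ _ => 0
  QU := Bounds.init _ _
  QV := Bounds.init _ _
  hU := id
  hV := id

/-- The length `2 ^ 2 ^ w` of window `w`. -/
def blockLength (w : ℕ) : ℕ := 2 ^ 2 ^ w

/-- First part of a step: update confidence bounds and domination maps.  Rows use the precision
parameter `1 / δ`, columns the length of the current window. -/
def State.refresh (δ : ℝ) (σ : State N M) : State N M :=
  let QV' := confidenceBound (blockLength σ.w : ℝ) (fun j i => σ.Xw i j) (fun j i => σ.Cw i j) σ.QV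
  let QU' := confidenceBound (1 / δ) σ.X σ.C σ.QU
  { σ with
    QV := QV'
    hV := dominationMap QV' σ.hV
    QU := QU'
    hU := dominationMap QU' σ.hU }

/-- Active rows. -/
def State.I (σ : State N M) : Finset (Fin N) := active σ.hU

/-- Active columns. -/
def State.J (σ : State N M) : Finset (Fin M) := active σ.hV

/-- The pairs played in one step, in order: all active rows against the column `hV b`, then all
active columns against the row `hU a`. -/
def State.pulls (σ : State N M) (a : Fin N) (b : Fin M) : List (Fin N × Fin M) :=
  (σ.I.sort (· ≤ ·)).map (fun i => (i, σ.hV b)) ++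
    (σ.J.sort (· ≤ ·)).map (fun j => (σ.hU a, j))

/-- Time at which active row `i` is played in the first half of a step. -/
def State.rowTime (σ : State N M) (i : Fin N) : ℕ := σ.t + (σ.I.filter (· < i)).card

/-- Time at which active column `j` is played in the second half of a step. -/
def State.colTime (σ : State N M) (j : Fin M) : ℕ :=
  σ.t + σ.I.card + (σ.J.filter (· < j)).card

/-- Second part of a step: sampling.  Here `x t i j` is what is observed if the pair `(i, j)` is
played at time `t`, and `a`, `b` are the random row and the random column of the step. -/
def State.sample (x : ℕ → Fin N → Fin M → ℝ) (a : Fin N) (b : Fin M) (σ : State N M) :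
    State N M :=
  { σ with
    X := fun i j => σ.X i j + if i ∈ σ.I ∧ j = σ.hV b then x (σ.rowTime i) i j else 0
    C := fun i j => σ.C i j + if i ∈ σ.I ∧ j = σ.hV b then 1 else 0
    Xw := fun i j => σ.Xw i j + if i = σ.hU a ∧ j ∈ σ.J then x (σ.colTime j) i j else 0
    Cw := fun i j => σ.Cw i j + if i = σ.hU a ∧ j ∈ σ.J then 1 else 0
    s := σ.s + σ.I.card + σ.J.card
    t := σ.t + σ.I.card + σ.J.card }

/-- Third part of a step: if the window is over, start the next one, in which all columns are
active again and the statistics on columns start afresh. -/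
def State.closeWindow (σ : State N M) : State N M :=
  if blockLength σ.w < σ.s then
    { σ with
      w := σ.w + 1
      s := 0
      Xw := fun _ _ => 0
      Cw := fun _ _ => 0
      QV := Bounds.init _ _
      hV := id }
  else σ

/-- The memory before step `n`.  `a n` and `b n` are the random row and column of step `n`. -/
def run (δ : ℝ) (x : ℕ → Fin N → Fin M → ℝ) (a : ℕ → Fin N) (b : ℕ → Fin M) : ℕ → State N M
  | 0 => State.init N M
  | n + 1 => (((run δ x a b n).refresh δ).sample x (a n) (b n)).closeWindow

/-- The sequence of all pairs played in the first `n` steps. -/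
def played (δ : ℝ) (x : ℕ → Fin N → Fin M → ℝ) (a : ℕ → Fin N) (b : ℕ → Fin M) :
    ℕ → List (Fin N × Fin M)
  | 0 => []
  | n + 1 => played δ x a b n ++ ((run δ x a b n).refresh δ).pulls (a n) (b n)

/-! ## Regret and gaps -/

/-- Regret over the first `T` played pairs.  (Every step plays at least two pairs, so that `T`
steps contain the first `T` played pairs.) -/
def regret (u : Fin N → ℝ) (v : Fin M → ℝ) (δ : ℝ) (x : ℕ → Fin N → Fin M → ℝ)
    (a : ℕ → Fin N) (b : ℕ → Fin M) (T : ℕ) : ℝ :=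
  (T : ℝ) * (⨆ p : Fin N × Fin M, u p.1 * v p.2) -
    (((played δ x a b T).take T).map fun p => u p.1 * v p.2).sum

/-- The gap `max u - u i`. -/
def gap {n : ℕ} (u : Fin n → ℝ) (i : Fin n) : ℝ := (⨆ i', u i') - u i

open Classical in
/-- The complexity `A(u, v)`. -/
def complexityA (u : Fin N → ℝ) (v : Fin M → ℝ) : ℝ :=
  (∑ i ∈ Finset.univ.filter (fun i => 0 < gap u i), 1 / ((⨆ j, v j) * gap u i)) +
    ∑ j ∈ Finset.univ.filter (fun j => 0 < gap v j), 1 / ((⨆ i, u i) * gap v j)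

/-! ## The random environment -/

/-- The sources of randomness: noise variables `ε t i j`, and the random row `a n` and random
column `b n` drawn by the algorithm in step `n`. -/
abbrev Source (N M : ℕ) : Type := (ℕ × Fin N × Fin M) ⊕ (ℕ ⊕ ℕ)

/-- The σ-algebra generated by each source of randomness. -/
@[reducible] def sourceSigma {Ω : Type*} (ε : ℕ → Fin N → Fin M → Ω → ℝ) (a : ℕ → Ω → Fin N)
    (b : ℕ → Ω → Fin M) : Source N M → MeasurableSpace Ω
  | Sum.inl (t, i, j) => MeasurableSpace.comap (ε t i j) inferInstance
  | Sum.inr (Sum.inl n) => MeasurableSpace.comap (a n) ⊤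
  | Sum.inr (Sum.inr n) => MeasurableSpace.comap (b n) ⊤

/-- Independent zero-mean noise, sub-Gaussian with variance proxy `1 / 4` (as centred variables
with values in an interval of length one), and independent uniform draws. -/
structure IsEnvironment {Ω : Type*} [MeasurableSpace Ω] (μ : Measure Ω)
    (ε : ℕ → Fin N → Fin M → Ω → ℝ) (a : ℕ → Ω → Fin N) (b : ℕ → Ω → Fin M) : Prop where
  measurable_noise : ∀ t i j, Measurable (ε t i j)
  mean_zero : ∀ t i j, ∫ ω, ε t i j ω ∂μ = 0
  subgaussian : ∀ t i j, HasSubgaussianMGF (ε t i j) (1 / 4) μ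
  measurable_row : ∀ n, Measurable (a n)
  uniform_row : ∀ n i, μ (a n ⁻¹' {i}) = (N : ENNReal)⁻¹
  measurable_col : ∀ n, Measurable (b n)
  uniform_col : ∀ n j, μ (b n ⁻¹' {j}) = (M : ENNReal)⁻¹
  indep : iIndep (sourceSigma ε a b) μ

end PairElim

end

/-!
The algorithm is analysed realization by realization, on the event that no statistic leaves its
confidence width; randomness enters only through the probability of the complementary events.

*Races.*  Rows during the whole run, and columns during one time window, follow the same rules
(`IsRace`): in each step all active items meet the same opponent.  Hence at each time all active
items have the same counts, and the means of a given statistic are `u i * θ` with a common factor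
`θ ≥ 0`.  As long as the confidence intervals are correct, an item is therefore dominated only by
strictly better items, the best item survives, and domination maps lead to better items.  The
aggregated statistic of an active item has as many samples as there were steps, so a suboptimal
item with gap `g` that survives an update after `n` steps satisfies `g * Θ ≤ 4 √(n log β)`, where
`Θ` is the sum of the weights of the opponents met so far (`IsRace.gap_mul_le`).  If all but `B`
opponents have weight at least `c`, the item is gone after order `log β / (g c) ^ 2 + B` steps
(`IsRace.time_le`).

*Rows.*  With the smallest column entry as `c`, all suboptimal rows are gone after a number of
steps of order `log T`, with a problem dependent constant.  The windows that begin before that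
time satisfy `2 ^ w ≤ Λ` with `Λ = O(log log T)`; windows with this property are called early.  In
an early window without failure, suboptimal columns survive at most `O(2 ^ w)` steps, which amounts
to `O(log log T)` steps altogether.  In all other early steps a row meets the best column, so that `time_le` with `c = v₁`
gives the cost `O(log T / (v₁ Δᵢ))` of row `i` (`card_row_active_le`).

*Columns.*  In a late window only the best row is left, and `time_le` with `c = u₁` gives the cost
`O(2 ^ w / (u₁ Δⱼ))` of column `j`.  Window lengths are doubly exponential, so the sum of `2 ^ w`
over all windows is `O(log T)` (`card_lateSteps_le`).  Together these bounds give
`regret_le_of_rowAccurate`.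

*Failures.*  The noise of a statistic is sampled adaptively, but a variable with time `t` is chosen
on the basis of the noise before `t` and of the draws.  The products of the factors
`exp (l * ε - l ^ 2 / 8)` over the sampled variables therefore have mean at most one
(`lintegral_tilt_le`).  Stopping the product after `n` samples and taking `l = ±4 √(log β / n)`
bounds the probability of a failure with sample size `n` by `β⁻²`.  A union bound over `n ≤ β`
leaves a probability `O(1 / β)`, while the cost of a failure is at most the number of steps
concerned, which is of order `β`: for rows `β = T`, for window `w` it is the length of the window.
So row failures cost `O(1)`, and column failures cost `O(1)` per window, of which there are
`O(log log T)`.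
-/

noncomputable section

namespace PairElim

/-! ### Domination maps -/

section Domination

variable {n : ℕ} {κ : Type}

lemma redirect_mem {Q : Bounds (Fin n) κ} {I : Finset (Fin n)} {i : Fin n} (hi : i ∈ I) :
    redirect Q I i ∈ I := by
  classical
  unfold redirect
  split_ifs with h
  · have := Finset.max'_mem _ h
    unfold dominators at this
    exact (Finset.mem_filter.1 this).1
  · exact hi

lemma redirect_of_dominated {Q : Bounds (Fin n) κ} {I : Finset (Fin n)} {i j : Fin n}
    (hj : j ∈ I) (hd : Q.Dominated i j) : Q.Dominated i (redirect Q I i) := by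
  classical
  have h : (dominators Q I i).Nonempty := ⟨j, by simp [dominators, hj, hd]⟩
  unfold redirect
  rw [dif_pos h]
  have := Finset.max'_mem _ h
  unfold dominators at this
  exact (Finset.mem_filter.1 this).2

lemma redirect_eq_or {Q : Bounds (Fin n) κ} {I : Finset (Fin n)} {i : Fin n} :
    redirect Q I i = i ∨ Q.Dominated i (redirect Q I i) := by
  classical
  by_cases h : ∃ j ∈ I, Q.Dominated i j
  · obtain ⟨j, hj, hd⟩ := h
    exact Or.inr (redirect_of_dominated hj hd)
  · left
    unfold redirect
    rw [dif_neg]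
    rintro ⟨j, hj⟩
    simp only [dominators, Finset.mem_filter] at hj
    exact h ⟨j, hj⟩

variable {Q : Bounds (Fin n) κ} {I : Finset (Fin n)} {u : Fin n → ℝ}

lemma iterate_redirect_mem {i : Fin n} (hi : i ∈ I) (m : ℕ) : (redirect Q I)^[m] i ∈ I := by
  induction m with
  | zero => exact hi
  | succ m ih => rw [Function.iterate_succ_apply']; exact redirect_mem ih

/-- Redirection only ever moves an item to a strictly better one, provided that every domination
is a true one. -/
lemma le_iterate_redirect (hQ : ∀ i ∈ I, ∀ j ∈ I, Q.Dominated i j → u i < u j) {i : Fin n}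
    (hi : i ∈ I) (m : ℕ) : u i ≤ u ((redirect Q I)^[m] i) := by
  induction m with
  | zero => exact le_rfl
  | succ m ih =>
    rw [Function.iterate_succ_apply']
    have hm := iterate_redirect_mem (Q := Q) hi m
    rcases redirect_eq_or (Q := Q) (I := I) (i := (redirect Q I)^[m] i) with h | h
    · rw [h]; exact ih
    · exact ih.trans (hQ _ hm _ (redirect_mem hm) h).le

/-- Along the iterates the number of strictly better items decreases until a fixed point is
reached, so that `n` iterations reach one. -/
lemma redirect_iterate_fixed (hQ : ∀ i ∈ I, ∀ j ∈ I, Q.Dominated i j → u i < u j) {i : Fin n}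
    (hi : i ∈ I) : redirect Q I ((redirect Q I)^[n] i) = (redirect Q I)^[n] i := by
  classical
  have key : ∀ m, redirect Q I ((redirect Q I)^[m] i) = (redirect Q I)^[m] i ∨
      (Finset.univ.filter fun j => u ((redirect Q I)^[m] i) < u j).card + m < n := by
    intro m
    induction m with
    | zero =>
      right
      have : (Finset.univ.filter fun j => u i < u j) ⊂ Finset.univ :=
        (Finset.ssubset_univ_iff).2 fun h => by
          have := Finset.mem_univ i
          rw [← h] at this
          simp at this
      have := Finset.card_lt_card this
      rw [Finset.card_univ, Fintype.card_fin] at this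
      simp only [Function.iterate_zero, id, add_zero]
      refine (Finset.card_le_card fun j hj => ?_).trans_lt this
      exact Finset.mem_filter.2 ⟨Finset.mem_univ _, (Finset.mem_filter.1 hj).2⟩
    | succ m ih =>
      have hm := iterate_redirect_mem (Q := Q) hi m
      rw [Function.iterate_succ_apply']
      rcases ih with h | h
      · left; rw [h, h]
      · rcases redirect_eq_or (Q := Q) (I := I) (i := (redirect Q I)^[m] i) with h' | h'
        · left; rw [h', h']
        · right
          have hlt := hQ _ hm _ (redirect_mem hm) h'
          have : (Finset.univ.filter fun j => u (redirect Q I ((redirect Q I)^[m] i)) < u j) ⊂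
              (Finset.univ.filter fun j => u ((redirect Q I)^[m] i) < u j) := by
            refine Finset.ssubset_iff_subset_ne.2 ⟨fun j hj => ?_, fun h => ?_⟩
            · simp only [Finset.mem_filter, Finset.mem_univ, true_and] at hj ⊢
              exact hlt.trans hj
            · have hmem : redirect Q I ((redirect Q I)^[m] i) ∈
                  (Finset.univ.filter fun j => u ((redirect Q I)^[m] i) < u j) := by
                simpa using hlt
              rw [← h] at hmem
              simp at hmem
          have := Finset.card_lt_card this
          omega
  rcases key n with h | h
  · exact h
  · omega

variable {h : Fin n → Fin n}

lemma active_dominationMap_subset : active (dominationMap Q h) ⊆ active h := by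
  intro i hi
  simp only [active, Finset.mem_image, Finset.mem_univ, true_and] at hi
  obtain ⟨j, rfl⟩ := hi
  exact iterate_redirect_mem (by simp [active]) _

lemma mem_active (i : Fin n) : h i ∈ active h := by simp [active]

/-- The items that survive an update are not dominated by any item active before the update. -/
lemma not_dominated_of_mem_active
    (hQ : ∀ i ∈ active h, ∀ j ∈ active h, Q.Dominated i j → u i < u j) {i j : Fin n}
    (hi : i ∈ active (dominationMap Q h)) (hj : j ∈ active h) : ¬ Q.Dominated i j := by
  intro hd
  have hi' := active_dominationMap_subset hi
  have h1 := redirect_of_dominated hj hd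
  have h2 := hQ _ hi' _ (redirect_mem hi') h1
  simp only [active, Finset.mem_image, Finset.mem_univ, true_and] at hi
  obtain ⟨k, rfl⟩ := hi
  have h3 := redirect_iterate_fixed hQ (mem_active (h := h) k)
  unfold dominationMap at h2
  unfold active at h2 h3
  rw [h3] at h2
  exact lt_irrefl _ h2

lemma le_dominationMap (hQ : ∀ i ∈ active h, ∀ j ∈ active h, Q.Dominated i j → u i < u j)
    (hh : ∀ i, u i ≤ u (h i)) (i : Fin n) : u i ≤ u (dominationMap Q h i) :=
  (hh i).trans (le_iterate_redirect hQ (mem_active i) _)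

end Domination

/-! ### Elimination races -/

section Race

variable {n : ℕ} {κ : Type} [Fintype κ]

/-- A race: items `Fin n` play against opponents `κ`, in step `τ` against opponent `q τ`.
`S`, `C`, `Q`, `h` are the sums and numbers of observations, the confidence bounds and the
domination map before step `τ`.  Only the steps `τ < H` have to obey the rules: the rows race
during the whole run, the columns during a single time window. -/
structure IsRace [DecidableEq κ] (β : ℝ) (H : ℕ) (S : ℕ → Fin n → κ → ℝ) (C : ℕ → Fin n → κ → ℕ)
    (Q : ℕ → Bounds (Fin n) κ) (h : ℕ → Fin n → Fin n) (q : ℕ → κ) : Prop where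
  C_zero : ∀ i k, C 0 i k = 0
  Q_zero : Q 0 = Bounds.init _ _
  h_zero : h 0 = id
  Q_succ : ∀ τ < H, Q (τ + 1) = confidenceBound β (S τ) (C τ) (Q τ)
  h_succ : ∀ τ < H, h (τ + 1) = dominationMap (Q (τ + 1)) (h τ)
  C_succ : ∀ τ < H, ∀ i ∈ active (h (τ + 1)), ∀ k,
    C (τ + 1) i k = C τ i k + if k = q τ then 1 else 0

/-- The observations `S`, `C` of items `i` with mean `u i * p k` against opponent `k` stay within
their confidence width for each statistic. -/
def Accurate (β : ℝ) (u : Fin n → ℝ) (p : κ → ℝ) (S : Fin n → κ → ℝ) (C : Fin n → κ → ℕ) : Prop :=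
  ∀ i k, 0 < stat C k i →
    |stat S k i - u i * stat (fun i k => (C i k : ℝ) * p k) k i| ≤ √(stat C k i * Real.log β)

lemma level_pos {β : ℝ} (hβ : 1 < β) (l : ℕ) : 0 < level β l := by
  unfold level
  have := Real.log_pos hβ
  exact Nat.ceil_pos.2 (by positivity)

/-- Every confidence interval of an active item contains the product of its mean with a factor
that is common to all active items. -/
def Valid (u : Fin n → ℝ) (Q : Bounds (Fin n) κ) (I : Finset (Fin n)) : Prop :=
  ∀ k, ∃ θ : ℝ, 0 ≤ θ ∧ ∀ i ∈ I, Q.lo k i ≤ ((u i * θ : ℝ) : EReal) ∧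
    ((u i * θ : ℝ) : EReal) ≤ Q.hi k i

omit [Fintype κ] in
lemma Valid.lt_of_dominated {u : Fin n → ℝ} {Q : Bounds (Fin n) κ} {I : Finset (Fin n)}
    (hV : Valid u Q I) : ∀ i ∈ I, ∀ j ∈ I, Q.Dominated i j → u i < u j := by
  rintro i hi j hj ⟨k, hk⟩
  obtain ⟨θ, hθ, h⟩ := hV k
  have h1 : ((u i * θ : ℝ) : EReal) < ((u j * θ : ℝ) : EReal) :=
    ((h i hi).2.trans_lt hk).trans_le (h j hj).1
  exact lt_of_mul_lt_mul_right (EReal.coe_lt_coe_iff.1 h1) hθ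

omit [Fintype κ] in
lemma Valid.mono {u : Fin n → ℝ} {Q : Bounds (Fin n) κ} {I I' : Finset (Fin n)}
    (hV : Valid u Q I) (hI : I' ⊆ I) : Valid u Q I' := fun k =>
  let ⟨θ, hθ, h⟩ := hV k
  ⟨θ, hθ, fun i hi => h i (hI hi)⟩

lemma stat_congr {ι α : Type} [AddCommMonoid α] {S S' : ι → κ → α} {i i' : ι}
    (h : ∀ k, S i k = S' i' k) (k : Option κ) : stat S k i = stat S' k i' := by
  cases k <;> simp [stat, h]

lemma stat_nonneg {ι : Type} {S : ι → κ → ℝ} {i : ι} (h : ∀ k, 0 ≤ S i k) (k : Option κ) :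
    0 ≤ stat S k i := by
  cases k
  · exact Finset.sum_nonneg fun k _ => h k
  · exact h _

/-- The width of a confidence interval, in terms of sums. -/
lemma sqrt_mul_div {a L : ℝ} (ha : 0 < a) : √(a * L) / a = √(L / a) := by
  rw [Real.sqrt_mul ha.le, Real.sqrt_div' _ ha.le]
  have : √a ≠ 0 := (Real.sqrt_pos.2 ha).ne'
  field_simp
  rw [Real.sq_sqrt ha.le, mul_comm]

lemma Valid.confidenceBound {u : Fin n → ℝ} {p : κ → ℝ} (hp : ∀ k, 0 ≤ p k) {β : ℝ} (hβ : 1 < β)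
    {S : Fin n → κ → ℝ} {C : Fin n → κ → ℕ} {Q : Bounds (Fin n) κ} {I : Finset (Fin n)}
    (hV : Valid u Q I) (hA : Accurate β u p S C) (hC : ∀ i ∈ I, ∀ j ∈ I, ∀ k, C i k = C j k) :
    Valid u (confidenceBound β S C Q) I := by
  classical
  intro k
  by_cases hne : ∃ i₀ ∈ I, IsLevel β (stat C k i₀)
  · obtain ⟨i₀, hi₀, hl⟩ := hne
    have hpos : 0 < stat C k i₀ := by
      obtain ⟨l, -, h⟩ := hl
      rw [h]; exact level_pos hβ l
    have hpos' : (0 : ℝ) < stat C k i₀ := by exact_mod_cast hpos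
    refine ⟨stat (fun i k => (C i k : ℝ) * p k) k i₀ / stat C k i₀,
      div_nonneg (stat_nonneg (S := fun i k => (C i k : ℝ) * p k)
        (fun k' => mul_nonneg (Nat.cast_nonneg _) (hp k')) k) hpos'.le,
      fun i hi => ?_⟩
    have e1 : stat C k i = stat C k i₀ := stat_congr (fun k => hC i hi i₀ hi₀ k) k
    have e2 : stat (fun i k => (C i k : ℝ) * p k) k i =
        stat (fun i k => (C i k : ℝ) * p k) k i₀ :=
      stat_congr (fun k => by simp only [hC i hi i₀ hi₀ k]) k
    have hdev := hA i k (by rw [e1]; exact hpos)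
    rw [e1, e2, abs_le] at hdev
    simp only [PairElim.confidenceBound, e1, hl, if_true, EReal.coe_le_coe_iff]
    rw [← sqrt_mul_div hpos', ← sub_div, ← add_div, ← mul_div_assoc]
    constructor
    · gcongr; linarith [hdev.2]
    · gcongr; linarith [hdev.1]
  · push Not at hne
    obtain ⟨θ, hθ, h⟩ := hV k
    refine ⟨θ, hθ, fun i hi => ?_⟩
    simp only [PairElim.confidenceBound, hne i hi, if_false]
    exact h i hi

namespace IsRace

variable [DecidableEq κ] {β : ℝ} {H : ℕ} {S : ℕ → Fin n → κ → ℝ} {C : ℕ → Fin n → κ → ℕ}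
  {Q : ℕ → Bounds (Fin n) κ} {h : ℕ → Fin n → Fin n} {q : ℕ → κ} {u : Fin n → ℝ} {p : κ → ℝ}

/-- The items that are active after the update in step `τ`. -/
def survivors (β : ℝ) (S : ℕ → Fin n → κ → ℝ) (C : ℕ → Fin n → κ → ℕ)
    (Q : ℕ → Bounds (Fin n) κ) (h : ℕ → Fin n → Fin n) (τ : ℕ) : Finset (Fin n) :=
  active (dominationMap (confidenceBound β (S τ) (C τ) (Q τ)) (h τ))

lemma active_succ (hR : IsRace β H S C Q h q) {τ : ℕ} (hτ : τ < H) :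
    active (h (τ + 1)) = survivors β S C Q h τ := by
  rw [survivors, hR.h_succ τ hτ, hR.Q_succ τ hτ]

/-- The number of the first `τ` steps in which the opponent is `k`. -/
def meetings (q : ℕ → κ) (τ : ℕ) (k : κ) : ℕ :=
  ((Finset.range τ).filter fun s => q s = k).card

lemma count_eq (hR : IsRace β H S C Q h q) {τ : ℕ} (hτ : τ ≤ H) :
    ∀ i ∈ active (h τ), ∀ k, C τ i k = meetings q τ k := by
  induction τ with
  | zero => intro i _ k; simp [hR.C_zero, meetings]
  | succ τ ih =>
    intro i hi k
    have hi' : i ∈ active (h τ) := by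
      rw [hR.h_succ τ hτ] at hi
      exact active_dominationMap_subset hi
    rw [hR.C_succ τ hτ i hi, ih (by omega) i hi', meetings, meetings, Finset.range_add_one,
      Finset.filter_insert]
    by_cases hk : q τ = k
    · subst hk; simp
    · have : ¬ k = q τ := fun h => hk h.symm
      simp [hk, this]

lemma active_anti (hR : IsRace β H S C Q h q) {τ τ' : ℕ} (hττ' : τ ≤ τ') (hτ : τ' ≤ H) :
    active (h τ') ⊆ active (h τ) := by
  induction τ', hττ' using Nat.le_induction with
  | base => exact subset_rfl
  | succ τ' _ ih =>
    rw [hR.h_succ τ' hτ]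
    exact active_dominationMap_subset.trans (ih (by omega))

lemma survivors_anti (hR : IsRace β H S C Q h q) {τ τ' : ℕ} (hττ' : τ ≤ τ') (hτ : τ' ≤ H) :
    survivors β S C Q h τ' ⊆ survivors β S C Q h τ := by
  rcases hττ'.eq_or_lt with rfl | hlt
  · exact subset_rfl
  · rw [← hR.active_succ (by omega : τ < H)]
    exact active_dominationMap_subset.trans (hR.active_anti hlt hτ)

lemma valid_and_le (hR : IsRace β H S C Q h q) (hβ : 1 < β) (hp : ∀ k, 0 ≤ p k)
    (hA : ∀ τ ≤ H, Accurate β u p (S τ) (C τ)) {τ : ℕ} (hτ : τ ≤ H) :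
    Valid u (Q τ) (active (h τ)) ∧ ∀ i, u i ≤ u (h τ i) := by
  classical
  induction τ with
  | zero =>
    refine ⟨fun k => ⟨0, le_rfl, fun i _ => ?_⟩, fun i => by rw [hR.h_zero]; rfl⟩
    rw [hR.Q_zero]; simp [Bounds.init]
  | succ τ ih =>
    obtain ⟨h1, h2⟩ := ih (by omega)
    have h3 : Valid u (Q (τ + 1)) (active (h τ)) := by
      rw [hR.Q_succ τ hτ]
      refine h1.confidenceBound hp hβ (hA τ (by omega)) fun i hi j hj k => ?_
      rw [hR.count_eq (by omega) i hi, hR.count_eq (by omega) j hj]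
    rw [hR.h_succ τ hτ]
    exact ⟨h3.mono active_dominationMap_subset, le_dominationMap h3.lt_of_dominated h2⟩

lemma valid_confidenceBound (hR : IsRace β H S C Q h q) (hβ : 1 < β) (hp : ∀ k, 0 ≤ p k)
    (hA : ∀ τ ≤ H, Accurate β u p (S τ) (C τ)) {τ : ℕ} (hτ : τ ≤ H) :
    Valid u (confidenceBound β (S τ) (C τ) (Q τ)) (active (h τ)) := by
  classical
  refine (hR.valid_and_le hβ hp hA hτ).1.confidenceBound hp hβ (hA τ hτ) fun i hi j hj k => ?_
  rw [hR.count_eq hτ i hi, hR.count_eq hτ j hj]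

lemma le_update (hR : IsRace β H S C Q h q) (hβ : 1 < β) (hp : ∀ k, 0 ≤ p k)
    (hA : ∀ τ ≤ H, Accurate β u p (S τ) (C τ)) {τ : ℕ} (hτ : τ ≤ H) (i : Fin n) :
    u i ≤ u (dominationMap (confidenceBound β (S τ) (C τ) (Q τ)) (h τ) i) :=
  le_dominationMap (hR.valid_confidenceBound hβ hp hA hτ).lt_of_dominated
    (hR.valid_and_le hβ hp hA hτ).2 i

/-- The best item survives. -/
lemma best_mem_survivors (hR : IsRace β H S C Q h q) (hβ : 1 < β) (hp : ∀ k, 0 ≤ p k)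
    (hA : ∀ τ ≤ H, Accurate β u p (S τ) (C τ)) {i₀ : Fin n} (h₀ : ∀ i, i ≠ i₀ → u i < u i₀)
    {τ : ℕ} (hτ : τ ≤ H) : i₀ ∈ survivors β S C Q h τ := by
  have h1 := hR.le_update hβ hp hA hτ i₀
  have h2 : dominationMap (confidenceBound β (S τ) (C τ) (Q τ)) (h τ) i₀ = i₀ := by
    by_contra hne
    exact absurd (h₀ _ hne) (not_lt.2 h1)
  have h3 := mem_active (h := dominationMap (confidenceBound β (S τ) (C τ) (Q τ)) (h τ)) i₀
  rwa [h2] at h3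

lemma sum_meetings (τ : ℕ) (p : κ → ℝ) :
    ∑ k, (meetings q τ k : ℝ) * p k = ∑ s ∈ Finset.range τ, p (q s) := by
  rw [← Finset.sum_fiberwise_of_maps_to (t := Finset.univ) (g := q) (fun _ _ => Finset.mem_univ _)]
  refine Finset.sum_congr rfl fun k _ => ?_
  rw [Finset.sum_congr rfl fun s hs => by rw [(Finset.mem_filter.1 hs).2]]
  simp [meetings]

/-- An item that survives an update of the aggregated statistic is not much worse than the best
one, measured by the sum of the weights of the opponents met so far. -/
lemma gap_mul_le (hR : IsRace β H S C Q h q) (hβ : 1 < β) (hp : ∀ k, 0 ≤ p k)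
    (hA : ∀ τ ≤ H, Accurate β u p (S τ) (C τ)) {i₀ : Fin n} (h₀ : ∀ i, i ≠ i₀ → u i < u i₀)
    {τ : ℕ} (hτ : τ ≤ H) (hl : IsLevel β τ) {i : Fin n} (hi : i ∈ survivors β S C Q h τ) :
    (u i₀ - u i) * ∑ s ∈ Finset.range τ, p (q s) ≤ 4 * √(τ * Real.log β) := by
  classical
  have hia := active_dominationMap_subset hi
  have hia₀ := active_dominationMap_subset (hR.best_mem_survivors hβ hp hA h₀ hτ)
  have hnd := not_dominated_of_mem_active
    (hR.valid_confidenceBound hβ hp hA hτ).lt_of_dominated hi hia₀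
  have hcount : ∀ j ∈ active (h τ), stat (C τ) none j = τ := by
    intro j hj
    simp only [stat, hR.count_eq hτ j hj]
    have := sum_meetings (q := q) τ (fun _ => (1 : ℝ))
    simp only [mul_one, Finset.sum_const, Finset.card_range, nsmul_eq_mul] at this
    exact_mod_cast this
  have hsum : ∀ j ∈ active (h τ), stat (fun i k => (C τ i k : ℝ) * p k) none j =
      ∑ s ∈ Finset.range τ, p (q s) := by
    intro j hj
    simp only [stat, hR.count_eq hτ j hj]
    exact sum_meetings τ p
  have hτ0 : 0 < τ := by
    obtain ⟨l, -, h⟩ := hl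
    rw [h]; exact level_pos hβ l
  have hτ0' : (0 : ℝ) < τ := by exact_mod_cast hτ0
  have hd := fun j hj => hA τ hτ j none (by rw [hcount j hj]; exact hτ0)
  have hdi := hd i hia
  have hd₀ := hd i₀ hia₀
  rw [hcount i hia, hsum i hia, abs_le] at hdi
  rw [hcount i₀ hia₀, hsum i₀ hia₀, abs_le] at hd₀
  have hle : stat (S τ) none i₀ / (τ : ℝ) - √(Real.log β / τ) ≤
      stat (S τ) none i / (τ : ℝ) + √(Real.log β / τ) := by
    by_contra hlt
    refine hnd ⟨none, ?_⟩
    simp only [PairElim.confidenceBound, hcount i hia, hcount i₀ hia₀, hl, if_true,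
      EReal.coe_lt_coe_iff]
    exact not_le.1 hlt
  rw [← sqrt_mul_div hτ0', ← sub_div, ← add_div, div_le_div_iff_of_pos_right hτ0'] at hle
  rw [sub_mul]
  linarith [hdi.2, hd₀.1]

lemma level_succ_le (β : ℝ) (l : ℕ) : level β (l + 1) ≤ 4 * level β l := by
  unfold level
  refine Nat.ceil_le.2 ?_
  push_cast
  have := Nat.le_ceil ((4 : ℝ) ^ (l + 1) * Real.log β)
  calc (4 : ℝ) ^ (l + 1 + 1) * Real.log β = 4 * (4 ^ (l + 1) * Real.log β) := by ring
    _ ≤ _ := by gcongr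

lemma exists_level {β : ℝ} (hβ : 1 < β) {τ : ℕ} (h : level β 1 ≤ τ) :
    ∃ n, IsLevel β n ∧ n ≤ τ ∧ τ + 1 ≤ 4 * n := by
  by_contra hcon
  push Not at hcon
  have key : ∀ l, level β (l + 1) ≤ τ := by
    intro l
    induction l with
    | zero => exact h
    | succ l ih =>
      have := hcon _ ⟨l + 1, by omega, rfl⟩ ih
      have := level_succ_le β (l + 1)
      omega
  have hlog := Real.log_pos hβ
  have hgrow : ∀ l : ℕ, (4 : ℝ) ^ (l + 2) * Real.log β ≤ τ := fun l =>
    (Nat.le_ceil _).trans (Nat.cast_le.2 (key l))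
  obtain ⟨l, hl⟩ := pow_unbounded_of_one_lt ((τ : ℝ) / Real.log β) (by norm_num : (1 : ℝ) < 4)
  rw [div_lt_iff₀ hlog] at hl
  have h1 := hgrow l
  have h2 : (4 : ℝ) ^ l * Real.log β ≤ 4 ^ (l + 2) * Real.log β := by
    gcongr
    · norm_num
    · omega
  linarith

/-- The elimination time of a suboptimal item, if all but `B` of the opponents met have weight at
least `c`. -/
lemma time_le (hR : IsRace β H S C Q h q) (hβ : 2 ≤ β) (hp : ∀ k, 0 ≤ p k)
    (hA : ∀ τ ≤ H, Accurate β u p (S τ) (C τ)) {i₀ : Fin n} (h₀ : ∀ i, i ≠ i₀ → u i < u i₀)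
    {τ : ℕ} (hτ : τ ≤ H) {i : Fin n} (hi : i ∈ survivors β S C Q h τ) (hne : i ≠ i₀)
    (hgap : u i₀ - u i ≤ 1) {c B : ℝ} (hc : 0 < c) (hc1 : c ≤ 1) (hB : 0 ≤ B)
    (hq : ∀ m ≤ τ, c * (m - B) ≤ ∑ s ∈ Finset.range m, p (q s)) :
    (τ + 1 : ℝ) ≤ 256 * Real.log β / ((u i₀ - u i) * c) ^ 2 + 8 * B := by
  have hg : 0 < u i₀ - u i := sub_pos.2 (h₀ i hne)
  have hgc : 0 < (u i₀ - u i) * c := mul_pos hg hc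
  have hgc1 : ((u i₀ - u i) * c) ^ 2 ≤ 1 :=
    pow_le_one₀ hgc.le (mul_le_one₀ hgap hc.le hc1)
  have hlog : (1 / 2 : ℝ) ≤ Real.log β :=
    (by linarith [Real.log_two_gt_d9] : (1 / 2 : ℝ) ≤ Real.log 2).trans
      (Real.log_le_log (by norm_num) hβ)
  rcases lt_or_ge τ (level β 1) with hlt | hge
  -- Before the first level `⌈16 log β⌉` there are no bounds and nothing is eliminated.
  · have h1 : (τ + 1 : ℝ) ≤ level β 1 := by exact_mod_cast hlt
    have h2 : (level β 1 : ℝ) < 4 ^ (1 + 1) * Real.log β + 1 :=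
      Nat.ceil_lt_add_one (by positivity)
    have h3 : 256 * Real.log β ≤ 256 * Real.log β / ((u i₀ - u i) * c) ^ 2 :=
      le_div_self (by positivity) (by positivity) hgc1
    norm_num at h2
    linarith
  -- Otherwise the item has survived the last level `m ≤ τ`, and `τ + 1 ≤ 4 * m`.
  · obtain ⟨m, hm, hmτ, h4⟩ := exists_level (by linarith) hge
    have h1 := hR.gap_mul_le (by linarith) hp hA h₀ (hmτ.trans hτ) hm
      (hR.survivors_anti hmτ hτ hi)
    have h2 := hq m hmτ
    have h4' : (τ + 1 : ℝ) ≤ 4 * m := by exact_mod_cast h4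
    rcases le_or_gt (m : ℝ) (2 * B) with hmB | hmB
    · have : 0 ≤ 256 * Real.log β / ((u i₀ - u i) * c) ^ 2 := by positivity
      linarith
    · have hm0 : (0 : ℝ) < m := by linarith
      have h5 : (u i₀ - u i) * c * m ≤ 8 * √(m * Real.log β) := by
        have : (u i₀ - u i) * (c * (m / 2)) ≤ 4 * √(m * Real.log β) := by
          refine le_trans ?_ h1
          gcongr
          refine le_trans ?_ h2
          gcongr
          linarith
        linarith
      have h6 : ((u i₀ - u i) * c * m) ^ 2 ≤ 64 * (m * Real.log β) := by
        calc _ ≤ (8 * √(m * Real.log β)) ^ 2 := by gcongr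
          _ = _ := by rw [mul_pow, Real.sq_sqrt (by positivity)]; norm_num
      have h7 : (m : ℝ) ≤ 64 * Real.log β / ((u i₀ - u i) * c) ^ 2 := by
        rw [le_div_iff₀ (by positivity)]
        have : m * (m * ((u i₀ - u i) * c) ^ 2) ≤ m * (64 * Real.log β) := by linarith
        exact le_of_mul_le_mul_left this hm0
      have h8 : 256 * Real.log β / ((u i₀ - u i) * c) ^ 2 =
          4 * (64 * Real.log β / ((u i₀ - u i) * c) ^ 2) := by ring
      linarith

end IsRace

end Race

/-! ### The states visited by the algorithm -/

section Run

variable {N M : ℕ}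

@[simp] lemma refresh_t (δ : ℝ) (σ : State N M) : (σ.refresh δ).t = σ.t := rfl
@[simp] lemma refresh_w (δ : ℝ) (σ : State N M) : (σ.refresh δ).w = σ.w := rfl
@[simp] lemma refresh_s (δ : ℝ) (σ : State N M) : (σ.refresh δ).s = σ.s := rfl
@[simp] lemma refresh_X (δ : ℝ) (σ : State N M) : (σ.refresh δ).X = σ.X := rfl
@[simp] lemma refresh_C (δ : ℝ) (σ : State N M) : (σ.refresh δ).C = σ.C := rfl
@[simp] lemma refresh_Xw (δ : ℝ) (σ : State N M) : (σ.refresh δ).Xw = σ.Xw := rfl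
@[simp] lemma refresh_Cw (δ : ℝ) (σ : State N M) : (σ.refresh δ).Cw = σ.Cw := rfl

@[simp] lemma closeWindow_t (σ : State N M) : σ.closeWindow.t = σ.t := by
  unfold State.closeWindow; split_ifs <;> rfl
@[simp] lemma closeWindow_X (σ : State N M) : σ.closeWindow.X = σ.X := by
  unfold State.closeWindow; split_ifs <;> rfl
@[simp] lemma closeWindow_C (σ : State N M) : σ.closeWindow.C = σ.C := by
  unfold State.closeWindow; split_ifs <;> rfl
@[simp] lemma closeWindow_QU (σ : State N M) : σ.closeWindow.QU = σ.QU := by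
  unfold State.closeWindow; split_ifs <;> rfl
@[simp] lemma closeWindow_hU (σ : State N M) : σ.closeWindow.hU = σ.hU := by
  unfold State.closeWindow; split_ifs <;> rfl

variable (δ : ℝ) (x : ℕ → Fin N → Fin M → ℝ) (a : ℕ → Fin N) (b : ℕ → Fin M)

/-- The memory in step `m` after the update of the confidence bounds and domination maps. -/
def updated (m : ℕ) : State N M := (run δ x a b m).refresh δ

lemma run_succ (m : ℕ) :
    run δ x a b (m + 1) = ((updated δ x a b m).sample x (a m) (b m)).closeWindow := rfl

/-- The memory at the end of step `m`, before the window is possibly closed. -/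
def sampled (m : ℕ) : State N M := (updated δ x a b m).sample x (a m) (b m)

lemma run_succ_eq (m : ℕ) :
    (blockLength (run δ x a b m).w < (sampled δ x a b m).s ∧
      run δ x a b (m + 1) = { sampled δ x a b m with
        w := (run δ x a b m).w + 1
        s := 0
        Xw := fun _ _ => 0
        Cw := fun _ _ => 0
        QV := Bounds.init _ _
        hV := id }) ∨
    ((sampled δ x a b m).s ≤ blockLength (run δ x a b m).w ∧
      run δ x a b (m + 1) = sampled δ x a b m) := by
  rw [run_succ]
  unfold State.closeWindow
  split_ifs with h
  · left; exact ⟨h, rfl⟩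
  · right; exact ⟨not_lt.1 h, rfl⟩

lemma card_I_pos (m : ℕ) : 0 < (updated δ x a b m).I.card :=
  Finset.card_pos.2 ⟨_, mem_active (a m)⟩

lemma card_J_pos (m : ℕ) : 0 < (updated δ x a b m).J.card :=
  Finset.card_pos.2 ⟨_, mem_active (b m)⟩

lemma card_I_le (σ : State N M) : σ.I.card ≤ N := by
  simpa using Finset.card_le_univ σ.I

lemma card_J_le (σ : State N M) : σ.J.card ≤ M := by
  simpa using Finset.card_le_univ σ.J

lemma run_succ_t (m : ℕ) : (run δ x a b (m + 1)).t =
    (run δ x a b m).t + (updated δ x a b m).I.card + (updated δ x a b m).J.card := by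
  rw [run_succ, closeWindow_t]; rfl

lemma run_t_le (m : ℕ) : (run δ x a b m).t ≤ m * (N + M) := by
  induction m with
  | zero => simp [run, State.init]
  | succ m ih =>
    rw [run_succ_t]
    have h1 := card_I_le (updated δ x a b m)
    have h2 := card_J_le (updated δ x a b m)
    rw [Nat.succ_mul]
    omega

lemma run_t_mono : Monotone fun m => (run δ x a b m).t :=
  monotone_nat_of_le_succ fun m => by
    simp only [run_succ_t]; omega

lemma sampled_s (m : ℕ) : (sampled δ x a b m).s =
    (run δ x a b m).s + (updated δ x a b m).I.card + (updated δ x a b m).J.card := rfl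

lemma run_s_le_t (m : ℕ) : (run δ x a b m).s ≤ (run δ x a b m).t := by
  induction m with
  | zero => simp [run, State.init]
  | succ m ih =>
    rw [run_succ_t]
    rcases run_succ_eq δ x a b m with ⟨-, h⟩ | ⟨-, h⟩
    · rw [h]; simp
    · rw [h, sampled_s]; omega

lemma run_s_le (m : ℕ) : (run δ x a b m).s ≤ blockLength (run δ x a b m).w := by
  cases m with
  | zero => simp [run, State.init]
  | succ m =>
    rcases run_succ_eq δ x a b m with ⟨-, h⟩ | ⟨h', h⟩
    · rw [h]; simp
    · rw [h]; exact h'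

lemma run_w_mono : Monotone fun m => (run δ x a b m).w :=
  monotone_nat_of_le_succ fun m => by
    rcases run_succ_eq δ x a b m with ⟨-, h⟩ | ⟨-, h⟩
    · rw [h]; simp
    · rw [h]; exact le_rfl

/-- The windows before the current one have been filled. -/
lemma blockLength_le_t (m : ℕ) : ∀ w < (run δ x a b m).w, blockLength w ≤ (run δ x a b m).t := by
  induction m with
  | zero => simp [run, State.init]
  | succ m ih =>
    intro w hw
    have hmono : (run δ x a b m).t ≤ (run δ x a b (m + 1)).t := run_t_mono δ x a b (Nat.le_succ m)
    rcases run_succ_eq δ x a b m with ⟨hs, h⟩ | ⟨-, h⟩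
    · rw [h] at hw
      rcases (Nat.lt_succ_iff.1 hw).eq_or_lt with rfl | hw'
      · have h1 := run_s_le_t δ x a b m
        have h2 := run_succ_t δ x a b m
        rw [sampled_s] at hs
        omega
      · exact (ih w hw').trans hmono
    · rw [h] at hw
      exact (ih w hw).trans hmono

/-- Step `m₀` is the first one of its window. -/
structure IsStart (m₀ : ℕ) : Prop where
  Cw : ∀ i j, (run δ x a b m₀).Cw i j = 0
  Xw : ∀ j i, (run δ x a b m₀).Xw i j = 0
  QV : (run δ x a b m₀).QV = Bounds.init _ _
  hV : (run δ x a b m₀).hV = id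
  first : ∀ m, (run δ x a b m).w = (run δ x a b m₀).w → m₀ ≤ m

lemma exists_isStart (m : ℕ) : ∃ m₀ ≤ m, IsStart δ x a b m₀ ∧
    (run δ x a b m₀).w = (run δ x a b m).w := by
  induction m with
  | zero =>
    exact ⟨0, le_rfl, ⟨fun _ _ => rfl, fun _ _ => rfl, rfl, rfl, fun m _ => Nat.zero_le m⟩, rfl⟩
  | succ m ih =>
    rcases run_succ_eq δ x a b m with ⟨-, h⟩ | ⟨-, h⟩
    · refine ⟨m + 1, le_rfl, ⟨?_, ?_, ?_, ?_, ?_⟩, rfl⟩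
      · rw [h]; simp
      · rw [h]; simp
      · rw [h]
      · rw [h]
      · intro m' hm'
        by_contra hlt
        have := run_w_mono δ x a b (by omega : m' ≤ m)
        simp only at this
        rw [hm', h] at this
        simp at this
    · obtain ⟨m₀, h1, h2, h3⟩ := ih
      refine ⟨m₀, by omega, h2, h3.trans ?_⟩
      rw [h]; rfl

variable {δ x a b}

lemma w_eq_of_mem {m₀ m m' : ℕ} (hw : (run δ x a b m₀).w = (run δ x a b m).w) (h1 : m₀ ≤ m')
    (h2 : m' ≤ m) : (run δ x a b m').w = (run δ x a b m).w := by
  have h3 := run_w_mono δ x a b h1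
  have h4 := run_w_mono δ x a b h2
  simp only at h3 h4
  omega

/-- Within a window the memory is not reset. -/
lemma run_succ_of_w_eq {m : ℕ} (hw : (run δ x a b (m + 1)).w = (run δ x a b m).w) :
    run δ x a b (m + 1) = sampled δ x a b m := by
  rcases run_succ_eq δ x a b m with ⟨-, h⟩ | ⟨-, h⟩
  · rw [h] at hw; simp at hw
  · exact h

lemma two_mul_le_s {m₀ m : ℕ} (hm : m₀ ≤ m) (hw : (run δ x a b m₀).w = (run δ x a b m).w) :
    2 * (m - m₀) ≤ (run δ x a b m).s := by
  induction m, hm using Nat.le_induction with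
  | base => simp
  | succ m hm ih =>
    have h1 : (run δ x a b m).w = (run δ x a b (m + 1)).w := w_eq_of_mem hw hm (Nat.le_succ m)
    have := ih (hw.trans h1.symm)
    rw [run_succ_of_w_eq h1.symm, sampled_s]
    have := card_I_pos δ x a b m
    have := card_J_pos δ x a b m
    omega

lemma two_le_blockLength (w : ℕ) : 2 ≤ blockLength w :=
  Nat.le_self_pow (by positivity) 2

/-- A window contains at most as many steps as its length says. -/
lemma card_window_le (T w : ℕ) :
    ((Finset.range T).filter fun m => (run δ x a b m).w = w).card ≤ blockLength w := by
  rcases ((Finset.range T).filter fun m => (run δ x a b m).w = w).eq_empty_or_nonempty with h | h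
  · rw [h]; simp
  · obtain ⟨m₁, hm₁⟩ := h
    obtain ⟨m₀, -, hst, hw₀⟩ := exists_isStart δ x a b m₁
    have hw₁ := (Finset.mem_filter.1 hm₁).2
    rw [hw₁] at hw₀
    have hsub : ((Finset.range T).filter fun m => (run δ x a b m).w = w) ⊆
        Finset.Ico m₀ (m₀ + blockLength w) := by
      intro m hm
      have hwm := (Finset.mem_filter.1 hm).2
      have h1 : m₀ ≤ m := hst.first m (hwm.trans hw₀.symm)
      have h2 := two_mul_le_s h1 (hw₀.trans hwm.symm)
      have h3 := run_s_le δ x a b m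
      rw [hwm] at h3
      have := two_le_blockLength w
      rw [Finset.mem_Ico]
      omega
    simpa using Finset.card_le_card hsub

variable (δ x a b)

/-- The rows race during the whole run. -/
lemma row_isRace (H : ℕ) : IsRace (1 / δ) H (fun m => (run δ x a b m).X)
    (fun m => (run δ x a b m).C) (fun m => (run δ x a b m).QU) (fun m => (run δ x a b m).hU)
    (fun m => (updated δ x a b m).hV (b m)) where
  C_zero _ _ := rfl
  Q_zero := rfl
  h_zero := rfl
  Q_succ m _ := by
    rw [run_succ, closeWindow_QU]; rfl
  h_succ m _ := by
    rw [run_succ, closeWindow_QU, closeWindow_hU]; rfl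
  C_succ m _ i hi k := by
    rw [run_succ, closeWindow_hU] at hi
    rw [run_succ, closeWindow_C]
    have hi' : i ∈ (updated δ x a b m).I := hi
    simp only [State.sample, hi', true_and]
    rfl

variable {δ x a b}

/-- The columns race during each window. -/
lemma col_isRace {m₀ H : ℕ} (hst : IsStart δ x a b m₀)
    (hw : (run δ x a b (m₀ + H)).w = (run δ x a b m₀).w) :
    IsRace (blockLength (run δ x a b m₀).w : ℝ) H
      (fun τ j i => (run δ x a b (m₀ + τ)).Xw i j) (fun τ j i => (run δ x a b (m₀ + τ)).Cw i j)
      (fun τ => (run δ x a b (m₀ + τ)).QV) (fun τ => (run δ x a b (m₀ + τ)).hV)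
      (fun τ => (updated δ x a b (m₀ + τ)).hU (a (m₀ + τ))) := by
  have hw' : ∀ τ ≤ H, (run δ x a b (m₀ + τ)).w = (run δ x a b m₀).w := fun τ hτ =>
    (w_eq_of_mem hw.symm (by omega) (by omega)).trans hw
  have hsucc : ∀ τ < H, run δ x a b (m₀ + (τ + 1)) = sampled δ x a b (m₀ + τ) := fun τ hτ =>
    run_succ_of_w_eq ((hw' (τ + 1) hτ).trans (hw' τ hτ.le).symm)
  constructor
  · exact fun j i => hst.Cw i j
  · exact hst.QV
  · exact hst.hV
  · intro τ hτ
    rw [hsucc τ hτ, ← hw' τ hτ.le]; rfl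
  · intro τ hτ
    rw [hsucc τ hτ]; rfl
  · intro τ hτ j hj i
    rw [hsucc τ hτ] at hj ⊢
    have hj' : j ∈ (updated δ x a b (m₀ + τ)).J := hj
    simp only [sampled, State.sample, hj', and_true]
    rfl

lemma stat_add_ite_le {ι κ : Type} [Fintype κ] [DecidableEq κ] {C C' : ι → κ → ℕ} {i : ι}
    {P : Prop} [Decidable P] {k₀ : κ} (h : ∀ k, C' i k = C i k + if P ∧ k = k₀ then 1 else 0)
    (k : Option κ) : stat C' k i ≤ stat C k i + 1 := by
  cases k with
  | none =>
    simp only [stat, h, Finset.sum_add_distrib]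
    gcongr
    calc (∑ k, if P ∧ k = k₀ then 1 else 0) ≤ ∑ k, if k = k₀ then 1 else 0 := by
          gcongr with k; split_ifs <;> simp_all
      _ = 1 := by simp
  | some k =>
    simp only [stat, h]
    split_ifs <;> omega

lemma stat_C_le (m : ℕ) (k : Option (Fin M)) (i : Fin N) : stat (run δ x a b m).C k i ≤ m := by
  induction m with
  | zero => cases k <;> simp [stat, run, State.init]
  | succ m ih =>
    refine (stat_add_ite_le (C := (run δ x a b m).C) (P := i ∈ (updated δ x a b m).I)
      (k₀ := (updated δ x a b m).hV (b m)) (fun k => ?_) k).trans (by omega)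
    rw [run_succ, closeWindow_C]; rfl

lemma stat_Cw_le (m : ℕ) (k : Option (Fin N)) (j : Fin M) :
    stat (fun j i => (run δ x a b m).Cw i j) k j ≤ (run δ x a b m).s := by
  induction m with
  | zero => cases k <;> simp [stat, run, State.init]
  | succ m ih =>
    rcases run_succ_eq δ x a b m with ⟨-, h⟩ | ⟨-, h⟩
    · rw [h]; cases k <;> simp [stat]
    · rw [h]
      refine (stat_add_ite_le (C := fun j i => (run δ x a b m).Cw i j)
        (P := j ∈ (updated δ x a b m).J) (k₀ := (updated δ x a b m).hU (a m))
        (fun k => ?_) k).trans ?_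
      · simp only [sampled, State.sample, and_comm]; rfl
      · rw [sampled_s]
        have := card_I_pos δ x a b m
        omega

end Run

/-! ### Regret along a single realization -/

section Pathwise

variable {N M : ℕ}

/-- The regret of the pairs played in step `m`, if the best pair is `(i₀, j₀)`. -/
def stepRegret (u : Fin N → ℝ) (v : Fin M → ℝ) (i₀ : Fin N) (j₀ : Fin M) (δ : ℝ)
    (x : ℕ → Fin N → Fin M → ℝ) (a : ℕ → Fin N) (b : ℕ → Fin M) (m : ℕ) : ℝ :=
  ∑ i ∈ (updated δ x a b m).I, (u i₀ * v j₀ - u i * v ((updated δ x a b m).hV (b m))) +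
    ∑ j ∈ (updated δ x a b m).J, (u i₀ * v j₀ - u ((updated δ x a b m).hU (a m)) * v j)

lemma le_of_best {n : ℕ} {u : Fin n → ℝ} {i₀ : Fin n} (h₀ : ∀ i, i ≠ i₀ → u i < u i₀)
    (i : Fin n) : u i ≤ u i₀ := by
  by_cases h : i = i₀
  · rw [h]
  · exact (h₀ i h).le

lemma iSup_eq_best {n : ℕ} {u : Fin n → ℝ} {i₀ : Fin n} (h₀ : ∀ i, i ≠ i₀ → u i < u i₀) :
    ⨆ i, u i = u i₀ :=
  haveI : Nonempty (Fin n) := ⟨i₀⟩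
  le_antisymm (ciSup_le (le_of_best h₀)) (le_ciSup (Set.finite_range u).bddAbove i₀)

variable {u : Fin N → ℝ} {v : Fin M → ℝ} {i₀ : Fin N} {j₀ : Fin M}

lemma mul_le_best (hu : ∀ i, 0 < u i) (hv : ∀ j, 0 < v j) (h₀ : ∀ i, i ≠ i₀ → u i < u i₀)
    (k₀ : ∀ j, j ≠ j₀ → v j < v j₀) (i : Fin N) (j : Fin M) : u i * v j ≤ u i₀ * v j₀ :=
  mul_le_mul (le_of_best h₀ i) (le_of_best k₀ j) (hv j).le (hu i₀).le

lemma iSup_mul_eq_best (hu : ∀ i, 0 < u i) (hv : ∀ j, 0 < v j)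
    (h₀ : ∀ i, i ≠ i₀ → u i < u i₀) (k₀ : ∀ j, j ≠ j₀ → v j < v j₀) :
    ⨆ p : Fin N × Fin M, u p.1 * v p.2 = u i₀ * v j₀ :=
  haveI : Nonempty (Fin N × Fin M) := ⟨(i₀, j₀)⟩
  le_antisymm (ciSup_le fun p => mul_le_best hu hv h₀ k₀ p.1 p.2)
    (le_ciSup (f := fun p : Fin N × Fin M => u p.1 * v p.2) (Set.finite_range _).bddAbove (i₀, j₀))

section Regret

variable (δ : ℝ) (x : ℕ → Fin N → Fin M → ℝ) (a : ℕ → Fin N) (b : ℕ → Fin M)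

lemma length_played (m : ℕ) : 2 * m ≤ (played δ x a b m).length := by
  induction m with
  | zero => simp
  | succ m ih =>
    have h1 := card_I_pos δ x a b m
    have h2 := card_J_pos δ x a b m
    unfold updated at h1 h2
    simp only [played, List.length_append, State.pulls, List.length_map, Finset.length_sort]
    omega

lemma sum_map_sort {n : ℕ} (I : Finset (Fin n)) (f : Fin n → ℝ) :
    ((I.sort (· ≤ ·)).map f).sum = ∑ i ∈ I, f i := by
  rw [← List.sum_toFinset f (Finset.sort_nodup I (· ≤ ·)), Finset.sort_toFinset]

lemma sum_played (m : ℕ) :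
    ((played δ x a b m).map fun p => u i₀ * v j₀ - u p.1 * v p.2).sum =
      ∑ m' ∈ Finset.range m, stepRegret u v i₀ j₀ δ x a b m' := by
  induction m with
  | zero => simp [played]
  | succ m ih =>
    rw [Finset.sum_range_succ, ← ih]
    simp only [played, List.map_append, List.sum_append, State.pulls, List.map_map]
    congr 1
    rw [stepRegret, ← sum_map_sort, ← sum_map_sort]
    rfl

lemma list_sum_sub (c : ℝ) (f : Fin N × Fin M → ℝ) (l : List (Fin N × Fin M)) :
    (l.map fun p => c - f p).sum = l.length * c - (l.map f).sum := by
  induction l with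
  | nil => simp
  | cons p l ih => simp only [List.map_cons, List.sum_cons, ih, List.length_cons]; push_cast; ring

lemma regret_eq (hu : ∀ i, 0 < u i) (hv : ∀ j, 0 < v j)
    (h₀ : ∀ i, i ≠ i₀ → u i < u i₀) (k₀ : ∀ j, j ≠ j₀ → v j < v j₀) (T : ℕ) :
    regret u v δ x a b T =
      (((played δ x a b T).take T).map fun p => u i₀ * v j₀ - u p.1 * v p.2).sum := by
  have := length_played δ x a b T
  rw [list_sum_sub, List.length_take, min_eq_left (by omega), regret,
    iSup_mul_eq_best hu hv h₀ k₀]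

lemma regret_le_sum (hu : ∀ i, 0 < u i) (hv : ∀ j, 0 < v j)
    (h₀ : ∀ i, i ≠ i₀ → u i < u i₀) (k₀ : ∀ j, j ≠ j₀ → v j < v j₀) (T : ℕ) :
    regret u v δ x a b T ≤ ∑ m ∈ Finset.range T, stepRegret u v i₀ j₀ δ x a b m := by
  rw [regret_eq δ x a b hu hv h₀ k₀, ← sum_played]
  nth_rewrite 2 [← List.take_append_drop T (played δ x a b T)]
  rw [List.map_append, List.sum_append, le_add_iff_nonneg_right]
  refine List.sum_nonneg fun r hr => ?_
  obtain ⟨p, -, rfl⟩ := List.mem_map.1 hr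
  exact sub_nonneg.2 (mul_le_best hu hv h₀ k₀ _ _)

lemma regret_mem_Icc (hu : ∀ i, u i ∈ Set.Ioo (0 : ℝ) 1) (hv : ∀ j, v j ∈ Set.Ioo (0 : ℝ) 1)
    (h₀ : ∀ i, i ≠ i₀ → u i < u i₀) (k₀ : ∀ j, j ≠ j₀ → v j < v j₀) (T : ℕ) :
    regret u v δ x a b T ∈ Set.Icc (0 : ℝ) T := by
  rw [regret_eq δ x a b (fun i => (hu i).1) (fun j => (hv j).1) h₀ k₀]
  constructor
  · refine List.sum_nonneg fun r hr => ?_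
    obtain ⟨p, -, rfl⟩ := List.mem_map.1 hr
    exact sub_nonneg.2 (mul_le_best (fun i => (hu i).1) (fun j => (hv j).1) h₀ k₀ _ _)
  · have h1 := List.sum_le_card_nsmul
      (((played δ x a b T).take T).map fun p => u i₀ * v j₀ - u p.1 * v p.2) 1 (by
        intro r hr
        obtain ⟨p, -, rfl⟩ := List.mem_map.1 hr
        have h1 := mul_le_one₀ (hu i₀).2.le (hv j₀).1.le (hv j₀).2.le
        have h2 := mul_pos (hu p.1).1 (hv p.2).1
        linarith)
    refine h1.trans ?_
    simp

end Regret

variable {T : ℕ} {x : ℕ → Fin N → Fin M → ℝ} {a : ℕ → Fin N} {b : ℕ → Fin M}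

/-- All statistics on rows stay within their confidence width during the first `T` steps. -/
def RowAccurate (u : Fin N → ℝ) (v : Fin M → ℝ) (T : ℕ) (x : ℕ → Fin N → Fin M → ℝ)
    (a : ℕ → Fin N) (b : ℕ → Fin M) : Prop :=
  ∀ m ≤ T, Accurate (T : ℝ) u v (run (1 / (T : ℝ)) x a b m).X (run (1 / (T : ℝ)) x a b m).C

/-- All statistics on columns stay within their confidence width in those of the first `T` steps
that belong to window `w`. -/
def ColAccurate (u : Fin N → ℝ) (v : Fin M → ℝ) (T : ℕ) (x : ℕ → Fin N → Fin M → ℝ)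
    (a : ℕ → Fin N) (b : ℕ → Fin M) (w : ℕ) : Prop :=
  ∀ m ≤ T, (run (1 / (T : ℝ)) x a b m).w = w → Accurate (blockLength w : ℝ) v u
    (fun j i => (run (1 / (T : ℝ)) x a b m).Xw i j) (fun j i => (run (1 / (T : ℝ)) x a b m).Cw i j)

/-- A common lower bound for all positive entries and gaps of the problem. -/
structure IsMargin (u : Fin N → ℝ) (v : Fin M → ℝ) (i₀ : Fin N) (j₀ : Fin M) (c : ℝ) : Prop where
  pos : 0 < c
  le_one : c ≤ 1
  row : ∀ i, c ≤ u i
  col : ∀ j, c ≤ v j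
  row_gap : ∀ i, i ≠ i₀ → c ≤ u i₀ - u i
  col_gap : ∀ j, j ≠ j₀ → c ≤ v j₀ - v j

lemma exists_isMargin (hu : ∀ i, u i ∈ Set.Ioo (0 : ℝ) 1) (hv : ∀ j, v j ∈ Set.Ioo (0 : ℝ) 1)
    (h₀ : ∀ i, i ≠ i₀ → u i < u i₀) (k₀ : ∀ j, j ≠ j₀ → v j < v j₀) :
    ∃ c, IsMargin u v i₀ j₀ c := by
  have key : ∀ {n : ℕ} (f : Fin n → ℝ), (∀ i, 0 < f i) → ∃ c, 0 < c ∧ ∀ i, c ≤ f i := by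
    intro n f hf
    cases n with
    | zero => exact ⟨1, one_pos, fun i => i.elim0⟩
    | succ n =>
      obtain ⟨i, hi⟩ := Finite.exists_min f
      exact ⟨f i, hf i, hi⟩
  obtain ⟨c1, p1, h1⟩ := key u fun i => (hu i).1
  obtain ⟨c2, p2, h2⟩ := key v fun i => (hv i).1
  obtain ⟨c3, p3, h3⟩ := key (fun i => if i = i₀ then 1 else u i₀ - u i) fun i => by
    split_ifs with h
    · exact one_pos
    · exact sub_pos.2 (h₀ i h)
  obtain ⟨c4, p4, h4⟩ := key (fun j => if j = j₀ then 1 else v j₀ - v j) fun j => by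
    split_ifs with h
    · exact one_pos
    · exact sub_pos.2 (k₀ j h)
  refine ⟨min (min c1 c2) (min c3 c4), ?_, ?_, ?_, ?_, ?_, ?_⟩
  · simp [*]
  · have := (h1 i₀).trans (hu i₀).2.le
    simp [this]
  · intro i; simp [h1 i]
  · intro j; simp [h2 j]
  · intro i hi
    have := h3 i
    simp only [hi, if_false] at this
    simp [this]
  · intro i hi
    have := h4 i
    simp only [hi, if_false] at this
    simp [this]

lemma log_blockLength (w : ℕ) : Real.log (blockLength w : ℝ) ≤ 2 ^ w := by
  unfold blockLength
  push_cast
  rw [Real.log_pow]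
  push_cast
  have := Real.log_two_lt_d9
  have h2 : (0 : ℝ) < 2 ^ w := by positivity
  nlinarith

lemma card_le_of_forall {P : Finset ℕ} {m₀ : ℕ} {R : ℝ} (hR : 0 ≤ R)
    (h : ∀ m ∈ P, m₀ ≤ m ∧ ((m - m₀ : ℕ) : ℝ) + 1 ≤ R) : (P.card : ℝ) ≤ R := by
  rcases P.eq_empty_or_nonempty with rfl | hP
  · simpa using hR
  · have hmax := h _ (P.max'_mem hP)
    have hsub : P ⊆ Finset.Ico m₀ (P.max' hP + 1) := fun m hm =>
      Finset.mem_Ico.2 ⟨(h m hm).1, Nat.lt_succ_of_le (P.le_max' m hm)⟩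
    have h1 := Finset.card_le_card hsub
    rw [Nat.card_Ico] at h1
    have h2 : P.card ≤ (P.max' hP - m₀) + 1 := by omega
    calc (P.card : ℝ) ≤ (((P.max' hP - m₀) + 1 : ℕ) : ℝ) := by exact_mod_cast h2
      _ ≤ R := by push_cast; exact hmax.2

section Bounds

variable (hu : ∀ i, u i ∈ Set.Ioo (0 : ℝ) 1) (hv : ∀ j, v j ∈ Set.Ioo (0 : ℝ) 1)
  (h₀ : ∀ i, i ≠ i₀ → u i < u i₀) (k₀ : ∀ j, j ≠ j₀ → v j < v j₀)

include hu hv h₀ in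
lemma row_time_le (hT : 2 ≤ T) (hA : RowAccurate u v T x a b) {m : ℕ} (hm : m ≤ T) {i : Fin N}
    (hi : i ∈ (updated (1 / (T : ℝ)) x a b m).I) (hne : i ≠ i₀) {c B : ℝ} (hc : 0 < c)
    (hc1 : c ≤ 1) (hB : 0 ≤ B) (hq : ∀ n ≤ m, c * (n - B) ≤
      ∑ s ∈ Finset.range n, v ((updated (1 / (T : ℝ)) x a b s).hV (b s))) :
    (m + 1 : ℝ) ≤ 256 * Real.log T / ((u i₀ - u i) * c) ^ 2 + 8 * B := by
  have hR := row_isRace (1 / (T : ℝ)) x a b T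
  rw [one_div_one_div] at hR
  refine hR.time_le (by exact_mod_cast hT) (fun j => (hv j).1.le) hA h₀ hm ?_ hne
    (by linarith [(hu i).1, (hu i₀).2]) hc hc1 hB hq
  have : (updated (1 / (T : ℝ)) x a b m).I = IsRace.survivors (1 / (1 / (T : ℝ)))
    (fun m => (run (1 / (T : ℝ)) x a b m).X) (fun m => (run (1 / (T : ℝ)) x a b m).C)
    (fun m => (run (1 / (T : ℝ)) x a b m).QU) (fun m => (run (1 / (T : ℝ)) x a b m).hU) m := rfl
  rwa [this, one_div_one_div] at hi

include hu hv k₀ in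
lemma col_time_le {m₀ τ : ℕ} (hst : IsStart (1 / (T : ℝ)) x a b m₀)
    (hA : ColAccurate u v T x a b (run (1 / (T : ℝ)) x a b m₀).w)
    (hw : (run (1 / (T : ℝ)) x a b (m₀ + τ)).w = (run (1 / (T : ℝ)) x a b m₀).w)
    (hm : m₀ + τ ≤ T) {j : Fin M}
    (hj : j ∈ (updated (1 / (T : ℝ)) x a b (m₀ + τ)).J) (hne : j ≠ j₀) {c : ℝ} (hc : 0 < c)
    (hc1 : c ≤ 1)
    (hq : ∀ s ≤ τ, c ≤ u ((updated (1 / (T : ℝ)) x a b (m₀ + s)).hU (a (m₀ + s)))) :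
    (τ + 1 : ℝ) ≤ 256 * Real.log (blockLength (run (1 / (T : ℝ)) x a b m₀).w) /
      ((v j₀ - v j) * c) ^ 2 := by
  have hR := col_isRace hst hw
  have hw' : ∀ s ≤ τ, (run (1 / (T : ℝ)) x a b (m₀ + s)).w = (run (1 / (T : ℝ)) x a b m₀).w :=
    fun s hs => (w_eq_of_mem hw.symm (by omega) (by omega)).trans hw
  have := hR.time_le (B := 0) (c := c) (by exact_mod_cast two_le_blockLength _)
    (fun i => (hu i).1.le) (fun s hs => hA _ (by omega) (hw' s hs)) k₀ le_rfl (i := j) ?_ hne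
    (by linarith [(hv j).1, (hv j₀).2]) hc hc1 le_rfl ?_
  · simpa using this
  · have h2 : (updated (1 / (T : ℝ)) x a b (m₀ + τ)).J = IsRace.survivors
      (blockLength (run (1 / (T : ℝ)) x a b (m₀ + τ)).w : ℝ)
      (fun τ j i => (run (1 / (T : ℝ)) x a b (m₀ + τ)).Xw i j)
      (fun τ j i => (run (1 / (T : ℝ)) x a b (m₀ + τ)).Cw i j)
      (fun τ => (run (1 / (T : ℝ)) x a b (m₀ + τ)).QV)
      (fun τ => (run (1 / (T : ℝ)) x a b (m₀ + τ)).hV) τ := rfl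
    rwa [h2, hw] at hj
  · intro n hn
    have := Finset.card_nsmul_le_sum (Finset.range n)
      (fun s => u ((updated (1 / (T : ℝ)) x a b (m₀ + s)).hU (a (m₀ + s)))) c
      (fun s hs => hq s (by have := Finset.mem_range.1 hs; omega))
    simpa [mul_comm] using this

lemma div_margin_le {c g d L : ℝ} (hc : 0 < c) (hg : c ≤ g) (hd : c ≤ d) (hL : 0 ≤ L) :
    256 * L / (g * d) ^ 2 ≤ 256 / c ^ 4 * L := by
  have hg0 : 0 ≤ g := hc.le.trans hg
  have : c ^ 4 ≤ (g * d) ^ 2 := by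
    calc c ^ 4 = (c * c) ^ 2 := by ring
      _ ≤ _ := by gcongr
  calc 256 * L / (g * d) ^ 2 ≤ 256 * L / c ^ 4 := by gcongr
    _ = _ := by ring

include hu hv h₀ in
/-- After order `log T` steps only the best row is left. -/
lemma row_time_le_margin (hT : 2 ≤ T) (hA : RowAccurate u v T x a b) {c : ℝ}
    (hc : IsMargin u v i₀ j₀ c) {m : ℕ} (hm : m ≤ T) {i : Fin N}
    (hi : i ∈ (updated (1 / (T : ℝ)) x a b m).I) (hne : i ≠ i₀) :
    (m + 1 : ℝ) ≤ 256 / c ^ 4 * Real.log T := by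
  have h1 := row_time_le hu hv h₀ hT hA hm hi hne hc.pos hc.le_one le_rfl (fun n _ => by
    have := Finset.card_nsmul_le_sum (Finset.range n)
      (fun s => v ((updated (1 / (T : ℝ)) x a b s).hV (b s))) c (fun s _ => hc.col _)
    simpa [mul_comm] using this)
  have h2 : 0 ≤ Real.log T := Real.log_natCast_nonneg T
  have := div_margin_le hc.pos (hc.row_gap i hne) le_rfl h2
  linarith

lemma stepRegret_le_card (hu : ∀ i, u i ∈ Set.Ioo (0 : ℝ) 1) (hv : ∀ j, v j ∈ Set.Ioo (0 : ℝ) 1)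
    (δ : ℝ) (m : ℕ) : stepRegret u v i₀ j₀ δ x a b m ≤ N + M := by
  have key : ∀ i j, u i₀ * v j₀ - u i * v j ≤ 1 := fun i j => by
    have h1 := mul_le_one₀ (hu i₀).2.le (hv j₀).1.le (hv j₀).2.le
    have h2 := mul_pos (hu i).1 (hv j).1
    linarith
  refine add_le_add ?_ ?_
  · refine (Finset.sum_le_card_nsmul _ _ 1 fun i _ => key _ _).trans ?_
    simpa using card_I_le _
  · refine (Finset.sum_le_card_nsmul _ _ 1 fun i _ => key _ _).trans ?_
    simpa using card_J_le _

include hv h₀ in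
/-- If only the best column is active, the regret of a step comes from the active rows. -/
lemma stepRegret_le_row {δ : ℝ} {m : ℕ} (hJ : (updated δ x a b m).J = {j₀}) :
    stepRegret u v i₀ j₀ δ x a b m ≤
      2 * ∑ i ∈ (updated δ x a b m).I, (u i₀ - u i) * v j₀ := by
  have hb : (updated δ x a b m).hV (b m) = j₀ := by
    have := mem_active (h := (updated δ x a b m).hV) (b m)
    change _ ∈ (updated δ x a b m).J at this
    rw [hJ] at this
    exact Finset.mem_singleton.1 this
  have ha : (updated δ x a b m).hU (a m) ∈ (updated δ x a b m).I := mem_active _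
  have h1 : (u i₀ - u ((updated δ x a b m).hU (a m))) * v j₀ ≤
      ∑ i ∈ (updated δ x a b m).I, (u i₀ - u i) * v j₀ :=
    Finset.single_le_sum (f := fun i => (u i₀ - u i) * v j₀)
      (fun i _ => mul_nonneg (sub_nonneg.2 (le_of_best h₀ i)) (hv j₀).1.le) ha
  rw [stepRegret, hJ, hb, Finset.sum_singleton, two_mul]
  refine add_le_add (le_of_eq ?_) (le_trans (le_of_eq ?_) h1)
  · exact Finset.sum_congr rfl fun i _ => by ring
  · ring

include hu k₀ in
/-- If only the best row is active, the regret of a step comes from the active columns. -/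
lemma stepRegret_le_col {δ : ℝ} {m : ℕ} (hI : (updated δ x a b m).I = {i₀}) :
    stepRegret u v i₀ j₀ δ x a b m ≤
      2 * ∑ j ∈ (updated δ x a b m).J, (v j₀ - v j) * u i₀ := by
  have ha : (updated δ x a b m).hU (a m) = i₀ := by
    have := mem_active (h := (updated δ x a b m).hU) (a m)
    change _ ∈ (updated δ x a b m).I at this
    rw [hI] at this
    exact Finset.mem_singleton.1 this
  have hb : (updated δ x a b m).hV (b m) ∈ (updated δ x a b m).J := mem_active _
  have h1 : (v j₀ - v ((updated δ x a b m).hV (b m))) * u i₀ ≤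
      ∑ j ∈ (updated δ x a b m).J, (v j₀ - v j) * u i₀ :=
    Finset.single_le_sum (f := fun j => (v j₀ - v j) * u i₀)
      (fun i _ => mul_nonneg (sub_nonneg.2 (le_of_best k₀ i)) (hu i₀).1.le) hb
  rw [stepRegret, hI, ha, Finset.sum_singleton, two_mul]
  refine add_le_add (le_trans (le_of_eq ?_) h1) (le_of_eq ?_)
  · ring
  · exact Finset.sum_congr rfl fun i _ => by ring

end Bounds

end Pathwise

section PathwiseBound

variable {N M : ℕ} {u : Fin N → ℝ} {v : Fin M → ℝ} {i₀ : Fin N} {j₀ : Fin M}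
  {T : ℕ} {x : ℕ → Fin N → Fin M → ℝ} {a : ℕ → Fin N} {b : ℕ → Fin M}

open Classical in
/-- Total length of those of the first `W` windows in which a column statistic leaves its
confidence width. -/
def failedLength (u : Fin N → ℝ) (v : Fin M → ℝ) (T : ℕ) (x : ℕ → Fin N → Fin M → ℝ)
    (a : ℕ → Fin N) (b : ℕ → Fin M) (W : ℕ) : ℝ :=
  ∑ w ∈ Finset.range W, if ColAccurate u v T x a b w then 0 else (blockLength w : ℝ)

open Classical in
/-- The steps in windows with a failure of a column statistic. -/
def failedSteps (u : Fin N → ℝ) (v : Fin M → ℝ) (T : ℕ) (x : ℕ → Fin N → Fin M → ℝ)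
    (a : ℕ → Fin N) (b : ℕ → Fin M) : Finset ℕ :=
  (Finset.range T).filter fun m => ¬ ColAccurate u v T x a b (run (1 / (T : ℝ)) x a b m).w

open Classical in
/-- The steps of early windows `w` (those with `2 ^ w ≤ Λ`) without failure in which suboptimal
columns are still active. -/
def slowSteps (u : Fin N → ℝ) (v : Fin M → ℝ) (j₀ : Fin M) (T : ℕ) (x : ℕ → Fin N → Fin M → ℝ)
    (a : ℕ → Fin N) (b : ℕ → Fin M) (Λ : ℝ) : Finset ℕ :=
  (Finset.range T).filter fun m => ColAccurate u v T x a b (run (1 / (T : ℝ)) x a b m).w ∧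
    (2 : ℝ) ^ (run (1 / (T : ℝ)) x a b m).w ≤ Λ ∧ (updated (1 / (T : ℝ)) x a b m).J ≠ {j₀}

open Classical in
/-- The steps of late windows without failure in which column `j` is still active. -/
def lateSteps (u : Fin N → ℝ) (v : Fin M → ℝ) (T : ℕ) (x : ℕ → Fin N → Fin M → ℝ)
    (a : ℕ → Fin N) (b : ℕ → Fin M) (Λ : ℝ) (j : Fin M) : Finset ℕ :=
  (Finset.range T).filter fun m => ColAccurate u v T x a b (run (1 / (T : ℝ)) x a b m).w ∧
    Λ < (2 : ℝ) ^ (run (1 / (T : ℝ)) x a b m).w ∧ j ∈ (updated (1 / (T : ℝ)) x a b m).J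

lemma card_le_sum_windows {P : Finset ℕ} {W : ℕ} {f : ℕ → ℝ} (w : ℕ → ℕ)
    (hW : ∀ m ∈ P, w m < W) (h : ∀ k < W, ((P.filter fun m => w m = k).card : ℝ) ≤ f k) :
    (P.card : ℝ) ≤ ∑ k ∈ Finset.range W, f k := by
  rw [Finset.card_eq_sum_card_fiberwise (f := w) (t := Finset.range W)
    fun m hm => Finset.mem_coe.2 (Finset.mem_range.2 (hW m hm))]
  push_cast
  exact Finset.sum_le_sum fun k hk => h k (Finset.mem_range.1 hk)

lemma card_failedSteps_le {W : ℕ} (hW : ∀ m < T, (run (1 / (T : ℝ)) x a b m).w < W) :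
    ((failedSteps u v T x a b).card : ℝ) ≤ failedLength u v T x a b W := by
  classical
  refine card_le_sum_windows (P := failedSteps u v T x a b)
    (fun m => (run (1 / (T : ℝ)) x a b m).w)
    (fun m hm => hW m (Finset.mem_range.1 (Finset.mem_filter.1 hm).1)) fun k _ => ?_
  split_ifs with h
  · rw [Finset.filter_eq_empty_iff.2 fun m hm hmk => ?_]
    · simp
    · have := (Finset.mem_filter.1 hm).2
      rw [hmk] at this
      exact this h
  · refine Nat.cast_le.2 ((Finset.card_le_card ?_).trans (card_window_le (δ := 1 / (T : ℝ))
      (x := x) (a := a) (b := b) T k))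
    intro m hm
    have hm' := Finset.mem_filter.1 hm
    exact Finset.mem_filter.2 ⟨(Finset.mem_filter.1 hm'.1).1, hm'.2⟩

lemma sum_two_pow_le {W : ℕ} (Λ : ℝ) (hΛ : 0 ≤ Λ) :
    ∑ w ∈ (Finset.range W).filter (fun w => (2 : ℝ) ^ w ≤ Λ), (2 : ℝ) ^ w ≤ 2 * Λ := by
  rcases ((Finset.range W).filter fun w => (2 : ℝ) ^ w ≤ Λ).eq_empty_or_nonempty with h | h
  · rw [h]; simpa using hΛ
  · have hmax := Finset.max'_mem _ h
    set k := Finset.max' _ h with hk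
    have h1 : (2 : ℝ) ^ k ≤ Λ := (Finset.mem_filter.1 hmax).2
    calc _ ≤ ∑ w ∈ Finset.range (k + 1), (2 : ℝ) ^ w := by
          refine Finset.sum_le_sum_of_subset_of_nonneg (fun w hw => ?_) fun _ _ _ => by positivity
          exact Finset.mem_range.2 (Nat.lt_succ_of_le (Finset.le_max' _ w hw))
      _ ≤ 2 * 2 ^ k := by
          rw [geom_sum_eq (by norm_num)]
          rw [pow_succ]; norm_num; linarith
      _ ≤ 2 * Λ := by linarith

section

variable (hu : ∀ i, u i ∈ Set.Ioo (0 : ℝ) 1) (hv : ∀ j, v j ∈ Set.Ioo (0 : ℝ) 1)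
  (h₀ : ∀ i, i ≠ i₀ → u i < u i₀) (k₀ : ∀ j, j ≠ j₀ → v j < v j₀)

include hu hv k₀ in
lemma card_slowSteps_le {c : ℝ} (hc : IsMargin u v i₀ j₀ c) {W : ℕ} {Λ : ℝ} (hΛ : 0 ≤ Λ)
    (hW : ∀ m < T, (run (1 / (T : ℝ)) x a b m).w < W) :
    ((slowSteps u v j₀ T x a b Λ).card : ℝ) ≤ 256 / c ^ 4 * (2 * Λ) := by
  classical
  have hK : 0 ≤ 256 / c ^ 4 := by have := hc.pos; positivity
  refine (card_le_sum_windows (P := slowSteps u v j₀ T x a b Λ)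
    (f := fun w => if (2 : ℝ) ^ w ≤ Λ then 256 / c ^ 4 * 2 ^ w else 0)
    (fun m => (run (1 / (T : ℝ)) x a b m).w)
    (fun m hm => hW m (Finset.mem_range.1 (Finset.mem_filter.1 hm).1)) fun k _ => ?_).trans ?_
  · rcases ((slowSteps u v j₀ T x a b Λ).filter
      fun m => (run (1 / (T : ℝ)) x a b m).w = k).eq_empty_or_nonempty with h | ⟨m₁, h⟩
    · rw [h]; simp only [Finset.card_empty, Nat.cast_zero]
      split_ifs
      · positivity
      · exact le_rfl
    · obtain ⟨hm₁, hk⟩ := Finset.mem_filter.1 h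
      obtain ⟨-, -, hΛk, -⟩ := Finset.mem_filter.1 hm₁
      rw [hk] at hΛk
      rw [if_pos hΛk]
      obtain ⟨m₀, -, hst, hw₀⟩ := exists_isStart (1 / (T : ℝ)) x a b m₁
      rw [hk] at hw₀
      refine card_le_of_forall (m₀ := m₀) (by positivity) fun m hm => ?_
      obtain ⟨hm, hmk⟩ := Finset.mem_filter.1 hm
      obtain ⟨hmT, hA, -, hJ⟩ := Finset.mem_filter.1 hm
      have hle := hst.first m (hmk.trans hw₀.symm)
      refine ⟨hle, ?_⟩
      obtain ⟨j, hj, hne⟩ : ∃ j ∈ (updated (1 / (T : ℝ)) x a b m).J, j ≠ j₀ := by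
        by_contra hcon
        push Not at hcon
        exact hJ (Finset.eq_singleton_iff_nonempty_unique_mem.2
          ⟨Finset.card_pos.1 (card_J_pos _ x a b m), hcon⟩)
      obtain ⟨τ, rfl⟩ := Nat.exists_eq_add_of_le hle
      rw [hmk, ← hw₀] at hA
      have h1 := col_time_le hu hv k₀ hst hA (hmk.trans hw₀.symm)
        (Finset.mem_range.1 hmT).le hj hne hc.pos hc.le_one (fun s _ => hc.row _)
      rw [hw₀] at h1
      rw [Nat.add_sub_cancel_left]
      refine h1.trans ((div_margin_le hc.pos (hc.col_gap j hne) le_rfl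
        (Real.log_natCast_nonneg _)).trans ?_)
      gcongr
      exact log_blockLength k
  · rw [← Finset.sum_filter, ← Finset.mul_sum]
    gcongr
    exact sum_two_pow_le Λ hΛ

include hu hv h₀ k₀ in
lemma card_lateSteps_le (hT : 2 ≤ T) {c : ℝ} (hc : IsMargin u v i₀ j₀ c) {W : ℕ} {Λ : ℝ}
    (hA : RowAccurate u v T x a b)
    (hW : ∀ m < T, (run (1 / (T : ℝ)) x a b m).w < W)
    (hΛ : ∀ m < T, (m : ℝ) ≤ 256 / c ^ 4 * Real.log T →
      (2 : ℝ) ^ (run (1 / (T : ℝ)) x a b m).w ≤ Λ) {j : Fin M} (hne : j ≠ j₀) :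
    ((lateSteps u v T x a b Λ j).card : ℝ) ≤ 256 * 2 ^ W / ((v j₀ - v j) * u i₀) ^ 2 := by
  classical
  have hgap : 0 < v j₀ - v j := sub_pos.2 (k₀ j hne)
  have hpos := (hu i₀).1
  refine (card_le_sum_windows (P := lateSteps u v T x a b Λ j)
    (f := fun w => 256 * 2 ^ w / ((v j₀ - v j) * u i₀) ^ 2)
    (fun m => (run (1 / (T : ℝ)) x a b m).w)
    (fun m hm => hW m (Finset.mem_range.1 (Finset.mem_filter.1 hm).1)) fun k _ => ?_).trans ?_
  · rcases ((lateSteps u v T x a b Λ j).filter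
      fun m => (run (1 / (T : ℝ)) x a b m).w = k).eq_empty_or_nonempty with h | ⟨m₁, h⟩
    · rw [h]; simp only [Finset.card_empty, Nat.cast_zero]
      positivity
    · obtain ⟨hm₁, hk⟩ := Finset.mem_filter.1 h
      obtain ⟨hm₁T, -, hΛk, -⟩ := Finset.mem_filter.1 hm₁
      have hm₁T := Finset.mem_range.1 hm₁T
      rw [hk] at hΛk
      obtain ⟨m₀, hm₀, hst, hw₀⟩ := exists_isStart (1 / (T : ℝ)) x a b m₁
      rw [hk] at hw₀
      have hlate : 256 / c ^ 4 * Real.log T < m₀ := by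
        by_contra hcon
        have := hΛ m₀ (by omega) (not_lt.1 hcon)
        rw [hw₀] at this
        linarith
      refine card_le_of_forall (m₀ := m₀) (by positivity) fun m hm => ?_
      obtain ⟨hm, hmk⟩ := Finset.mem_filter.1 hm
      obtain ⟨hmT, hA', -, hj⟩ := Finset.mem_filter.1 hm
      have hmT := Finset.mem_range.1 hmT
      have hle := hst.first m (hmk.trans hw₀.symm)
      refine ⟨hle, ?_⟩
      obtain ⟨τ, rfl⟩ := Nat.exists_eq_add_of_le hle
      rw [hmk, ← hw₀] at hA'
      have h1 := col_time_le hu hv k₀ hst hA' (hmk.trans hw₀.symm)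
        hmT.le hj hne (c := u i₀) hpos (hu i₀).2.le (fun s hs => by
          have hmem : (updated (1 / (T : ℝ)) x a b (m₀ + s)).hU (a (m₀ + s)) ∈
            (updated (1 / (T : ℝ)) x a b (m₀ + s)).I := mem_active _
          by_cases hi : (updated (1 / (T : ℝ)) x a b (m₀ + s)).hU (a (m₀ + s)) = i₀
          · rw [hi]
          · have h2 := row_time_le_margin hu hv h₀ hT hA hc (by omega) hmem hi
            push_cast at h2
            have h3 : (0 : ℝ) ≤ s := Nat.cast_nonneg s
            linarith)
      rw [hw₀] at h1
      rw [Nat.add_sub_cancel_left]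
      refine h1.trans ?_
      gcongr
      exact log_blockLength k
  · rw [← Finset.sum_div, ← Finset.mul_sum]
    gcongr
    rw [geom_sum_eq (by norm_num)]
    norm_num

open Classical in
include hu hv h₀ k₀ in
lemma stepRegret_le (hT : 2 ≤ T) {c : ℝ} (hc : IsMargin u v i₀ j₀ c) {Λ : ℝ}
    (hA : RowAccurate u v T x a b)
    (hΛ : ∀ m < T, (m : ℝ) ≤ 256 / c ^ 4 * Real.log T →
      (2 : ℝ) ^ (run (1 / (T : ℝ)) x a b m).w ≤ Λ) {m : ℕ} (hm : m < T) :
    stepRegret u v i₀ j₀ (1 / (T : ℝ)) x a b m ≤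
      (N + M) * (if m ∈ failedSteps u v T x a b ∪ slowSteps u v j₀ T x a b Λ then 1 else 0) +
      2 * ∑ i, (u i₀ - u i) * v j₀ *
        (if i ∈ (updated (1 / (T : ℝ)) x a b m).I then 1 else 0) +
      2 * ∑ j, (v j₀ - v j) * u i₀ * (if m ∈ lateSteps u v T x a b Λ j then 1 else 0) := by
  have hrow : 0 ≤ 2 * ∑ i, (u i₀ - u i) * v j₀ *
        (if i ∈ (updated (1 / (T : ℝ)) x a b m).I then 1 else 0 : ℝ) := by
    refine mul_nonneg zero_le_two (Finset.sum_nonneg fun i _ => ?_)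
    exact mul_nonneg (mul_nonneg (sub_nonneg.2 (le_of_best h₀ i)) (hv j₀).1.le) (by positivity)
  have hcol : 0 ≤ 2 * ∑ j, (v j₀ - v j) * u i₀ *
        (if m ∈ lateSteps u v T x a b Λ j then 1 else 0 : ℝ) := by
    refine mul_nonneg zero_le_two (Finset.sum_nonneg fun i _ => ?_)
    exact mul_nonneg (mul_nonneg (sub_nonneg.2 (le_of_best k₀ i)) (hu i₀).1.le) (by positivity)
  by_cases hmem : m ∈ failedSteps u v T x a b ∪ slowSteps u v j₀ T x a b Λ
  · rw [if_pos hmem]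
    have := stepRegret_le_card (i₀ := i₀) (j₀ := j₀) (x := x) (a := a) (b := b) hu hv
      (1 / (T : ℝ)) m
    linarith
  · rw [if_neg hmem, mul_zero, zero_add]
    have hfail : m ∉ failedSteps u v T x a b := fun h => hmem (Finset.mem_union_left _ h)
    have hslow : m ∉ slowSteps u v j₀ T x a b Λ := fun h => hmem (Finset.mem_union_right _ h)
    have hgood : ColAccurate u v T x a b (run (1 / (T : ℝ)) x a b m).w := by
      by_contra h
      exact hfail (Finset.mem_filter.2 ⟨Finset.mem_range.2 hm, h⟩)
    by_cases hJ : (updated (1 / (T : ℝ)) x a b m).J = {j₀}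
    · have h1 := stepRegret_le_row (u := u) (i₀ := i₀) hv h₀ hJ
      have h2 : ∑ i ∈ (updated (1 / (T : ℝ)) x a b m).I, (u i₀ - u i) * v j₀ =
          ∑ i, (u i₀ - u i) * v j₀ *
            (if i ∈ (updated (1 / (T : ℝ)) x a b m).I then 1 else 0) := by
        simp only [mul_ite, mul_one, mul_zero, ← Finset.sum_filter, Finset.filter_mem_eq_inter,
          Finset.univ_inter]
      rw [h2] at h1
      linarith
    · have hlate : Λ < (2 : ℝ) ^ (run (1 / (T : ℝ)) x a b m).w := by
        by_contra h
        exact hslow (Finset.mem_filter.2 ⟨Finset.mem_range.2 hm, hgood, not_lt.1 h, hJ⟩)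
      have hI : (updated (1 / (T : ℝ)) x a b m).I = {i₀} := by
        refine Finset.eq_singleton_iff_nonempty_unique_mem.2
          ⟨Finset.card_pos.1 (card_I_pos _ x a b m), fun i hi => ?_⟩
        by_contra hne
        have h1 := row_time_le_margin hu hv h₀ hT hA hc hm.le hi hne
        have h2 := hΛ m hm (by linarith)
        linarith
      have h1 := stepRegret_le_col (v := v) (j₀ := j₀) hu k₀ hI
      have h2 : ∑ j ∈ (updated (1 / (T : ℝ)) x a b m).J, (v j₀ - v j) * u i₀ =
          ∑ j, (v j₀ - v j) * u i₀ * (if m ∈ lateSteps u v T x a b Λ j then 1 else 0) := by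
        have h3 : ∀ j, m ∈ lateSteps u v T x a b Λ j ↔
            j ∈ (updated (1 / (T : ℝ)) x a b m).J := fun j =>
          ⟨fun h => (Finset.mem_filter.1 h).2.2.2,
            fun h => Finset.mem_filter.2 ⟨Finset.mem_range.2 hm, hgood, hlate, h⟩⟩
        simp only [h3, mul_ite, mul_one, mul_zero, ← Finset.sum_filter,
          Finset.filter_mem_eq_inter, Finset.univ_inter]
      rw [h2] at h1
      linarith

open Classical in
include hu hv h₀ in
/-- A suboptimal row is active only for a number of steps of the order of its lower bound, up to
the number of steps in which suboptimal columns interfere: all other steps before its elimination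
show the row against the best column. -/
lemma card_row_active_le (hT : 2 ≤ T) {c : ℝ} (hc : IsMargin u v i₀ j₀ c) {Λ : ℝ}
    (hA : RowAccurate u v T x a b)
    (hΛ : ∀ m < T, (m : ℝ) ≤ 256 / c ^ 4 * Real.log T →
      (2 : ℝ) ^ (run (1 / (T : ℝ)) x a b m).w ≤ Λ) {i : Fin N} (hne : i ≠ i₀) :
    (((Finset.range T).filter fun m => i ∈ (updated (1 / (T : ℝ)) x a b m).I).card : ℝ) ≤
      256 * Real.log T / ((u i₀ - u i) * v j₀) ^ 2 +
        8 * (failedSteps u v T x a b ∪ slowSteps u v j₀ T x a b Λ).card := by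
  have hlog : 0 ≤ Real.log T := Real.log_natCast_nonneg T
  refine card_le_of_forall (m₀ := 0) (by positivity) fun m hm => ⟨Nat.zero_le _, ?_⟩
  obtain ⟨hmT, hi⟩ := Finset.mem_filter.1 hm
  have hmT := Finset.mem_range.1 hmT
  rw [Nat.sub_zero]
  refine row_time_le hu hv h₀ hT hA hmT.le hi hne (hv j₀).1 (hv j₀).2.le (Nat.cast_nonneg _)
    fun n hn => ?_
  have hearly := row_time_le_margin hu hv h₀ hT hA hc hmT.le hi hne
  set P := failedSteps u v T x a b ∪ slowSteps u v j₀ T x a b Λ with hP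
  have hbest : ∀ s ∈ Finset.range n \ P,
      v j₀ ≤ v ((updated (1 / (T : ℝ)) x a b s).hV (b s)) := by
    intro s hs
    obtain ⟨hs, hsP⟩ := Finset.mem_sdiff.1 hs
    have hs := Finset.mem_range.1 hs
    have hJ : (updated (1 / (T : ℝ)) x a b s).J = {j₀} := by
      by_contra hJ
      refine hsP ?_
      rw [hP, Finset.mem_union]
      by_cases hg : ColAccurate u v T x a b (run (1 / (T : ℝ)) x a b s).w
      · right
        refine Finset.mem_filter.2 ⟨Finset.mem_range.2 (by omega), hg, hΛ s (by omega) ?_, hJ⟩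
        have : (s : ℝ) ≤ m := by exact_mod_cast (by omega : s ≤ m)
        linarith
      · left
        exact Finset.mem_filter.2 ⟨Finset.mem_range.2 (by omega), hg⟩
    have hmem : (updated (1 / (T : ℝ)) x a b s).hV (b s) ∈ (updated (1 / (T : ℝ)) x a b s).J :=
      mem_active _
    rw [hJ, Finset.mem_singleton] at hmem
    rw [hmem]
  calc v j₀ * ((n : ℝ) - P.card) ≤ v j₀ * ((Finset.range n \ P).card : ℝ) := by
        have := (hv j₀).1
        gcongr
        have h1 := Finset.le_card_sdiff P (Finset.range n)
        rw [Finset.card_range] at h1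
        rw [sub_le_iff_le_add]
        exact_mod_cast (by omega : n ≤ (Finset.range n \ P).card + P.card)
    _ = ((Finset.range n \ P).card : ℕ) • v j₀ := by rw [nsmul_eq_mul, mul_comm]
    _ ≤ ∑ s ∈ Finset.range n \ P, v ((updated (1 / (T : ℝ)) x a b s).hV (b s)) :=
        Finset.card_nsmul_le_sum _ _ _ hbest
    _ ≤ ∑ s ∈ Finset.range n, v ((updated (1 / (T : ℝ)) x a b s).hV (b s)) :=
        Finset.sum_le_sum_of_subset_of_nonneg Finset.sdiff_subset fun _ _ _ => (hv _).1.le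

open Classical in
include hu hv h₀ k₀ in
/-- The regret on a realization on which the row statistics are accurate. -/
theorem regret_le_of_rowAccurate (hT : 2 ≤ T) {c : ℝ} (hc : IsMargin u v i₀ j₀ c) {W : ℕ} {Λ : ℝ}
    (hΛ0 : 0 ≤ Λ) (hA : RowAccurate u v T x a b)
    (hW : ∀ m < T, (run (1 / (T : ℝ)) x a b m).w < W)
    (hΛ : ∀ m < T, (m : ℝ) ≤ 256 / c ^ 4 * Real.log T →
      (2 : ℝ) ^ (run (1 / (T : ℝ)) x a b m).w ≤ Λ) :
    regret u v (1 / (T : ℝ)) x a b T ≤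
      512 * Real.log T * ∑ i ∈ Finset.univ.filter (· ≠ i₀), 1 / (v j₀ * (u i₀ - u i)) +
      512 * 2 ^ W * ∑ j ∈ Finset.univ.filter (· ≠ j₀), 1 / (u i₀ * (v j₀ - v j)) +
      17 * (N + M) * (failedLength u v T x a b W + 512 / c ^ 4 * Λ) := by
  set P := failedSteps u v T x a b ∪ slowSteps u v j₀ T x a b Λ with hP
  set B : ℝ := failedLength u v T x a b W + 512 / c ^ 4 * Λ with hB
  have hPB : (P.card : ℝ) ≤ B := by
    have h1 := card_failedSteps_le (u := u) (v := v) hW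
    have h2 := card_slowSteps_le hu hv k₀ hc hΛ0 hW
    have h3 : (P.card : ℝ) ≤ (failedSteps u v T x a b).card +
        (slowSteps u v j₀ T x a b Λ).card := by exact_mod_cast Finset.card_union_le _ _
    calc _ ≤ _ := h3
      _ ≤ _ := add_le_add h1 h2
      _ = B := by rw [hB]; ring
  have hB0 : 0 ≤ B := (Nat.cast_nonneg _).trans hPB
  have hlog : 0 ≤ Real.log T := Real.log_natCast_nonneg T
  have hsum : regret u v (1 / (T : ℝ)) x a b T ≤ (N + M) * P.card +
      2 * ∑ i, (u i₀ - u i) * v j₀ *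
        ((Finset.range T).filter fun m => i ∈ (updated (1 / (T : ℝ)) x a b m).I).card +
      2 * ∑ j, (v j₀ - v j) * u i₀ * (lateSteps u v T x a b Λ j).card := by
    refine (regret_le_sum _ x a b (fun i => (hu i).1) (fun j => (hv j).1) h₀ k₀ T).trans ?_
    refine (Finset.sum_le_sum fun m hm => stepRegret_le hu hv h₀ k₀ hT hc hA hΛ
      (Finset.mem_range.1 hm)).trans (le_of_eq ?_)
    have hin : ∀ Q : Finset ℕ, Q ⊆ Finset.range T →
        ∑ m ∈ Finset.range T, (if m ∈ Q then (1 : ℝ) else 0) = Q.card := fun Q hQ => by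
      rw [Finset.sum_ite_mem, Finset.inter_eq_right.2 hQ]; simp
    rw [Finset.sum_add_distrib, Finset.sum_add_distrib, ← Finset.mul_sum, ← Finset.mul_sum,
      ← Finset.mul_sum, Finset.sum_comm, Finset.sum_comm (s := Finset.range T), ← hP,
      hin P (Finset.union_subset (Finset.filter_subset _ _) (Finset.filter_subset _ _))]
    have hl : ∀ j, Finset.range T ∩ lateSteps u v T x a b Λ j = lateSteps u v T x a b Λ j :=
      fun j => Finset.inter_eq_right.2 (Finset.filter_subset _ _)
    simp only [← Finset.mul_sum]
    simp [hl]
  have hrow : ∑ i, (u i₀ - u i) * v j₀ *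
        ((Finset.range T).filter fun m => i ∈ (updated (1 / (T : ℝ)) x a b m).I).card ≤
      256 * Real.log T * (∑ i ∈ Finset.univ.filter (· ≠ i₀), 1 / (v j₀ * (u i₀ - u i))) +
        N * (8 * B) := by
    calc _ ≤ ∑ i, ((if i ≠ i₀ then 256 * Real.log T * (1 / (v j₀ * (u i₀ - u i))) else 0) +
            8 * B) := by
          refine Finset.sum_le_sum fun i _ => ?_
          by_cases hi : i = i₀
          · simp [hi, hB0]
          · rw [if_pos hi]
            have h1 := card_row_active_le hu hv h₀ hT hc hA hΛ hi
            have hg : 0 < u i₀ - u i := sub_pos.2 (h₀ i hi)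
            have hv0 := (hv j₀).1
            have hg1 : (u i₀ - u i) * v j₀ ≤ 1 :=
              mul_le_one₀ (by linarith [(hu i).1, (hu i₀).2]) hv0.le (hv j₀).2.le
            calc _ ≤ (u i₀ - u i) * v j₀ * (256 * Real.log T / ((u i₀ - u i) * v j₀) ^ 2 +
                  8 * P.card) := by gcongr
              _ = 256 * Real.log T * (1 / (v j₀ * (u i₀ - u i))) +
                  (u i₀ - u i) * v j₀ * (8 * P.card) := by field_simp
              _ ≤ 256 * Real.log T * (1 / (v j₀ * (u i₀ - u i))) + 1 * (8 * B) := by gcongr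
              _ = _ := by ring
      _ = _ := by
          rw [Finset.sum_add_distrib, ← Finset.sum_filter, ← Finset.mul_sum]
          simp
  have hcol : ∑ j, (v j₀ - v j) * u i₀ * (lateSteps u v T x a b Λ j).card ≤
      256 * 2 ^ W * ∑ j ∈ Finset.univ.filter (· ≠ j₀), 1 / (u i₀ * (v j₀ - v j)) := by
    calc _ ≤ ∑ j, (if j ≠ j₀ then 256 * 2 ^ W * (1 / (u i₀ * (v j₀ - v j))) else 0) := by
          refine Finset.sum_le_sum fun j _ => ?_
          by_cases hj : j = j₀
          · simp [hj]
          · rw [if_pos hj]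
            have h1 := card_lateSteps_le hu hv h₀ k₀ hT hc hA hW hΛ hj
            have hg : 0 < v j₀ - v j := sub_pos.2 (k₀ j hj)
            have hu0 := (hu i₀).1
            calc _ ≤ (v j₀ - v j) * u i₀ * (256 * 2 ^ W / ((v j₀ - v j) * u i₀) ^ 2) := by gcongr
              _ = _ := by field_simp
      _ = _ := by rw [← Finset.sum_filter, ← Finset.mul_sum]
  have hNM : ((N : ℝ) + M) * P.card ≤ (N + M) * B := by gcongr
  have hMB : 0 ≤ (M : ℝ) * B := by positivity
  calc _ ≤ _ := hsum
    _ ≤ (N + M) * B + 2 * (256 * Real.log T *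
          (∑ i ∈ Finset.univ.filter (· ≠ i₀), 1 / (v j₀ * (u i₀ - u i))) + N * (8 * B)) +
        2 * (256 * 2 ^ W * ∑ j ∈ Finset.univ.filter (· ≠ j₀), 1 / (u i₀ * (v j₀ - v j))) := by
      gcongr
    _ ≤ _ := by nlinarith

end

end PathwiseBound

/-! ### Measurability -/

section Measurability

variable {α : Type*} [MeasurableSpace α]

lemma measurable_eval_discrete {D β : Type*} [MeasurableSpace D] [MeasurableSpace β] [Countable D]
    [MeasurableSingletonClass D] {d : α → D} (hd : Measurable d) {F : D → α → β}
    (hF : ∀ d, Measurable (F d)) : Measurable fun e => F (d e) e :=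
  (measurable_from_prod_countable_right (f := fun p : D × α => F p.1 p.2) hF).comp
    (hd.prodMk measurable_id)

lemma measurable_discrete {D E : Type*} [MeasurableSpace D] [MeasurableSpace E] [Countable D]
    [MeasurableSingletonClass D] {d : α → D} (hd : Measurable d) (F : D → E) :
    Measurable fun e => F (d e) :=
  measurable_eval_discrete hd (F := fun d _ => F d) fun _ => measurable_const

lemma measurableSet_discrete {D : Type*} [MeasurableSpace D] [Countable D]
    [MeasurableSingletonClass D] {d : α → D} (hd : Measurable d) (P : D → Prop) :
    MeasurableSet {e | P (d e)} :=
  hd (Set.to_countable {x | P x}).measurableSet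

lemma measurable_stat {ι κ : Type} [Fintype κ] {S : α → ι → κ → ℝ}
    (hS : ∀ i k, Measurable fun e => S e i k) (k : Option κ) (i : ι) :
    Measurable fun e => stat (S e) k i := by
  cases k with
  | none => exact Finset.measurable_fun_sum _ fun k _ => hS i k
  | some k => exact hS i k

/-- All confidence bounds are measurable. -/
structure MeasurableBounds {ι κ : Type} (Q : α → Bounds ι κ) : Prop where
  lo : ∀ k i, Measurable fun e => (Q e).lo k i
  hi : ∀ k i, Measurable fun e => (Q e).hi k i

lemma MeasurableBounds.confidenceBound {ι κ : Type} [Finite ι] [Fintype κ] {w : α → ℕ}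
    (hw : Measurable w) (β : ℕ → ℝ) {S : α → ι → κ → ℝ} (hS : ∀ i k, Measurable fun e => S e i k)
    {C : α → ι → κ → ℕ} (hC : Measurable C) {Q : α → Bounds ι κ} (hQ : MeasurableBounds Q) :
    MeasurableBounds fun e => confidenceBound (β (w e)) (S e) (C e) (Q e) := by
  have hlevel : ∀ k i, MeasurableSet {e | IsLevel (β (w e)) (stat (C e) k i)} := fun k i =>
    measurableSet_discrete (hw.prodMk hC) fun p => IsLevel (β p.1) (stat p.2 k i)
  have hn : ∀ k i, Measurable fun e => ((stat (C e) k i : ℕ) : ℝ) := fun k i =>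
    measurable_discrete hC fun C => ((stat C k i : ℕ) : ℝ)
  have hβ : Measurable fun e => Real.log (β (w e)) := measurable_discrete hw fun w => Real.log (β w)
  constructor <;> intro k i
  · refine Measurable.ite (hlevel k i) (Measurable.coe_real_ereal ?_) (hQ.lo k i)
    exact ((measurable_stat hS k i).div (hn k i)).sub ((hβ.div (hn k i)).sqrt)
  · refine Measurable.ite (hlevel k i) (Measurable.coe_real_ereal ?_) (hQ.hi k i)
    exact ((measurable_stat hS k i).div (hn k i)).add ((hβ.div (hn k i)).sqrt)

lemma measurable_dominationMap {n : ℕ} {κ : Type} [Finite κ] {Q : α → Bounds (Fin n) κ}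
    (hQ : MeasurableBounds Q) {h : α → Fin n → Fin n} (hh : Measurable h) :
    Measurable fun e => dominationMap (Q e) (h e) := by
  classical
  have hd : Measurable fun e => (fun i j => (Q e).Dominated i j : Fin n → Fin n → Prop) := by
    refine measurable_pi_lambda _ fun i => measurable_pi_lambda _ fun j => ?_
    refine measurableSet_setOfPred.1 ?_
    unfold Bounds.Dominated
    rw [Set.ofPred_exists]
    exact MeasurableSet.iUnion fun k => measurableSet_lt (hQ.hi k i) (hQ.lo k j)
  -- The new map depends on the bounds only through the finitely many truth values "dominated".
  have := measurable_discrete (E := Fin n → Fin n) (hd.prodMk hh) fun p => fun i =>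
    (fun i' => if hne : ((active p.2).filter fun j => p.1 i' j).Nonempty
      then ((active p.2).filter fun j => p.1 i' j).max' hne else i')^[n] (p.2 i)
  exact this

variable {N M : ℕ}

/-- All components of the memory are measurable. -/
structure MeasurableState (σ : α → State N M) : Prop where
  t : Measurable fun e => (σ e).t
  w : Measurable fun e => (σ e).w
  s : Measurable fun e => (σ e).s
  X : ∀ i j, Measurable fun e => (σ e).X i j
  C : Measurable fun e => (σ e).C
  Xw : ∀ i j, Measurable fun e => (σ e).Xw i j
  Cw : Measurable fun e => (σ e).Cw
  QU : MeasurableBounds fun e => (σ e).QU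
  QV : MeasurableBounds fun e => (σ e).QV
  hU : Measurable fun e => (σ e).hU
  hV : Measurable fun e => (σ e).hV

lemma MeasurableState.refresh {σ : α → State N M} (hσ : MeasurableState σ) (δ : ℝ) :
    MeasurableState fun e => (σ e).refresh δ := by
  have hQV := hσ.QV.confidenceBound hσ.w (fun w => (blockLength w : ℝ))
    (S := fun e j i => (σ e).Xw i j) (fun j i => hσ.Xw i j) (C := fun e j i => (σ e).Cw i j)
    (measurable_discrete hσ.Cw fun C j i => C i j)
  have hQU := hσ.QU.confidenceBound hσ.w (fun _ => 1 / δ) hσ.X hσ.C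
  exact ⟨hσ.t, hσ.w, hσ.s, hσ.X, hσ.C, hσ.Xw, hσ.Cw, hQU, hQV,
    measurable_dominationMap hQU hσ.hU, measurable_dominationMap hQV hσ.hV⟩

lemma MeasurableState.sample {σ : α → State N M} (hσ : MeasurableState σ)
    {x : α → ℕ → Fin N → Fin M → ℝ} (hx : ∀ t i j, Measurable fun e => x e t i j)
    {a : α → Fin N} (ha : Measurable a) {b : α → Fin M} (hb : Measurable b) :
    MeasurableState fun e => (σ e).sample (x e) (a e) (b e) := by
  have hrow : ∀ i, Measurable fun e => (σ e).rowTime i := fun i =>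
    measurable_discrete (hσ.t.prodMk hσ.hU) fun p => p.1 + ((active p.2).filter (· < i)).card
  have hcol : ∀ j, Measurable fun e => (σ e).colTime j := fun j =>
    measurable_discrete (hσ.t.prodMk (hσ.hU.prodMk hσ.hV)) fun p =>
      p.1 + (active p.2.1).card + ((active p.2.2).filter (· < j)).card
  have hrowP : ∀ i j, MeasurableSet {e | i ∈ (σ e).I ∧ j = (σ e).hV (b e)} := fun i j =>
    measurableSet_discrete (hσ.hU.prodMk (hσ.hV.prodMk hb)) fun p =>
      i ∈ active p.1 ∧ j = p.2.1 p.2.2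
  have hcolP : ∀ i j, MeasurableSet {e | i = (σ e).hU (a e) ∧ j ∈ (σ e).J} := fun i j =>
    measurableSet_discrete (hσ.hU.prodMk (hσ.hV.prodMk ha)) fun p =>
      i = p.1 p.2.2 ∧ j ∈ active p.2.1
  constructor
  · exact measurable_discrete (hσ.t.prodMk (hσ.hU.prodMk hσ.hV)) fun p =>
      p.1 + (active p.2.1).card + (active p.2.2).card
  · exact hσ.w
  · exact measurable_discrete (hσ.s.prodMk (hσ.hU.prodMk hσ.hV)) fun p =>
      p.1 + (active p.2.1).card + (active p.2.2).card
  · exact fun i j => (hσ.X i j).add (Measurable.ite (hrowP i j)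
      (measurable_eval_discrete (hrow i) (F := fun t e => x e t i j) fun t => hx t i j)
      measurable_const)
  · exact measurable_discrete (hσ.C.prodMk (hσ.hU.prodMk (hσ.hV.prodMk hb))) fun p i j =>
      p.1 i j + if i ∈ active p.2.1 ∧ j = p.2.2.1 p.2.2.2 then 1 else 0
  · exact fun i j => (hσ.Xw i j).add (Measurable.ite (hcolP i j)
      (measurable_eval_discrete (hcol j) (F := fun t e => x e t i j) fun t => hx t i j)
      measurable_const)
  · exact measurable_discrete (hσ.Cw.prodMk (hσ.hU.prodMk (hσ.hV.prodMk ha))) fun p i j =>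
      p.1 i j + if i = p.2.1 p.2.2.2 ∧ j ∈ active p.2.2.1 then 1 else 0
  · exact hσ.QU
  · exact hσ.QV
  · exact hσ.hU
  · exact hσ.hV

lemma measurable_ite_apply {β γ : Type*} [MeasurableSpace γ] {s : Set α} [DecidablePred (· ∈ s)]
    (hs : MeasurableSet s) {f g : α → β} (F : β → γ) (hf : Measurable fun e => F (f e))
    (hg : Measurable fun e => F (g e)) : Measurable fun e => F (if e ∈ s then f e else g e) := by
  simp only [apply_ite F]
  exact Measurable.ite hs hf hg

lemma MeasurableState.ite {σ σ' : α → State N M} (hσ : MeasurableState σ)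
    (hσ' : MeasurableState σ') {s : Set α} [DecidablePred (· ∈ s)] (hs : MeasurableSet s) :
    MeasurableState fun e => if e ∈ s then σ e else σ' e where
  t := measurable_ite_apply hs State.t hσ.t hσ'.t
  w := measurable_ite_apply hs State.w hσ.w hσ'.w
  s := measurable_ite_apply hs State.s hσ.s hσ'.s
  X i j := measurable_ite_apply hs (fun σ => State.X σ i j) (hσ.X i j) (hσ'.X i j)
  C := measurable_ite_apply hs State.C hσ.C hσ'.C
  Xw i j := measurable_ite_apply hs (fun σ => State.Xw σ i j) (hσ.Xw i j) (hσ'.Xw i j)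
  Cw := measurable_ite_apply hs State.Cw hσ.Cw hσ'.Cw
  QU := ⟨fun k i => measurable_ite_apply hs (fun σ => (State.QU σ).lo k i)
      (hσ.QU.lo k i) (hσ'.QU.lo k i),
    fun k i => measurable_ite_apply hs (fun σ => (State.QU σ).hi k i)
      (hσ.QU.hi k i) (hσ'.QU.hi k i)⟩
  QV := ⟨fun k i => measurable_ite_apply hs (fun σ => (State.QV σ).lo k i)
      (hσ.QV.lo k i) (hσ'.QV.lo k i),
    fun k i => measurable_ite_apply hs (fun σ => (State.QV σ).hi k i)
      (hσ.QV.hi k i) (hσ'.QV.hi k i)⟩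
  hU := measurable_ite_apply hs State.hU hσ.hU hσ'.hU
  hV := measurable_ite_apply hs State.hV hσ.hV hσ'.hV

lemma MeasurableState.closeWindow {σ : α → State N M} (hσ : MeasurableState σ) :
    MeasurableState fun e => (σ e).closeWindow := by
  classical
  have hs : MeasurableSet {e | blockLength (σ e).w < (σ e).s} :=
    measurableSet_discrete (hσ.w.prodMk hσ.s) fun p => blockLength p.1 < p.2
  refine MeasurableState.ite (s := {e | blockLength (σ e).w < (σ e).s})
    (σ := fun e => { σ e with
      w := (σ e).w + 1
      s := 0
      Xw := fun _ _ => 0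
      Cw := fun _ _ => 0
      QV := Bounds.init _ _
      hV := id }) ?_ hσ hs
  exact ⟨hσ.t, measurable_discrete hσ.w fun w => w + 1, measurable_const, hσ.X, hσ.C,
    fun _ _ => measurable_const, measurable_const, hσ.QU,
    ⟨fun _ _ => measurable_const, fun _ _ => measurable_const⟩, hσ.hU, measurable_const⟩

section

variable {x : α → ℕ → Fin N → Fin M → ℝ} (hx : ∀ t i j, Measurable fun e => x e t i j)
  {a : α → ℕ → Fin N} (ha : ∀ m, Measurable fun e => a e m)
  {b : α → ℕ → Fin M} (hb : ∀ m, Measurable fun e => b e m) (δ : ℝ)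

include hx ha hb

lemma measurableState_run (m : ℕ) : MeasurableState fun e => run δ (x e) (a e) (b e) m := by
  induction m with
  | zero =>
    exact ⟨measurable_const, measurable_const, measurable_const, fun _ _ => measurable_const,
      measurable_const, fun _ _ => measurable_const, measurable_const,
      ⟨fun _ _ => measurable_const, fun _ _ => measurable_const⟩,
      ⟨fun _ _ => measurable_const, fun _ _ => measurable_const⟩, measurable_const,
      measurable_const⟩
  | succ m ih => exact ((ih.refresh δ).sample hx (ha m) (hb m)).closeWindow

lemma measurableState_updated (m : ℕ) : MeasurableState fun e => updated δ (x e) (a e) (b e) m :=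
  (measurableState_run hx ha hb δ m).refresh δ

lemma measurableSet_played (m : ℕ) (l : List (Fin N × Fin M)) :
    MeasurableSet {e | played δ (x e) (a e) (b e) m = l} := by
  let _ : MeasurableSpace (List (Fin N × Fin M)) := ⊤
  have key : Measurable fun e => played δ (x e) (a e) (b e) m := by
    induction m with
    | zero => exact measurable_const
    | succ m ih =>
      have h := measurableState_updated hx ha hb δ m
      exact measurable_discrete (ih.prodMk (h.hU.prodMk (h.hV.prodMk ((ha m).prodMk (hb m)))))
        fun p => p.1 ++ (((active p.2.1).sort (· ≤ ·)).map (fun i => (i, p.2.2.1 p.2.2.2.2)) ++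
          ((active p.2.2.1).sort (· ≤ ·)).map (fun j => (p.2.1 p.2.2.2.1, j)))
  exact key (MeasurableSpace.measurableSet_top (s := {l}))

lemma measurable_regret (u : Fin N → ℝ) (v : Fin M → ℝ) (T : ℕ) :
    Measurable fun e => regret u v δ (x e) (a e) (b e) T := by
  let _ : MeasurableSpace (List (Fin N × Fin M)) := ⊤
  have key : Measurable fun e => played δ (x e) (a e) (b e) T :=
    measurable_to_countable' fun l => measurableSet_played hx ha hb δ T l
  exact measurable_discrete key fun l => (T : ℝ) * (⨆ p : Fin N × Fin M, u p.1 * v p.2) -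
    ((l.take T).map fun p => u p.1 * v p.2).sum

end

end Measurability

/-! ### Exponential moments of adaptively sampled noise -/

section Tilt

variable {N M : ℕ}

/-- The factor that the noise variable with index `p = (t, i, j)` contributes to the exponential
supermartingale with parameter `l`. -/
def tiltFactor (l : ℝ) (e : ℕ → Fin N → Fin M → ℝ) : Option (ℕ × Fin N × Fin M) → ℝ
  | none => 1
  | some p => Real.exp (l * e p.1 p.2.1 p.2.2 - l ^ 2 / 8)

/-- The exponential supermartingale of a statistic that in step `s` samples the noise variable
`o s`, or no variable if `o s = none`. -/
def tilt (l : ℝ) (e : ℕ → Fin N → Fin M → ℝ) (o : ℕ → Option (ℕ × Fin N × Fin M)) (m : ℕ) : ℝ :=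
  ∏ s ∈ Finset.range m, tiltFactor l e (o s)

/-- The noise up to time `t`, continued by zero. -/
def truncate (t : ℕ) (e : ℕ → Fin N → Fin M → ℝ) : ℕ → Fin N → Fin M → ℝ :=
  fun s i j => if s < t then e s i j else 0

/-- Choices of a noise variable form a discrete space. -/
instance selectionMeasurableSpace : MeasurableSpace (Option (ℕ × Fin N × Fin M)) := ⊤

instance selectionDiscrete : DiscreteMeasurableSpace (Option (ℕ × Fin N × Fin M)) :=
  ⟨fun _ => trivial⟩

/-- A selection rule, which chooses a noise variable (or none) in each step from the noise and the
random draws, is causal if it selects variables in temporal order, and if the choices up to the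
one of a variable with time `t` depend only on the noise before `t` and on the draws. -/
structure IsCausal
    (sel : (ℕ → Fin N → Fin M → ℝ) → (ℕ → Fin N) → (ℕ → Fin M) → ℕ →
      Option (ℕ × Fin N × Fin M)) : Prop where
  measurable : ∀ m, Measurable fun e : (ℕ → Fin N → Fin M → ℝ) × (ℕ → Fin N) × (ℕ → Fin M) =>
    sel e.1 e.2.1 e.2.2 m
  congr : ∀ e e' a b m t i j, (∀ s < t, e s = e' s) → sel e a b m = some (t, i, j) →
    ∀ s ≤ m, sel e' a b s = sel e a b s
  lt : ∀ e a b m t i j t' i' j', sel e a b m = some (t, i, j) → ∀ s < m,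
    sel e a b s = some (t', i', j') → t' < t

lemma tiltFactor_pos (l : ℝ) (e : ℕ → Fin N → Fin M → ℝ) (o : Option (ℕ × Fin N × Fin M)) :
    0 < tiltFactor l e o := by
  cases o
  · exact one_pos
  · exact Real.exp_pos _

lemma tilt_nonneg (l : ℝ) (e : ℕ → Fin N → Fin M → ℝ) (o : ℕ → Option (ℕ × Fin N × Fin M))
    (m : ℕ) : 0 ≤ tilt l e o m :=
  Finset.prod_nonneg fun _ _ => (tiltFactor_pos _ _ _).le

lemma measurable_tiltFactor (l : ℝ) (o : Option (ℕ × Fin N × Fin M)) :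
    Measurable fun e : ℕ → Fin N → Fin M → ℝ => tiltFactor l e o := by
  cases o with
  | none => exact measurable_const
  | some p => simp only [tiltFactor]; fun_prop

variable {sel : (ℕ → Fin N → Fin M → ℝ) → (ℕ → Fin N) → (ℕ → Fin M) → ℕ →
      Option (ℕ × Fin N × Fin M)}

lemma IsCausal.measurable_tilt (hsel : IsCausal sel) (l : ℝ) (m : ℕ) :
    Measurable fun e : (ℕ → Fin N → Fin M → ℝ) × (ℕ → Fin N) × (ℕ → Fin M) =>
      tilt l e.1 (sel e.1 e.2.1 e.2.2) m :=
  Finset.measurable_fun_prod _ fun s _ => measurable_eval_discrete (hsel.measurable s)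
    (F := fun o e => tiltFactor l e.1 o) fun o => (measurable_tiltFactor l o).comp measurable_fst

/-- On the event that the variable `(t, i, j)` is selected in step `m`, the supermartingale before
that step does not depend on the noise from time `t` on. -/
lemma IsCausal.tilt_truncate (hsel : IsCausal sel) (l : ℝ) (m : ℕ) (e : ℕ → Fin N → Fin M → ℝ)
    (a : ℕ → Fin N) (b : ℕ → Fin M) {t : ℕ} {i : Fin N} {j : Fin M} :
    (sel (truncate t e) a b m = some (t, i, j) ↔ sel e a b m = some (t, i, j)) ∧
    (sel e a b m = some (t, i, j) →
      tilt l (truncate t e) (sel (truncate t e) a b) m = tilt l e (sel e a b) m) := by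
  have hagree : ∀ s < t, e s = truncate t e s := fun s hs => by
    unfold truncate; simp [hs]
  refine ⟨⟨fun h => ?_, fun h => ?_⟩, fun h => ?_⟩
  · rw [hsel.congr _ e a b m t i j (fun s hs => (hagree s hs).symm) h m le_rfl, h]
  · rw [hsel.congr _ _ a b m t i j hagree h m le_rfl, h]
  · refine Finset.prod_congr rfl fun s hs => ?_
    have hs := Finset.mem_range.1 hs
    rw [hsel.congr _ _ a b m t i j hagree h s hs.le]
    rcases hsel' : sel e a b s with _ | ⟨t', i', j'⟩
    · rfl
    · have := hsel.lt e a b m t i j t' i' j' h s hs hsel'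
      simp only [tiltFactor]
      rw [← hagree t' this]

variable {Ω : Type*} [MeasurableSpace Ω] {μ : Measure Ω}
  {ε : ℕ → Fin N → Fin M → Ω → ℝ} {a : ℕ → Ω → Fin N} {b : ℕ → Ω → Fin M}

/-- The information available before the rewards of time `t` are drawn, together with all draws
of the algorithm. -/
@[reducible] def pastSigma (ε : ℕ → Fin N → Fin M → Ω → ℝ) (a : ℕ → Ω → Fin N)
    (b : ℕ → Ω → Fin M) (t : ℕ) : MeasurableSpace Ω :=
  ⨆ q ∈ {q : Source N M | ∀ p, q = Sum.inl p → p.1 < t}, sourceSigma ε a b q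

lemma sourceSigma_le (hE : IsEnvironment μ ε a b) (q : Source N M) :
    sourceSigma ε a b q ≤ ‹MeasurableSpace Ω› := by
  rcases q with ⟨t, i, j⟩ | n | n
  · exact (hE.measurable_noise t i j).comap_le
  · exact (hE.measurable_row n).comap_le
  · exact (hE.measurable_col n).comap_le

lemma pastSigma_le (hE : IsEnvironment μ ε a b) (t : ℕ) :
    pastSigma ε a b t ≤ ‹MeasurableSpace Ω› :=
  iSup₂_le fun q _ => sourceSigma_le hE q

lemma indep_pastSigma (hE : IsEnvironment μ ε a b) (t : ℕ) (i : Fin N) (j : Fin M) :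
    Indep (pastSigma ε a b t) (MeasurableSpace.comap (ε t i j) inferInstance) μ := by
  have := indep_iSup_of_disjoint (sourceSigma_le hE) hE.indep
    (S := {q : Source N M | ∀ p, q = Sum.inl p → p.1 < t}) (T := {Sum.inl (t, i, j)}) (by
      rw [Set.disjoint_singleton_right]
      intro h
      exact lt_irrefl _ (h _ rfl))
  rwa [iSup_singleton] at this

omit [MeasurableSpace Ω] in
lemma measurable_truncate_past (t : ℕ) : Measurable[pastSigma ε a b t]
    fun ω => (truncate t (fun s i j => ε s i j ω), (fun n => a n ω), fun n => b n ω) := by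
  let _ := pastSigma ε a b t
  refine Measurable.prodMk ?_ (Measurable.prodMk ?_ ?_)
  · refine measurable_pi_lambda _ fun s => measurable_pi_lambda _ fun i =>
      measurable_pi_lambda _ fun j => ?_
    unfold truncate
    by_cases hs : s < t
    · simp only [hs, if_true]
      exact (comap_measurable (ε s i j)).mono (le_iSup₂ (f := fun q _ => sourceSigma ε a b q)
        (Sum.inl (s, i, j)) (by rintro p ⟨⟩; exact hs)) le_rfl
    · simp only [hs, if_false]
      exact measurable_const
  · exact measurable_pi_lambda _ fun n => (comap_measurable (a n)).mono
      (le_iSup₂ (f := fun q _ => sourceSigma ε a b q) (Sum.inr (Sum.inl n))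
        (by rintro p ⟨⟩)) le_rfl
  · exact measurable_pi_lambda _ fun n => (comap_measurable (b n)).mono
      (le_iSup₂ (f := fun q _ => sourceSigma ε a b q) (Sum.inr (Sum.inr n))
        (by rintro p ⟨⟩)) le_rfl

lemma lintegral_tiltFactor_le [IsProbabilityMeasure μ] (hE : IsEnvironment μ ε a b) (l : ℝ)
    (t : ℕ) (i : Fin N) (j : Fin M) :
    ∫⁻ ω, ENNReal.ofReal (Real.exp (l * ε t i j ω - l ^ 2 / 8)) ∂μ ≤ 1 := by
  have hsub := hE.subgaussian t i j
  have h1 : ∀ ω, Real.exp (l * ε t i j ω - l ^ 2 / 8) =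
      Real.exp (l * ε t i j ω) * Real.exp (-(l ^ 2 / 8)) := fun ω => by
    rw [← Real.exp_add, sub_eq_add_neg]
  simp only [h1]
  rw [← ofReal_integral_eq_lintegral_ofReal ((hsub.integrable_exp_mul l).mul_const _)
    (Filter.Eventually.of_forall fun ω => by positivity), integral_mul_const]
  refine ENNReal.ofReal_le_one.2 ?_
  have h2 : ∫ ω, Real.exp (l * ε t i j ω) ∂μ ≤ Real.exp (l ^ 2 / 8) := by
    refine (hsub.mgf_le l).trans (Real.exp_le_exp.2 (le_of_eq ?_))
    push_cast
    ring
  calc _ ≤ Real.exp (l ^ 2 / 8) * Real.exp (-(l ^ 2 / 8)) := by gcongr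
    _ = 1 := by rw [← Real.exp_add]; simp

lemma measurable_env (hE : IsEnvironment μ ε a b) : Measurable
    fun ω => ((fun s i j => ε s i j ω), (fun n => a n ω), fun n => b n ω) :=
  Measurable.prodMk (measurable_pi_lambda _ fun s => measurable_pi_lambda _ fun i =>
    measurable_pi_lambda _ fun j => hE.measurable_noise s i j)
    (Measurable.prodMk (measurable_pi_lambda _ fun n => hE.measurable_row n)
      (measurable_pi_lambda _ fun n => hE.measurable_col n))

/-- The exponential supermartingale has mean at most one. -/
theorem lintegral_tilt_le [IsProbabilityMeasure μ] (hE : IsEnvironment μ ε a b)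
    (hsel : IsCausal sel) (l : ℝ) (m : ℕ) :
    ∫⁻ ω, ENNReal.ofReal (tilt l (fun s i j => ε s i j ω)
      (sel (fun s i j => ε s i j ω) (fun n => a n ω) (fun n => b n ω)) m) ∂μ ≤ 1 := by
  induction m with
  | zero => simp [tilt]
  | succ m ih =>
    refine le_trans ?_ ih
    set A : Option (ℕ × Fin N × Fin M) → Set Ω := fun o =>
      {ω | sel (fun s i j => ε s i j ω) (fun n => a n ω) (fun n => b n ω) m = o} with hA
    have hAm : ∀ o, MeasurableSet (A o) := fun o =>
      ((hsel.measurable m).comp (measurable_env hE)) (MeasurableSpace.measurableSet_top (s := {o}))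
    have hAd : Pairwise (Function.onFun Disjoint A) := fun o o' hne =>
      Set.disjoint_left.2 fun ω h h' => hne (h.symm.trans h')
    have hAu : ⋃ o, A o = Set.univ := Set.eq_univ_of_forall fun ω => Set.mem_iUnion.2 ⟨_, rfl⟩
    rw [← setLIntegral_univ, ← hAu, lintegral_iUnion hAm hAd, ← setLIntegral_univ
      (f := fun ω => ENNReal.ofReal (tilt l _ _ m)), ← hAu, lintegral_iUnion hAm hAd]
    refine ENNReal.tsum_le_tsum fun o => ?_
    rcases o with _ | ⟨t, i, j⟩
    · refine le_of_eq (setLIntegral_congr_fun (hAm _) fun ω hω => ?_)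
      have hω' : sel (fun s i j => ε s i j ω) (fun n => a n ω) (fun n => b n ω) m = none := hω
      simp only [tilt, Finset.prod_range_succ, hω', tiltFactor, mul_one]
    · have hH : Measurable[pastSigma ε a b t] ((A (some (t, i, j))).indicator fun ω =>
          ENNReal.ofReal (tilt l (fun s i j => ε s i j ω)
            (sel (fun s i j => ε s i j ω) (fun n => a n ω) (fun n => b n ω)) m)) := by
        set D : Set ((ℕ → Fin N → Fin M → ℝ) × (ℕ → Fin N) × (ℕ → Fin M)) :=
          {e | sel e.1 e.2.1 e.2.2 m = some (t, i, j)} with hD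
        have h1 : Measurable (D.indicator
            fun e => ENNReal.ofReal (tilt l e.1 (sel e.1 e.2.1 e.2.2) m)) :=
          (hsel.measurable_tilt l m).ennreal_ofReal.indicator
            (hsel.measurable m (MeasurableSpace.measurableSet_top (s := {some (t, i, j)})))
        convert h1.comp (measurable_truncate_past (ε := ε) (a := a) (b := b) t) using 1
        ext ω
        have h2 := hsel.tilt_truncate l m (fun s i j => ε s i j ω) (fun n => a n ω)
          (fun n => b n ω) (t := t) (i := i) (j := j)
        by_cases hω : sel (fun s i j => ε s i j ω) (fun n => a n ω) (fun n => b n ω) m =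
            some (t, i, j)
        · rw [Function.comp_apply, Set.indicator_of_mem (show ω ∈ A (some (t, i, j)) from hω),
            Set.indicator_of_mem (s := D) (h2.1.2 hω), h2.2 hω]
        · rw [Function.comp_apply, Set.indicator_of_notMem (show ω ∉ A (some (t, i, j)) from hω),
            Set.indicator_of_notMem (s := D) fun h => hω (h2.1.1 h)]
      have hg : Measurable[MeasurableSpace.comap (ε t i j) inferInstance]
          fun ω => ENNReal.ofReal (Real.exp (l * ε t i j ω - l ^ 2 / 8)) :=
        (by fun_prop : Measurable fun r : ℝ =>
          ENNReal.ofReal (Real.exp (l * r - l ^ 2 / 8))).comp (comap_measurable _)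
      calc _ = ∫⁻ ω, (A (some (t, i, j))).indicator (fun ω =>
              ENNReal.ofReal (tilt l (fun s i j => ε s i j ω)
                (sel (fun s i j => ε s i j ω) (fun n => a n ω) (fun n => b n ω)) m)) ω *
              ENNReal.ofReal (Real.exp (l * ε t i j ω - l ^ 2 / 8)) ∂μ := by
            rw [← lintegral_indicator (hAm _)]
            refine lintegral_congr fun ω => ?_
            by_cases hω : ω ∈ A (some (t, i, j))
            · rw [Set.indicator_of_mem hω, Set.indicator_of_mem hω,
                ← ENNReal.ofReal_mul (tilt_nonneg _ _ _ _)]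
              have hω' : sel (fun s i j => ε s i j ω) (fun n => a n ω) (fun n => b n ω) m =
                some (t, i, j) := hω
              simp only [tilt, Finset.prod_range_succ, hω', tiltFactor]
            · rw [Set.indicator_of_notMem hω, Set.indicator_of_notMem hω, zero_mul]
        _ = _ := lintegral_mul_eq_lintegral_mul_lintegral_of_independent_measurableSpace
              (pastSigma_le hE t) ((hE.measurable_noise t i j).comap_le)
              (indep_pastSigma hE t i j) hH hg
        _ ≤ (∫⁻ ω, (A (some (t, i, j))).indicator (fun ω =>
              ENNReal.ofReal (tilt l (fun s i j => ε s i j ω)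
                (sel (fun s i j => ε s i j ω) (fun n => a n ω) (fun n => b n ω)) m)) ω ∂μ) * 1 := by
            gcongr
            exact lintegral_tiltFactor_le hE l t i j
        _ = _ := by rw [mul_one, lintegral_indicator (hAm _)]

/-- Markov's inequality for the exponential supermartingale. -/
theorem measure_tilt_ge_le [IsProbabilityMeasure μ] (hE : IsEnvironment μ ε a b)
    (hsel : IsCausal sel) (l : ℝ) (m : ℕ) {β : ℝ} (hβ : 0 < β) :
    μ.real {ω | β ^ 2 ≤ tilt l (fun s i j => ε s i j ω)
      (sel (fun s i j => ε s i j ω) (fun n => a n ω) (fun n => b n ω)) m} ≤ 1 / β ^ 2 := by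
  have hm : Measurable fun ω => ENNReal.ofReal (tilt l (fun s i j => ε s i j ω)
      (sel (fun s i j => ε s i j ω) (fun n => a n ω) (fun n => b n ω)) m) :=
    ((hsel.measurable_tilt l m).comp (measurable_env hE)).ennreal_ofReal
  have h1 := (mul_meas_ge_le_lintegral hm (μ := μ) (ENNReal.ofReal (β ^ 2))).trans
    (lintegral_tilt_le hE hsel l m)
  have h2 : {ω | ENNReal.ofReal (β ^ 2) ≤ ENNReal.ofReal (tilt l (fun s i j => ε s i j ω)
      (sel (fun s i j => ε s i j ω) (fun n => a n ω) (fun n => b n ω)) m)} =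
      {ω | β ^ 2 ≤ tilt l (fun s i j => ε s i j ω)
      (sel (fun s i j => ε s i j ω) (fun n => a n ω) (fun n => b n ω)) m} := by
    ext ω
    exact ENNReal.ofReal_le_ofReal_iff (tilt_nonneg _ _ _ _)
  rw [h2] at h1
  have h3 := ENNReal.toReal_mono ENNReal.one_ne_top h1
  rw [ENNReal.toReal_mul, ENNReal.toReal_ofReal (by positivity), ENNReal.toReal_one] at h3
  rw [le_div_iff₀' (by positivity)]
  exact h3

end Tilt

/-! ### Sampling by rows and by columns -/

section Selection

variable {N M : ℕ}

/-- The observations with means `u i * v j` and noise `e`. -/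
def observations (u : Fin N → ℝ) (v : Fin M → ℝ) (e : ℕ → Fin N → Fin M → ℝ) :
    ℕ → Fin N → Fin M → ℝ :=
  fun t i j => u i * v j + e t i j

/-- The pairs of a step are played at different times, between the time counters of this step
and the next one. -/
lemma rowTime_lt {σ : State N M} (i : Fin N) (hi : i ∈ σ.I) : σ.rowTime i < σ.t + σ.I.card := by
  unfold State.rowTime
  gcongr
  refine (Finset.ssubset_iff_subset_ne.2 ⟨Finset.filter_subset _ _, fun h => ?_⟩)
  have := Finset.mem_filter.1 (h.symm ▸ hi)
  exact lt_irrefl _ this.2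

lemma colTime_lt {σ : State N M} (j : Fin M) (hj : j ∈ σ.J) :
    σ.colTime j < σ.t + σ.I.card + σ.J.card := by
  unfold State.colTime
  gcongr
  refine (Finset.ssubset_iff_subset_ne.2 ⟨Finset.filter_subset _ _, fun h => ?_⟩)
  have := Finset.mem_filter.1 (h.symm ▸ hj)
  exact lt_irrefl _ this.2

/-- The memory depends only on the observations at past times. -/
lemma run_congr (δ : ℝ) {x x' : ℕ → Fin N → Fin M → ℝ} (a : ℕ → Fin N) (b : ℕ → Fin M) {t : ℕ}
    (hx : ∀ s < t, x s = x' s) (m : ℕ) (hm : (run δ x a b m).t ≤ t) :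
    run δ x' a b m = run δ x a b m := by
  induction m with
  | zero => rfl
  | succ m ih =>
    rw [run_succ_t] at hm
    have hrun := ih (by omega)
    have hupd : updated δ x' a b m = updated δ x a b m := by rw [updated, hrun]; rfl
    rw [run_succ, run_succ, hupd]
    congr 1
    have ht : (updated δ x a b m).t = (run δ x a b m).t := rfl
    simp only [State.sample]
    congr 1
    · funext i j
      congr 1
      refine if_ctx_congr Iff.rfl (fun h => ?_) fun _ => rfl
      rw [hx _ (by have := rowTime_lt i h.1; omega)]
    · funext i j
      congr 1
      refine if_ctx_congr Iff.rfl (fun h => ?_) fun _ => rfl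
      rw [hx _ (by have := colTime_lt j h.2; omega)]

open Classical in
/-- The noise variable that enters the statistic `k` of row `i` in step `m`, as long as the
statistic has fewer than `n` samples. -/
def rowSelection (u : Fin N → ℝ) (v : Fin M → ℝ) (δ : ℝ) (k : Option (Fin M)) (i : Fin N) (n : ℕ)
    (e : ℕ → Fin N → Fin M → ℝ) (a : ℕ → Fin N) (b : ℕ → Fin M) (m : ℕ) :
    Option (ℕ × Fin N × Fin M) :=
  let σ := updated δ (observations u v e) a b m
  if (i ∈ σ.I ∧ ∀ j ∈ k, j = σ.hV (b m)) ∧ stat σ.C k i < n then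
    some (σ.rowTime i, i, σ.hV (b m)) else none

open Classical in
/-- The noise variable that enters the statistic `k` of column `j` in step `m`, if this step
belongs to window `w`, and as long as the statistic has fewer than `n` samples. -/
def colSelection (u : Fin N → ℝ) (v : Fin M → ℝ) (δ : ℝ) (w : ℕ) (k : Option (Fin N)) (j : Fin M)
    (n : ℕ) (e : ℕ → Fin N → Fin M → ℝ) (a : ℕ → Fin N) (b : ℕ → Fin M) (m : ℕ) :
    Option (ℕ × Fin N × Fin M) :=
  let σ := updated δ (observations u v e) a b m
  if σ.w = w ∧ (j ∈ σ.J ∧ ∀ i ∈ k, i = σ.hU (a m)) ∧ stat (fun j i => σ.Cw i j) k j < n then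
    some (σ.colTime j, σ.hU (a m), j) else none

variable (u : Fin N → ℝ) (v : Fin M → ℝ) (δ : ℝ)

lemma measurable_observations (t : ℕ) (i : Fin N) (j : Fin M) :
    Measurable fun e : (ℕ → Fin N → Fin M → ℝ) × (ℕ → Fin N) × (ℕ → Fin M) =>
      observations u v e.1 t i j := by
  unfold observations
  fun_prop

/-- A selection rule is causal if in each step it selects a variable that is played in that step,
by a rule that depends only on the updated memory and the draws. -/
lemma isCausal_of_state
    {sel : (ℕ → Fin N → Fin M → ℝ) → (ℕ → Fin N) → (ℕ → Fin M) → ℕ → Option (ℕ × Fin N × Fin M)}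
    (hmeas : ∀ m, Measurable fun e : (ℕ → Fin N → Fin M → ℝ) × (ℕ → Fin N) × (ℕ → Fin M) =>
      sel e.1 e.2.1 e.2.2 m)
    (hstate : ∀ e e' a b m, updated δ (observations u v e') a b m =
      updated δ (observations u v e) a b m → sel e' a b m = sel e a b m)
    (htime : ∀ e a b m t i j, sel e a b m = some (t, i, j) →
      (run δ (observations u v e) a b m).t ≤ t ∧ t < (run δ (observations u v e) a b (m + 1)).t) :
    IsCausal sel where
  measurable := hmeas
  congr e e' a b m t i j hee h s hs := by
    refine hstate e e' a b s ?_
    have h1 := (htime e a b m t i j h).1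
    have h2 : (run δ (observations u v e) a b s).t ≤ (run δ (observations u v e) a b m).t :=
      run_t_mono δ (observations u v e) a b hs
    unfold updated
    rw [run_congr δ a b (x := observations u v e) (x' := observations u v e') (t := t)
      (fun s hs => by unfold observations; simp only [hee s hs]) s (by omega)]
  lt e a b m t i j t' i' j' h s hs h' := by
    have h1 := (htime e a b m t i j h).1
    have h2 := (htime e a b s t' i' j' h').2
    have h3 : (run δ (observations u v e) a b (s + 1)).t ≤ (run δ (observations u v e) a b m).t :=
      run_t_mono δ (observations u v e) a b hs
    omega

lemma rowSelection_isCausal (k : Option (Fin M)) (i : Fin N) (n : ℕ) :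
    IsCausal (rowSelection u v δ k i n) := by
  classical
  refine isCausal_of_state u v δ (fun m => ?_) (fun e e' a b m h => ?_) fun e a b m t i' j h => ?_
  · have hs := measurableState_updated (measurable_observations u v)
      (a := fun e => e.2.1) (b := fun e => e.2.2) (fun m => by fun_prop) (fun m => by fun_prop) δ m
    exact measurable_discrete (hs.C.prodMk (hs.t.prodMk (hs.hU.prodMk (hs.hV.prodMk
      (by fun_prop : Measurable fun e : (ℕ → Fin N → Fin M → ℝ) × (ℕ → Fin N) × (ℕ → Fin M) =>
        e.2.2 m))))) fun p =>
      if (i ∈ active p.2.2.1 ∧ ∀ j ∈ k, j = p.2.2.2.1 p.2.2.2.2) ∧ stat p.1 k i < n then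
        some (p.2.1 + ((active p.2.2.1).filter (· < i)).card, i, p.2.2.2.1 p.2.2.2.2) else none
  · unfold rowSelection
    rw [h]
  · unfold rowSelection at h
    dsimp only at h
    split_ifs at h with hc
    have ht : (updated δ (observations u v e) a b m).rowTime i = t := by
      simpa using congrArg (Option.map Prod.fst) h
    rw [← ht, run_succ_t]
    have := rowTime_lt i hc.1.1
    exact ⟨Nat.le_add_right _ _, lt_of_lt_of_le this (Nat.le_add_right _ _)⟩

lemma colSelection_isCausal (w : ℕ) (k : Option (Fin N)) (j : Fin M) (n : ℕ) :
    IsCausal (colSelection u v δ w k j n) := by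
  classical
  refine isCausal_of_state u v δ (fun m => ?_) (fun e e' a b m h => ?_) fun e a b m t i j' h => ?_
  · have hs := measurableState_updated (measurable_observations u v)
      (a := fun e => e.2.1) (b := fun e => e.2.2) (fun m => by fun_prop) (fun m => by fun_prop) δ m
    exact measurable_discrete (hs.w.prodMk (hs.Cw.prodMk (hs.t.prodMk (hs.hU.prodMk (hs.hV.prodMk
      (by fun_prop : Measurable fun e : (ℕ → Fin N → Fin M → ℝ) × (ℕ → Fin N) × (ℕ → Fin M) =>
        e.2.1 m)))))) fun p =>
      if p.1 = w ∧ (j ∈ active p.2.2.2.2.1 ∧ ∀ i ∈ k, i = p.2.2.2.1 p.2.2.2.2.2) ∧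
          stat (fun j i => p.2.1 i j) k j < n then
        some (p.2.2.1 + (active p.2.2.2.1).card + ((active p.2.2.2.2.1).filter (· < j)).card,
          p.2.2.2.1 p.2.2.2.2.2, j) else none
  · unfold colSelection
    rw [h]
  · unfold colSelection at h
    dsimp only at h
    split_ifs at h with hc
    have ht : (updated δ (observations u v e) a b m).colTime j = t := by
      simpa using congrArg (Option.map Prod.fst) h
    rw [← ht, run_succ_t]
    refine ⟨?_, colTime_lt j hc.2.1.1⟩
    unfold State.colTime
    exact (Nat.le_add_right _ _).trans (Nat.le_add_right _ _)

lemma stat_add_ite {ι κ A : Type} [Fintype κ] [AddCommMonoid A] {S S' : ι → κ → A}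
    {i : ι} {P : Prop} {k₀ : κ} [∀ k, Decidable (P ∧ k = k₀)] {y : κ → A}
    (h : ∀ k, S' i k = S i k + if P ∧ k = k₀ then y k else 0) (k : Option κ)
    [Decidable (P ∧ ∀ k' ∈ k, k' = k₀)] :
    stat S' k i = stat S k i + if P ∧ ∀ k' ∈ k, k' = k₀ then y k₀ else 0 := by
  cases k with
  | none =>
    simp only [stat, h, Finset.sum_add_distrib]
    congr 1
    by_cases hP : P
    · classical
      simp only [hP, true_and, Option.mem_def, reduceCtorEq, false_imp_iff, implies_true, if_true]
      rw [Finset.sum_eq_single_of_mem k₀ (Finset.mem_univ _) (fun k _ hk => if_neg hk), if_pos rfl]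
    · simp [hP]
  | some k =>
    simp only [stat, h, Option.mem_def, Option.some.injEq, forall_eq']
    congr 1
    by_cases hk : k = k₀ <;> simp [hk]

/-- The supermartingale of a statistic that starts in step `m₀` and has count `c` and centred sum
`d`. -/
lemma tilt_eq_exp {l : ℝ} {e : ℕ → Fin N → Fin M → ℝ} {o : ℕ → Option (ℕ × Fin N × Fin M)}
    {c : ℕ → ℕ} {d : ℕ → ℝ} {m₀ m n : ℕ} (hm : m₀ ≤ m) (ho : ∀ s < m₀, o s = none)
    (hc : c m₀ = 0) (hd : d m₀ = 0)
    (hstep : ∀ s, m₀ ≤ s → s < m → c s ≤ c (s + 1) ∧ (c (s + 1) ≤ n →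
      (o s = none ∧ c (s + 1) = c s ∧ d (s + 1) = d s) ∨
      ∃ t i j, o s = some (t, i, j) ∧ c (s + 1) = c s + 1 ∧ d (s + 1) = d s + e t i j))
    (hn : c m ≤ n) : tilt l e o m = Real.exp (l * d m - l ^ 2 / 8 * c m) := by
  induction m, hm using Nat.le_induction with
  | base =>
    rw [hc, hd, tilt, Finset.prod_eq_one fun s hs => by rw [ho s (Finset.mem_range.1 hs)]; rfl]
    simp
  | succ m hm ih =>
    obtain ⟨h1, h2⟩ := hstep m hm (Nat.lt_succ_self m)
    have ih' := ih (fun s hs hsm => hstep s hs (by omega)) (h1.trans hn)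
    unfold tilt at ih' ⊢
    rw [Finset.prod_range_succ, ih']
    rcases h2 hn with ⟨h3, h4, h5⟩ | ⟨t, i, j, h3, h4, h5⟩
    · rw [h3, h4, h5]; simp [tiltFactor]
    · rw [h3, h4, h5, tiltFactor, ← Real.exp_add]
      push_cast
      ring_nf

lemma tilt_eq_of_none {l : ℝ} {e : ℕ → Fin N → Fin M → ℝ} {o : ℕ → Option (ℕ × Fin N × Fin M)}
    {m m' : ℕ} (hm : m ≤ m') (ho : ∀ s, m ≤ s → s < m' → o s = none) :
    tilt l e o m' = tilt l e o m := by
  induction m', hm using Nat.le_induction with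
  | base => rfl
  | succ m' hm ih =>
    rw [← ih fun s hs hs' => ho s hs (by omega)]
    unfold tilt
    rw [Finset.prod_range_succ, ho m' hm (Nat.lt_succ_self _)]
    simp [tiltFactor]

/-- The parameter `±4 √(log β / n)` is the best one to control the deviation of a sum of `n`
terms. -/
def tiltParam (β : ℝ) (n : ℕ) (sgn : Bool) : ℝ :=
  (if sgn then 1 else -1) * (4 * √(Real.log β / n))

lemma abs_le_of_tilt_lt {β d : ℝ} {n : ℕ} (hβ : 1 < β) (hn : 0 < n)
    (h : ∀ sgn, Real.exp (tiltParam β n sgn * d - tiltParam β n sgn ^ 2 / 8 * n) < β ^ 2) :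
    |d| ≤ √(n * Real.log β) := by
  have hlog := Real.log_pos hβ
  have hn' : (0 : ℝ) < n := by exact_mod_cast hn
  have hr : 0 < √(Real.log β / n) := Real.sqrt_pos.2 (by positivity)
  have hrr : √(Real.log β / n) * √(n * Real.log β) = Real.log β := by
    rw [← Real.sqrt_mul (by positivity), show Real.log β / n * (n * Real.log β) =
      Real.log β ^ 2 by field_simp, Real.sqrt_sq hlog.le]
  have key : ∀ sgn : Bool, (if sgn then 1 else -1 : ℝ) * d ≤ √(n * Real.log β) := by
    intro sgn
    have h1 := h sgn
    rw [← Real.exp_log (by positivity : 0 < β ^ 2), Real.exp_lt_exp, Real.log_pow] at h1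
    have h2 : tiltParam β n sgn ^ 2 / 8 * n = 2 * Real.log β := by
      unfold tiltParam
      rw [mul_pow, mul_pow, Real.sq_sqrt (by positivity)]
      cases sgn <;> field_simp <;> norm_num
    rw [h2] at h1
    unfold tiltParam at h1
    push_cast at h1
    have h3 : √(Real.log β / n) * ((if sgn then 1 else -1 : ℝ) * d) ≤
        √(Real.log β / n) * √(n * Real.log β) := by
      rw [hrr]; linarith
    exact le_of_mul_le_mul_left h3 hr
  rw [abs_le]
  have h1 := key true
  have h2 := key false
  simp only [if_true, Bool.false_eq_true, if_false] at h1 h2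
  constructor <;> linarith

variable {e : ℕ → Fin N → Fin M → ℝ} {a : ℕ → Fin N} {b : ℕ → Fin M} {T : ℕ}

/-- The statistics on rows are accurate if no supermartingale has become large. -/
lemma rowAccurate_of_tilt_lt (hT : 2 ≤ T)
    (h : ∀ k i, ∀ n ∈ Finset.Icc 1 T, ∀ sgn, tilt (tiltParam T n sgn) e
      (rowSelection u v (1 / (T : ℝ)) k i n e a b) T < (T : ℝ) ^ 2) :
    RowAccurate u v T (observations u v e) a b := by
  classical
  intro m hm i k hpos
  set x := observations u v e with hx
  set c : ℕ → ℕ := fun m => stat (run (1 / (T : ℝ)) x a b m).C k i with hcdef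
  set d : ℕ → ℝ := fun m => stat (run (1 / (T : ℝ)) x a b m).X k i -
    u i * stat (fun i k => ((run (1 / (T : ℝ)) x a b m).C i k : ℝ) * v k) k i with hddef
  have hC : ∀ s, c (s + 1) = c s + if i ∈ (updated (1 / (T : ℝ)) x a b s).I ∧
      ∀ j ∈ k, j = (updated (1 / (T : ℝ)) x a b s).hV (b s) then 1 else 0 := fun s =>
    stat_add_ite (S := (run (1 / (T : ℝ)) x a b s).C) (S' := (run (1 / (T : ℝ)) x a b (s + 1)).C)
      (y := fun _ => 1) (fun j => by
      rw [run_succ, closeWindow_C]; simp only [State.sample]; rfl) k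
  have hX : ∀ s, stat (run (1 / (T : ℝ)) x a b (s + 1)).X k i =
      stat (run (1 / (T : ℝ)) x a b s).X k i + if i ∈ (updated (1 / (T : ℝ)) x a b s).I ∧
        ∀ j ∈ k, j = (updated (1 / (T : ℝ)) x a b s).hV (b s) then
          x ((updated (1 / (T : ℝ)) x a b s).rowTime i) i
            ((updated (1 / (T : ℝ)) x a b s).hV (b s)) else 0 := fun s =>
    stat_add_ite (y := fun j => x ((updated (1 / (T : ℝ)) x a b s).rowTime i) i j) (fun j => by
      rw [run_succ, closeWindow_X]; simp only [State.sample]; rfl) k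
  have hCv : ∀ s, stat (fun i k => ((run (1 / (T : ℝ)) x a b (s + 1)).C i k : ℝ) * v k) k i =
      stat (fun i k => ((run (1 / (T : ℝ)) x a b s).C i k : ℝ) * v k) k i +
        if i ∈ (updated (1 / (T : ℝ)) x a b s).I ∧
        ∀ j ∈ k, j = (updated (1 / (T : ℝ)) x a b s).hV (b s) then
          v ((updated (1 / (T : ℝ)) x a b s).hV (b s)) else 0 := fun s =>
    stat_add_ite (S := fun i k => ((run (1 / (T : ℝ)) x a b s).C i k : ℝ) * v k) (y := v)
      (fun j => by
        rw [run_succ, closeWindow_C]; simp only [State.sample]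
        push_cast
        rw [add_mul, ite_mul, one_mul, zero_mul]
        rfl) k
  have hmono : Monotone c := monotone_nat_of_le_succ fun s => by rw [hC]; exact Nat.le_add_right _ _
  have hcT : c m ≤ T := (stat_C_le m k i).trans hm
  have hsel : ∀ s, rowSelection u v (1 / (T : ℝ)) k i (c m) e a b s =
      if (i ∈ (updated (1 / (T : ℝ)) x a b s).I ∧
        ∀ j ∈ k, j = (updated (1 / (T : ℝ)) x a b s).hV (b s)) ∧ c s < c m then
        some ((updated (1 / (T : ℝ)) x a b s).rowTime i, i,
          (updated (1 / (T : ℝ)) x a b s).hV (b s)) else none := fun s => rfl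
  refine abs_le_of_tilt_lt (d := d m) (n := c m) (by exact_mod_cast hT) hpos fun sgn => ?_
  refine lt_of_eq_of_lt ?_ (h k i (c m) (Finset.mem_Icc.2 ⟨hpos, hcT⟩) sgn)
  rw [tilt_eq_of_none hm fun s hs _ => by
    rw [hsel, if_neg fun hh => absurd hh.2 (not_lt.2 (hmono hs))]]
  refine (tilt_eq_exp (c := c) (d := d) (m₀ := 0) (n := c m) (Nat.zero_le m)
    (fun s hs => absurd hs (Nat.not_lt_zero s)) ?_ ?_ (fun s _ _ => ⟨hmono (Nat.le_succ s),
      fun hle => ?_⟩) le_rfl).symm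
  · cases k <;> simp [hcdef, stat, run, State.init]
  · cases k <;> simp [hddef, stat, run, State.init]
  · by_cases hcond : i ∈ (updated (1 / (T : ℝ)) x a b s).I ∧
        ∀ j ∈ k, j = (updated (1 / (T : ℝ)) x a b s).hV (b s)
    · right
      have hc1 : c (s + 1) = c s + 1 := by rw [hC, if_pos hcond]
      refine ⟨_, _, _, by rw [hsel, if_pos ⟨hcond, by omega⟩], hc1, ?_⟩
      simp only [hddef]
      rw [hX, hCv, if_pos hcond, if_pos hcond, hx]
      simp only [observations]
      ring
    · left
      refine ⟨by rw [hsel, if_neg fun hh => hcond hh.1], by rw [hC, if_neg hcond, add_zero], ?_⟩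
      simp only [hddef]
      rw [hX, hCv, if_neg hcond, if_neg hcond, add_zero, add_zero]

/-- The statistics on columns are accurate if no supermartingale has become large. -/
lemma colAccurate_of_tilt_lt (w : ℕ)
    (h : ∀ k j, ∀ n ∈ Finset.Icc 1 (blockLength w), ∀ sgn, tilt (tiltParam (blockLength w) n sgn) e
      (colSelection u v (1 / (T : ℝ)) w k j n e a b) T < (blockLength w : ℝ) ^ 2) :
    ColAccurate u v T (observations u v e) a b w := by
  classical
  intro m hm hw j k hpos
  set x := observations u v e with hx
  obtain ⟨m₀, hm₀, hst, hw₀⟩ := exists_isStart (1 / (T : ℝ)) x a b m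
  rw [hw] at hw₀
  set c : ℕ → ℕ := fun m => stat (fun j i => (run (1 / (T : ℝ)) x a b m).Cw i j) k j with hcdef
  set d : ℕ → ℝ := fun m => stat (fun j i => (run (1 / (T : ℝ)) x a b m).Xw i j) k j -
    v j * stat (fun j i => ((run (1 / (T : ℝ)) x a b m).Cw i j : ℝ) * u i) k j with hddef
  have hC : ∀ s, (run (1 / (T : ℝ)) x a b (s + 1)).w = (run (1 / (T : ℝ)) x a b s).w →
      c (s + 1) = c s + if j ∈ (updated (1 / (T : ℝ)) x a b s).J ∧
        ∀ i ∈ k, i = (updated (1 / (T : ℝ)) x a b s).hU (a s) then 1 else 0 := fun s hs =>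
    stat_add_ite (S := fun j i => (run (1 / (T : ℝ)) x a b s).Cw i j)
      (S' := fun j i => (run (1 / (T : ℝ)) x a b (s + 1)).Cw i j) (y := fun _ => 1)
      (fun i => by
        rw [run_succ_of_w_eq hs]; simp only [sampled, State.sample, and_comm]; rfl) k
  have hX : ∀ s, (run (1 / (T : ℝ)) x a b (s + 1)).w = (run (1 / (T : ℝ)) x a b s).w →
      stat (fun j i => (run (1 / (T : ℝ)) x a b (s + 1)).Xw i j) k j =
      stat (fun j i => (run (1 / (T : ℝ)) x a b s).Xw i j) k j +
        if j ∈ (updated (1 / (T : ℝ)) x a b s).J ∧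
        ∀ i ∈ k, i = (updated (1 / (T : ℝ)) x a b s).hU (a s) then
          x ((updated (1 / (T : ℝ)) x a b s).colTime j)
            ((updated (1 / (T : ℝ)) x a b s).hU (a s)) j else 0 := fun s hs =>
    stat_add_ite (S := fun j i => (run (1 / (T : ℝ)) x a b s).Xw i j)
      (y := fun i => x ((updated (1 / (T : ℝ)) x a b s).colTime j) i j) (fun i => by
        rw [run_succ_of_w_eq hs]; simp only [sampled, State.sample, and_comm]; rfl) k
  have hCu : ∀ s, (run (1 / (T : ℝ)) x a b (s + 1)).w = (run (1 / (T : ℝ)) x a b s).w →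
      stat (fun j i => ((run (1 / (T : ℝ)) x a b (s + 1)).Cw i j : ℝ) * u i) k j =
      stat (fun j i => ((run (1 / (T : ℝ)) x a b s).Cw i j : ℝ) * u i) k j +
        if j ∈ (updated (1 / (T : ℝ)) x a b s).J ∧
        ∀ i ∈ k, i = (updated (1 / (T : ℝ)) x a b s).hU (a s) then
          u ((updated (1 / (T : ℝ)) x a b s).hU (a s)) else 0 := fun s hs =>
    stat_add_ite (S := fun j i => ((run (1 / (T : ℝ)) x a b s).Cw i j : ℝ) * u i) (y := u)
      (fun i => by
        rw [run_succ_of_w_eq hs]; simp only [sampled, State.sample, and_comm]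
        push_cast
        rw [add_mul, ite_mul, one_mul, zero_mul]
        rfl) k
  have hsel : ∀ s, colSelection u v (1 / (T : ℝ)) w k j (c m) e a b s =
      if (run (1 / (T : ℝ)) x a b s).w = w ∧ (j ∈ (updated (1 / (T : ℝ)) x a b s).J ∧
        ∀ i ∈ k, i = (updated (1 / (T : ℝ)) x a b s).hU (a s)) ∧ c s < c m then
        some ((updated (1 / (T : ℝ)) x a b s).colTime j,
          (updated (1 / (T : ℝ)) x a b s).hU (a s), j) else none := fun s => rfl
  have hmono : ∀ s, m ≤ s → (run (1 / (T : ℝ)) x a b s).w = w → c m ≤ c s := by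
    intro s hs
    induction s, hs using Nat.le_induction with
    | base => exact fun _ => le_rfl
    | succ s hs ih =>
      intro hws
      have hws' : (run (1 / (T : ℝ)) x a b s).w = w :=
        (w_eq_of_mem (hw.trans hws.symm) hs (Nat.le_succ s)).trans hws
      rw [hC s (hws.trans hws'.symm)]
      exact (ih hws').trans (Nat.le_add_right _ _)
  have hcT : c m ≤ blockLength w := by
    have := (stat_Cw_le m k j).trans (run_s_le (1 / (T : ℝ)) x a b m)
    rwa [hw] at this
  refine abs_le_of_tilt_lt (d := d m) (n := c m) (by exact_mod_cast two_le_blockLength w) hpos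
    fun sgn => ?_
  refine lt_of_eq_of_lt ?_ (h k j (c m) (Finset.mem_Icc.2 ⟨hpos, hcT⟩) sgn)
  rw [tilt_eq_of_none hm fun s hs _ => by
    rw [hsel, if_neg fun hh => absurd hh.2.2 (not_lt.2 (hmono s hs hh.1))]]
  refine (tilt_eq_exp (c := c) (d := d) (m₀ := m₀) (n := c m) hm₀ (fun s hs => ?_) ?_ ?_
    (fun s hs hsm => ?_) le_rfl).symm
  · rw [hsel, if_neg fun hh => absurd (hst.first s (hh.1.trans hw₀.symm)) (not_le.2 hs)]
  · cases k <;> simp only [hcdef, stat, hst.Cw, Finset.sum_const_zero]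
  · have hXw : ∀ i, (run (1 / (T : ℝ)) x a b m₀).Xw i j = 0 := hst.Xw j
    cases k <;> simp only [hddef, stat, hst.Cw, hXw, Nat.cast_zero, zero_mul, mul_zero,
      Finset.sum_const_zero, sub_zero]
  · have hws : (run (1 / (T : ℝ)) x a b s).w = w :=
      (w_eq_of_mem (hw₀.trans hw.symm) hs hsm.le).trans hw
    have hws' : (run (1 / (T : ℝ)) x a b (s + 1)).w = w :=
      (w_eq_of_mem (hw₀.trans hw.symm) (by omega) (by omega)).trans hw
    have hws'' := hws'.trans hws.symm
    refine ⟨by rw [hC s hws'']; exact Nat.le_add_right _ _, fun hle => ?_⟩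
    by_cases hcond : j ∈ (updated (1 / (T : ℝ)) x a b s).J ∧
        ∀ i ∈ k, i = (updated (1 / (T : ℝ)) x a b s).hU (a s)
    · right
      have hc1 : c (s + 1) = c s + 1 := by rw [hC s hws'', if_pos hcond]
      refine ⟨_, _, _, by rw [hsel, if_pos ⟨hws, hcond, by omega⟩], hc1, ?_⟩
      simp only [hddef]
      rw [hX s hws'', hCu s hws'', if_pos hcond, if_pos hcond, hx]
      simp only [observations]
      ring
    · left
      refine ⟨by rw [hsel, if_neg fun hh => hcond hh.2.1],
        by rw [hC s hws'', if_neg hcond, add_zero], ?_⟩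
      simp only [hddef]
      rw [hX s hws'', hCu s hws'', if_neg hcond, if_neg hcond, add_zero, add_zero]

end Selection

/-! ### Expected regret -/

section Expectation

variable {N M : ℕ}

section Failure

variable {Ω : Type*} [MeasurableSpace Ω] {μ : Measure Ω}
  {ε : ℕ → Fin N → Fin M → Ω → ℝ} {a : ℕ → Ω → Fin N} {b : ℕ → Ω → Fin M}
  {ι : Type} [Fintype ι]
  {sel : ι → ℕ → (ℕ → Fin N → Fin M → ℝ) → (ℕ → Fin N) → (ℕ → Fin M) → ℕ →
      Option (ℕ × Fin N × Fin M)}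

/-- The event that within the first `m` steps one of the supermartingales with parameters
`l q n`, `1 ≤ n ≤ K`, reaches the level `K ^ 2`. -/
def failure (ε : ℕ → Fin N → Fin M → Ω → ℝ) (a : ℕ → Ω → Fin N) (b : ℕ → Ω → Fin M)
    (sel : ι → ℕ → (ℕ → Fin N → Fin M → ℝ) → (ℕ → Fin N) → (ℕ → Fin M) → ℕ →
      Option (ℕ × Fin N × Fin M)) (l : ι → ℕ → ℝ) (K m : ℕ) : Set Ω :=
  ⋃ q, ⋃ n ∈ Finset.Icc 1 K, {ω | (K : ℝ) ^ 2 ≤ tilt (l q n) (fun s i j => ε s i j ω)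
      (sel q n (fun s i j => ε s i j ω) (fun n => a n ω) (fun n => b n ω)) m}

lemma measurableSet_failure (hE : IsEnvironment μ ε a b) (hsel : ∀ q n, IsCausal (sel q n))
    (l : ι → ℕ → ℝ) (K m : ℕ) : MeasurableSet (failure ε a b sel l K m) :=
  MeasurableSet.iUnion fun q => Finset.measurableSet_biUnion _ fun n _ =>
    measurableSet_le measurable_const (((hsel q n).measurable_tilt (l q n) m).comp
      (measurable_env hE))

/-- The union bound: there are `K` events of probability at most `K⁻²` for each `q`. -/
lemma measure_failure_le [IsProbabilityMeasure μ] (hE : IsEnvironment μ ε a b)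
    (hsel : ∀ q n, IsCausal (sel q n)) (l : ι → ℕ → ℝ) {K : ℕ} (hK : 0 < K) (m : ℕ) :
    K * μ.real (failure ε a b sel l K m) ≤ Fintype.card ι := by
  have hK' : (0 : ℝ) < K := by exact_mod_cast hK
  have h1 : μ.real (failure ε a b sel l K m) ≤
      ∑ q : ι, ∑ n ∈ Finset.Icc 1 K, 1 / (K : ℝ) ^ 2 := by
    refine (measureReal_iUnion_fintype_le _).trans (Finset.sum_le_sum fun q _ => ?_)
    refine (measureReal_biUnion_finset_le _ _).trans (Finset.sum_le_sum fun n _ => ?_)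
    exact measure_tilt_ge_le hE (hsel q n) (l q n) m hK'
  calc _ ≤ (K : ℝ) * ∑ q : ι, ∑ n ∈ Finset.Icc 1 K, 1 / (K : ℝ) ^ 2 := by gcongr
    _ = Fintype.card ι := by
      simp only [Finset.sum_const, Nat.card_Icc, Finset.card_univ, nsmul_eq_mul,
        Nat.add_sub_cancel]
      field_simp

/-- The event that the supermartingale of a row statistic becomes large. -/
def rowFailure (ε : ℕ → Fin N → Fin M → Ω → ℝ) (a : ℕ → Ω → Fin N) (b : ℕ → Ω → Fin M)
    (u : Fin N → ℝ) (v : Fin M → ℝ) (T : ℕ) : Set Ω :=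
  failure ε a b
    (fun (q : Option (Fin M) × Fin N × Bool) n => rowSelection u v (1 / (T : ℝ)) q.1 q.2.1 n)
    (fun q n => tiltParam T n q.2.2) T T

/-- The event that the supermartingale of a column statistic in window `w` becomes large. -/
def colFailure (ε : ℕ → Fin N → Fin M → Ω → ℝ) (a : ℕ → Ω → Fin N) (b : ℕ → Ω → Fin M)
    (u : Fin N → ℝ) (v : Fin M → ℝ) (T w : ℕ) : Set Ω :=
  failure ε a b
    (fun (q : Option (Fin N) × Fin M × Bool) n => colSelection u v (1 / (T : ℝ)) w q.1 q.2.1 n)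
    (fun q n => tiltParam (blockLength w) n q.2.2) (blockLength w) T

lemma measurableSet_rowFailure (hE : IsEnvironment μ ε a b) (u : Fin N → ℝ) (v : Fin M → ℝ)
    (T : ℕ) : MeasurableSet (rowFailure ε a b u v T) :=
  measurableSet_failure hE
    (sel := fun (q : Option (Fin M) × Fin N × Bool) n =>
      rowSelection u v (1 / (T : ℝ)) q.1 q.2.1 n)
    (fun q n => rowSelection_isCausal u v (1 / (T : ℝ)) q.1 q.2.1 n)
    (fun q n => tiltParam T n q.2.2) T T

lemma measurableSet_colFailure (hE : IsEnvironment μ ε a b) (u : Fin N → ℝ) (v : Fin M → ℝ)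
    (T w : ℕ) : MeasurableSet (colFailure ε a b u v T w) :=
  measurableSet_failure hE
    (sel := fun (q : Option (Fin N) × Fin M × Bool) n =>
      colSelection u v (1 / (T : ℝ)) w q.1 q.2.1 n)
    (fun q n => colSelection_isCausal u v (1 / (T : ℝ)) w q.1 q.2.1 n)
    (fun q n => tiltParam (blockLength w) n q.2.2) (blockLength w) T

lemma measure_rowFailure_le [IsProbabilityMeasure μ] (hE : IsEnvironment μ ε a b) (u : Fin N → ℝ)
    (v : Fin M → ℝ) {T : ℕ} (hT : 0 < T) :
    (T : ℝ) * μ.real (rowFailure ε a b u v T) ≤ (M + 1) * (N * 2) := by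
  refine (measure_failure_le hE
    (sel := fun (q : Option (Fin M) × Fin N × Bool) n =>
      rowSelection u v (1 / (T : ℝ)) q.1 q.2.1 n)
    (fun q n => rowSelection_isCausal u v (1 / (T : ℝ)) q.1 q.2.1 n)
    (fun q n => tiltParam T n q.2.2) hT T).trans (le_of_eq ?_)
  simp

lemma measure_colFailure_le [IsProbabilityMeasure μ] (hE : IsEnvironment μ ε a b) (u : Fin N → ℝ)
    (v : Fin M → ℝ) (T w : ℕ) :
    (blockLength w : ℝ) * μ.real (colFailure ε a b u v T w) ≤ (N + 1) * (M * 2) := by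
  refine (measure_failure_le hE
    (sel := fun (q : Option (Fin N) × Fin M × Bool) n =>
      colSelection u v (1 / (T : ℝ)) w q.1 q.2.1 n)
    (fun q n => colSelection_isCausal u v (1 / (T : ℝ)) w q.1 q.2.1 n)
    (fun q n => tiltParam (blockLength w) n q.2.2)
    (zero_lt_two.trans_le (two_le_blockLength w)) T).trans (le_of_eq ?_)
  simp

omit [MeasurableSpace Ω] in
lemma rowAccurate_of_notMem_rowFailure {u : Fin N → ℝ} {v : Fin M → ℝ} {T : ℕ} (hT : 2 ≤ T)
    {ω : Ω} (hω : ω ∉ rowFailure ε a b u v T) :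
    RowAccurate u v T (observations u v fun t i j => ε t i j ω) (fun n => a n ω)
      (fun n => b n ω) := by
  refine rowAccurate_of_tilt_lt u v hT fun k i n hn sgn => ?_
  by_contra hlt
  exact hω (Set.mem_iUnion.2 ⟨(k, i, sgn), Set.mem_iUnion₂.2 ⟨n, hn, not_lt.1 hlt⟩⟩)

omit [MeasurableSpace Ω] in
lemma colAccurate_of_notMem_colFailure {u : Fin N → ℝ} {v : Fin M → ℝ} {T w : ℕ}
    {ω : Ω} (hω : ω ∉ colFailure ε a b u v T w) :
    ColAccurate u v T (observations u v fun t i j => ε t i j ω) (fun n => a n ω)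
      (fun n => b n ω) w := by
  refine colAccurate_of_tilt_lt u v w fun k j n hn sgn => ?_
  by_contra hlt
  exact hω (Set.mem_iUnion.2 ⟨(k, j, sgn), Set.mem_iUnion₂.2 ⟨n, hn, not_lt.1 hlt⟩⟩)

end Failure

/-- The index of the window of step `m` is of the order of `log log m`. -/
lemma two_pow_w_le (δ : ℝ) (x : ℕ → Fin N → Fin M → ℝ) (a : ℕ → Fin N) (b : ℕ → Fin M) {m : ℕ}
    {y : ℝ} (hy : 1 ≤ y) (hm : (m : ℝ) * (N + M) ≤ y) :
    (2 : ℝ) ^ (run δ x a b m).w ≤ 1 + 4 * Real.log y := by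
  have hlog := Real.log_nonneg hy
  rcases hw : (run δ x a b m).w with _ | w
  · simpa using hlog
  · have h1 := blockLength_le_t δ x a b m w (by omega)
    have h2 := run_t_le δ x a b m
    have h3 : ((blockLength w : ℕ) : ℝ) ≤ y := by
      refine le_trans ?_ hm
      exact_mod_cast h1.trans h2
    have h4 := Real.log_le_log (by exact_mod_cast zero_lt_two.trans_le (two_le_blockLength w)) h3
    unfold blockLength at h4
    push_cast at h4
    rw [Real.log_pow] at h4
    push_cast at h4
    have := Real.log_two_gt_d9
    have h5 : (0 : ℝ) < 2 ^ w := by positivity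
    rw [pow_succ]
    nlinarith

lemma complexityA_eq {u : Fin N → ℝ} {v : Fin M → ℝ} {i₀ : Fin N} {j₀ : Fin M}
    (h₀ : ∀ i, i ≠ i₀ → u i < u i₀) (k₀ : ∀ j, j ≠ j₀ → v j < v j₀) :
    complexityA u v = ∑ i ∈ Finset.univ.filter (· ≠ i₀), 1 / (v j₀ * (u i₀ - u i)) +
      ∑ j ∈ Finset.univ.filter (· ≠ j₀), 1 / (u i₀ * (v j₀ - v j)) := by
  classical
  have hgap : ∀ {n : ℕ} {u : Fin n → ℝ} {i₀ : Fin n}, (∀ i, i ≠ i₀ → u i < u i₀) → ∀ i,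
      0 < gap u i ↔ i ≠ i₀ := by
    intro n u i₀ h₀ i
    rw [gap, iSup_eq_best h₀, sub_pos]
    exact ⟨fun h hi => by rw [hi] at h; exact lt_irrefl _ h, h₀ i⟩
  unfold complexityA
  simp only [hgap h₀, hgap k₀]
  simp only [gap, iSup_eq_best h₀, iSup_eq_best k₀]

lemma measurable_observations_env {Ω : Type*} [MeasurableSpace Ω] {μ : Measure Ω}
    {ε : ℕ → Fin N → Fin M → Ω → ℝ} {a : ℕ → Ω → Fin N} {b : ℕ → Ω → Fin M}
    (hE : IsEnvironment μ ε a b) (u : Fin N → ℝ) (v : Fin M → ℝ) (t : ℕ) (i : Fin N) (j : Fin M) :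
    Measurable fun ω => observations u v (fun t i j => ε t i j ω) t i j :=
  measurable_const.add (hE.measurable_noise t i j)

section Bound

variable {u : Fin N → ℝ} {v : Fin M → ℝ} {i₀ : Fin N} {j₀ : Fin M}
  (hu : ∀ i, u i ∈ Set.Ioo (0 : ℝ) 1) (hv : ∀ j, v j ∈ Set.Ioo (0 : ℝ) 1)
  (h₀ : ∀ i, i ≠ i₀ → u i < u i₀) (k₀ : ∀ j, j ≠ j₀ → v j < v j₀)
  {Ω : Type*} [MeasurableSpace Ω] {μ : Measure Ω} [IsProbabilityMeasure μ]
  {ε : ℕ → Fin N → Fin M → Ω → ℝ} {a : ℕ → Ω → Fin N} {b : ℕ → Ω → Fin M}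
  (hE : IsEnvironment μ ε a b)

include hu hv h₀ k₀ hE in
lemma integrable_regret (T : ℕ) : Integrable (fun ω => regret u v (1 / (T : ℝ))
    (observations u v fun t i j => ε t i j ω) (fun n => a n ω) (fun n => b n ω) T) μ := by
  refine Integrable.of_mem_Icc 0 T ?_ (Filter.Eventually.of_forall fun ω =>
    regret_mem_Icc _ _ _ _ hu hv h₀ k₀ T)
  exact (measurable_regret (measurable_observations_env hE u v) hE.measurable_row
    hE.measurable_col (1 / (T : ℝ)) u v T).aemeasurable

include hu hv h₀ k₀ hE in
/-- The expected regret in terms of the number `W` of windows and the bound `Λ` on `2 ^ w` for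
the early windows `w`. -/
lemma integral_regret_le {T : ℕ} (hT : 2 ≤ T) {c : ℝ} (hc : IsMargin u v i₀ j₀ c) {W : ℕ} {Λ : ℝ}
    (hΛ0 : 0 ≤ Λ)
    (hW : ∀ (x : ℕ → Fin N → Fin M → ℝ) (a : ℕ → Fin N) (b : ℕ → Fin M),
      ∀ m < T, (run (1 / (T : ℝ)) x a b m).w < W)
    (hΛ : ∀ (x : ℕ → Fin N → Fin M → ℝ) (a : ℕ → Fin N) (b : ℕ → Fin M),
      ∀ m < T, (m : ℝ) ≤ 256 / c ^ 4 * Real.log T →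
      (2 : ℝ) ^ (run (1 / (T : ℝ)) x a b m).w ≤ Λ) :
    ∫ ω, regret u v (1 / (T : ℝ)) (observations u v fun t i j => ε t i j ω) (fun n => a n ω)
        (fun n => b n ω) T ∂μ ≤
      512 * Real.log T * ∑ i ∈ Finset.univ.filter (· ≠ i₀), 1 / (v j₀ * (u i₀ - u i)) +
      512 * 2 ^ W * ∑ j ∈ Finset.univ.filter (· ≠ j₀), 1 / (u i₀ * (v j₀ - v j)) +
      17 * (N + M) * (W * ((N + 1) * (M * 2)) + 512 / c ^ 4 * Λ) + (M + 1) * (N * 2) := by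
  classical
  set A : ℝ := 512 * Real.log T * ∑ i ∈ Finset.univ.filter (· ≠ i₀), 1 / (v j₀ * (u i₀ - u i)) +
      512 * 2 ^ W * ∑ j ∈ Finset.univ.filter (· ≠ j₀), 1 / (u i₀ * (v j₀ - v j)) with hA
  have hA0 : 0 ≤ A := by
    have hlog := Real.log_natCast_nonneg T
    refine add_nonneg (mul_nonneg (by positivity) (Finset.sum_nonneg fun i _ => ?_))
      (mul_nonneg (by positivity) (Finset.sum_nonneg fun j _ => ?_))
    · exact one_div_nonneg.2 (mul_nonneg (hv j₀).1.le (sub_nonneg.2 (le_of_best h₀ i)))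
    · exact one_div_nonneg.2 (mul_nonneg (hu i₀).1.le (sub_nonneg.2 (le_of_best k₀ j)))
  set FR : Set Ω := rowFailure ε a b u v T
  set FC : ℕ → Set Ω := colFailure ε a b u v T
  have hFRm : MeasurableSet FR := measurableSet_rowFailure hE u v T
  have hFCm : ∀ w, MeasurableSet (FC w) := measurableSet_colFailure hE u v T
  have hFRp : (T : ℝ) * μ.real FR ≤ (M + 1) * (N * 2) :=
    measure_rowFailure_le hE u v (by omega)
  have hFCp : ∀ w, (blockLength w : ℝ) * μ.real (FC w) ≤ (N + 1) * (M * 2) :=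
    measure_colFailure_le hE u v T
  have hpoint : ∀ ω, regret u v (1 / (T : ℝ)) (observations u v fun t i j => ε t i j ω)
      (fun n => a n ω) (fun n => b n ω) T ≤
      (A + 17 * (N + M) * (512 / c ^ 4 * Λ)) + FR.indicator (fun _ => (T : ℝ)) ω +
        17 * (N + M) * ∑ w ∈ Finset.range W, (FC w).indicator (fun _ => (blockLength w : ℝ)) ω := by
    intro ω
    have hc0 := hc.pos
    have hsum0 : 0 ≤ ∑ w ∈ Finset.range W, (FC w).indicator (fun _ => (blockLength w : ℝ)) ω :=
      Finset.sum_nonneg fun w _ => Set.indicator_nonneg (fun _ _ => Nat.cast_nonneg _) _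
    by_cases hω : ω ∈ FR
    · rw [Set.indicator_of_mem hω]
      have h1 := (regret_mem_Icc (1 / (T : ℝ)) (observations u v fun t i j => ε t i j ω)
        (fun n => a n ω) (fun n => b n ω) hu hv h₀ k₀ T).2
      have h2 : 0 ≤ 17 * ((N : ℝ) + M) * (512 / c ^ 4 * Λ) := by positivity
      have h3 : 0 ≤ 17 * ((N : ℝ) + M) *
        ∑ w ∈ Finset.range W, (FC w).indicator (fun _ => (blockLength w : ℝ)) ω := by positivity
      linarith
    · rw [Set.indicator_of_notMem hω, add_zero]
      have hrow : RowAccurate u v T (observations u v fun t i j => ε t i j ω)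
          (fun n => a n ω) (fun n => b n ω) := rowAccurate_of_notMem_rowFailure hT hω
      have hmain := regret_le_of_rowAccurate hu hv h₀ k₀ hT hc hΛ0 hrow (hW _ _ _) (hΛ _ _ _)
      have hfail : failedLength u v T (observations u v fun t i j => ε t i j ω) (fun n => a n ω)
          (fun n => b n ω) W ≤
          ∑ w ∈ Finset.range W, (FC w).indicator (fun _ => (blockLength w : ℝ)) ω := by
        refine Finset.sum_le_sum fun w _ => ?_
        by_cases hw : ω ∈ FC w
        · rw [Set.indicator_of_mem hw]
          split_ifs
          · exact Nat.cast_nonneg _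
          · exact le_rfl
        · rw [if_pos]
          · exact Set.indicator_nonneg (fun _ _ => Nat.cast_nonneg _) _
          exact colAccurate_of_notMem_colFailure hw
      calc _ ≤ _ := hmain
        _ ≤ A + 17 * (N + M) * (∑ w ∈ Finset.range W,
            (FC w).indicator (fun _ => (blockLength w : ℝ)) ω + 512 / c ^ 4 * Λ) := by
          rw [hA]; gcongr
        _ = _ := by ring
  have hint1 : Integrable (fun ω => FR.indicator (fun _ => (T : ℝ)) ω) μ :=
    (integrable_const _).indicator hFRm
  have hint2 : ∀ w, Integrable (fun ω => (FC w).indicator (fun _ => (blockLength w : ℝ)) ω) μ :=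
    fun w => (integrable_const _).indicator (hFCm w)
  have hint3 : Integrable (fun ω => 17 * ((N : ℝ) + M) *
      ∑ w ∈ Finset.range W, (FC w).indicator (fun _ => (blockLength w : ℝ)) ω) μ :=
    (integrable_finsetSum _ fun w _ => hint2 w).const_mul _
  have hconst : Integrable (fun _ : Ω => A + 17 * ((N : ℝ) + M) * (512 / c ^ 4 * Λ)) μ :=
    integrable_const _
  have hint12 : Integrable (fun ω => (A + 17 * ((N : ℝ) + M) * (512 / c ^ 4 * Λ)) +
      FR.indicator (fun _ => (T : ℝ)) ω) μ := hconst.add hint1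
  refine (integral_mono (integrable_regret hu hv h₀ k₀ hE T) (hint12.add hint3)
    hpoint).trans ?_
  have heq : ∫ ω, ((A + 17 * ((N : ℝ) + M) * (512 / c ^ 4 * Λ)) +
      FR.indicator (fun _ => (T : ℝ)) ω) + 17 * ((N : ℝ) + M) *
      ∑ w ∈ Finset.range W, (FC w).indicator (fun _ => (blockLength w : ℝ)) ω ∂μ =
      (A + 17 * ((N : ℝ) + M) * (512 / c ^ 4 * Λ)) + T * μ.real FR +
      17 * ((N : ℝ) + M) * ∑ w ∈ Finset.range W, (blockLength w : ℝ) * μ.real (FC w) := by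
    rw [integral_add hint12 hint3, integral_add hconst hint1, integral_const_mul,
      integral_finsetSum _ fun w _ => hint2 w, integral_indicator_const _ hFRm]
    simp only [integral_indicator_const _ (hFCm _), smul_eq_mul, integral_const, probReal_univ,
      one_mul, mul_comm (μ.real _)]
  refine (le_of_eq heq).trans ?_
  have hsum : ∑ w ∈ Finset.range W, (blockLength w : ℝ) * μ.real (FC w) ≤
      W * ((N + 1) * (M * 2)) := by
    refine (Finset.sum_le_sum fun w _ => hFCp w).trans (le_of_eq ?_)
    simp
  calc _ ≤ (A + 17 * ((N : ℝ) + M) * (512 / c ^ 4 * Λ)) + (M + 1) * (N * 2) +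
        17 * ((N : ℝ) + M) * (W * ((N + 1) * (M * 2))) := by gcongr
    _ = _ := by ring

end Bound

end Expectation

lemma one_lt_log_three : 1 < Real.log 3 := by
  rw [Real.lt_log_iff_exp_lt (by norm_num)]
  linarith [Real.exp_one_lt_d9]

end PairElim

end

theorem theorem1 :
    ∃ c_u : ℝ, 0 < c_u ∧
      ∀ (N M : ℕ) (u : Fin N → ℝ) (v : Fin M → ℝ),
        (∀ i, u i ∈ Set.Ioo (0 : ℝ) 1) → (∀ j, v j ∈ Set.Ioo (0 : ℝ) 1) →
        (∃ i₀, ∀ i, i ≠ i₀ → u i < u i₀) → (∃ j₀, ∀ j, j ≠ j₀ → v j < v j₀) →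
        ∃ c_p : ℝ,
          ∀ {Ω : Type*} [MeasurableSpace Ω] (μ : Measure Ω) [IsProbabilityMeasure μ]
            (ε : ℕ → Fin N → Fin M → Ω → ℝ) (a : ℕ → Ω → Fin N) (b : ℕ → Ω → Fin M),
            PairElim.IsEnvironment μ ε a b →
            ∀ T : ℕ, 3 ≤ T →
              Integrable (fun ω => PairElim.regret u v (1 / (T : ℝ))
                (fun t i j => u i * v j + ε t i j ω) (fun n => a n ω) (fun n => b n ω) T) μ ∧
              ∫ ω, PairElim.regret u v (1 / (T : ℝ))
                (fun t i j => u i * v j + ε t i j ω) (fun n => a n ω) (fun n => b n ω) T ∂μ ≤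
                c_u * PairElim.complexityA u v * Real.log T +
                  c_p * Real.log (Real.log T) := by
  -- `4096 = 512 * 8`: the sum of `2 ^ w` over all windows is at most `8 log T` up to a constant.
  refine ⟨4096, by norm_num, fun N M u v hu hv ⟨i₀, h₀⟩ ⟨j₀, k₀⟩ => ?_⟩
  obtain ⟨c, hc⟩ := PairElim.exists_isMargin hu hv h₀ k₀
  have hc0 := hc.pos
  set AU : ℝ := ∑ i ∈ Finset.univ.filter (· ≠ i₀), 1 / (v j₀ * (u i₀ - u i)) with hAU
  set AV : ℝ := ∑ j ∈ Finset.univ.filter (· ≠ j₀), 1 / (u i₀ * (v j₀ - v j)) with hAV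
  have hAU0 : 0 ≤ AU := Finset.sum_nonneg fun i _ =>
    one_div_nonneg.2 (mul_nonneg (hv j₀).1.le (sub_nonneg.2 (PairElim.le_of_best h₀ i)))
  have hAV0 : 0 ≤ AV := Finset.sum_nonneg fun j _ =>
    one_div_nonneg.2 (mul_nonneg (hu i₀).1.le (sub_nonneg.2 (PairElim.le_of_best k₀ j)))
  set D : ℝ := (N : ℝ) + M with hD
  have hD1 : 1 ≤ D := by
    have h1 : 1 ≤ N := i₀.pos
    have h2 : (1 : ℝ) ≤ N := by exact_mod_cast h1
    have h3 : (0 : ℝ) ≤ M := Nat.cast_nonneg M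
    linarith
  set K : ℝ := 256 / c ^ 4 with hK
  have hK1 : 1 ≤ K := by
    rw [hK, one_le_div (by positivity)]
    have := pow_le_one₀ (n := 4) hc0.le hc.le_one
    linarith
  set P : ℝ := 512 * (2 + 8 * Real.log D) * AV + (M + 1) * (N * 2) +
    17 * D * (2 * Real.log (10 + 8 * Real.log D) * ((N + 1) * (M * 2)) +
      2 * K * (1 + 4 * Real.log (K * D))) with hP
  set Q : ℝ := 17 * D * (2 * ((N + 1) * (M * 2)) + 2 * K * 4) with hQ
  have hlogD : 0 ≤ Real.log D := Real.log_nonneg hD1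
  have hP0 : 0 ≤ P := by
    have h1 : 0 ≤ Real.log (10 + 8 * Real.log D) := Real.log_nonneg (by linarith)
    have h2 : 0 ≤ Real.log (K * D) := Real.log_nonneg (one_le_mul_of_one_le_of_one_le hK1 hD1)
    positivity
  refine ⟨P / Real.log (Real.log 3) + Q, fun μ _ ε a b hE T hT => ?_⟩
  refine ⟨PairElim.integrable_regret hu hv h₀ k₀ hE T, ?_⟩
  have hT' : (3 : ℝ) ≤ T := by exact_mod_cast hT
  have hlog3 := PairElim.one_lt_log_three
  have hlogT : Real.log 3 ≤ Real.log T := Real.log_le_log (by norm_num) hT'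
  have hL1 : 1 ≤ Real.log T := hlog3.le.trans hlogT
  have hLL : Real.log (Real.log 3) ≤ Real.log (Real.log T) :=
    Real.log_le_log (by linarith) hlogT
  -- All windows of the first `T` steps have `2 ^ w ≤ Y`, the early ones have `2 ^ w ≤ Λ`.
  set Y : ℝ := 1 + 4 * Real.log (T * D) with hY
  set Λ : ℝ := 1 + 4 * Real.log (K * Real.log T * D) with hΛ
  have hTD : 1 ≤ T * D := one_le_mul_of_one_le_of_one_le (by linarith) hD1
  have hKLD : 1 ≤ K * Real.log T * D :=
    one_le_mul_of_one_le_of_one_le (one_le_mul_of_one_le_of_one_le hK1 hL1) hD1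
  have hYeq : Y = 1 + 4 * Real.log T + 4 * Real.log D := by
    rw [hY, Real.log_mul (by positivity) (by positivity)]; ring
  have hΛeq : Λ = 1 + 4 * Real.log (K * D) + 4 * Real.log (Real.log T) := by
    rw [hΛ, mul_right_comm, Real.log_mul (by positivity) (by positivity)]; ring
  have hY1 : 1 ≤ Y := by linarith
  set W : ℕ := Nat.log 2 ⌊Y⌋₊ + 1 with hW
  have hfloor : ⌊Y⌋₊ ≠ 0 := (Nat.floor_pos.2 hY1).ne'
  have h2W : (2 : ℝ) ^ W ≤ 2 * Y := by
    have h1 : 2 ^ Nat.log 2 ⌊Y⌋₊ ≤ ⌊Y⌋₊ := Nat.pow_log_le_self 2 hfloor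
    have h2 : ((2 ^ Nat.log 2 ⌊Y⌋₊ : ℕ) : ℝ) ≤ Y :=
      (Nat.cast_le.2 h1).trans (Nat.floor_le (by linarith))
    push_cast at h2
    rw [hW, pow_succ]
    linarith
  have hWle : (W : ℝ) ≤ 2 * Real.log (10 + 8 * Real.log D) + 2 * Real.log (Real.log T) := by
    have h1 := Real.log_le_log (by positivity) h2W
    rw [Real.log_pow] at h1
    have h2 : 2 * Y ≤ (10 + 8 * Real.log D) * Real.log T := by
      have := le_mul_of_one_le_right hlogD hL1
      rw [hYeq]
      linarith
    have h3 := Real.log_le_log (by positivity) h2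
    have h6 : Real.log ((10 + 8 * Real.log D) * Real.log T) =
        Real.log (10 + 8 * Real.log D) + Real.log (Real.log T) :=
      Real.log_mul (by positivity) (by positivity)
    rw [h6] at h3
    have h4 := Real.log_two_gt_d9
    have h5 : (W : ℝ) * (1 / 2) ≤ W * Real.log 2 := by
      gcongr
      linarith
    linarith
  have hmain := PairElim.integral_regret_le hu hv h₀ k₀ hE (by omega : 2 ≤ T) hc (W := W) (Λ := Λ)
    (by have := Real.log_nonneg hKLD; positivity)
    (fun x a b m hm => by
      have h1 := PairElim.two_pow_w_le (1 / (T : ℝ)) x a b hTD (m := m) (by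
        have : (m : ℝ) ≤ T := by exact_mod_cast hm.le
        gcongr)
      rw [hW, Nat.lt_succ_iff]
      refine Nat.le_log_of_pow_le one_lt_two (Nat.le_floor ?_)
      push_cast
      exact h1)
    (fun x a b m _ hm => PairElim.two_pow_w_le (1 / (T : ℝ)) x a b hKLD (by gcongr))
  refine hmain.trans ?_
  rw [PairElim.complexityA_eq h₀ k₀, ← hAU, ← hAV]
  -- Constants are absorbed into `log (log T)`, which is at least `log (log 3) > 0`.
  have hPdiv : P ≤ P / Real.log (Real.log 3) * Real.log (Real.log T) := by
    rw [div_mul_eq_mul_div, le_div_iff₀ (Real.log_pos hlog3)]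
    gcongr
  have h512 : 512 / c ^ 4 = 2 * K := by rw [hK]; ring
  rw [h512, hΛeq]
  calc _ ≤ 512 * Real.log T * AU + 512 * (2 * (1 + 4 * Real.log T + 4 * Real.log D)) * AV +
        17 * D * ((2 * Real.log (10 + 8 * Real.log D) + 2 * Real.log (Real.log T)) *
          ((N + 1) * (M * 2)) +
          2 * K * (1 + 4 * Real.log (K * D) + 4 * Real.log (Real.log T))) +
        (M + 1) * (N * 2) := by
        rw [← hYeq]
        gcongr
    _ = 512 * Real.log T * AU + 4096 * Real.log T * AV + P + Q * Real.log (Real.log T) := by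
        rw [hP, hQ]; ring
    _ ≤ 4096 * (AU + AV) * Real.log T +
        (P / Real.log (Real.log 3) + Q) * Real.log (Real.log T) := by
        have : 0 ≤ Real.log T * AU := by positivity
        linarith
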